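/- Let $K$ be a commutative ring containing $\mathbb{Q}$, graded by $\mathbb{Z}$ and concentrated in even degrees. Let $V$ be a free graded $K$-module with homogeneous basis $(v_i)_{i\in I}$, put $(\Sigma V)^n=V^{n+1}$ and $W=\Sigma V^*=\mathrm{Hom}_K(\Sigma V,K)$, a profinite graded module with topological basis $(t_i)_{i\in I}$ dual to $(\Sigma v_i)$, so $|t_i|=1-|v_i|$. Let $\widehat{T}W=\prod_{n\ge 0}W^{\hat\otimes n}=K\langle\langle t_i\rangle\rangle$ be the completed tensor algebra, with the product topology, let $\widehat{T}_{+}W=\prod_{n\ge1}W^{\hat\otimes n}=W\hat\otimes\widehat{T}W$, and let $\widehat{L}W\subset\widehat{T}W$ be the pro-free graded Lie algebra, consisting of the convergent infinite linear combinations of Lie monomials in the $t_i$ for the graded commutator. A $C_\infty$-structure on $V$ is a continuous derivation $m$ of $\widehat{L}W$ of degree $1$ with $m^2=0$; it extends uniquely to a continuous derivation, again denoted $m$, of $\widehat{T}W$. Fix such an $m$. Let $\Delta:\widehat{T}W\to\widehat{T}W\hat\otimes\widehat{T}W$ be the shuffle coproduct, i.e. the continuous algebra homomorphism with $\Delta(t_i)=t_i\otimes1+1\otimes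 t_i$, let $\mu$ be the multiplication of $\widehat{T}W$, and let $s=\mu\Delta$; it preserves each $W^{\hat\otimes n}$, where it is denoted $s_n$. Let $e(j)$, $j\ge0$, be the operator on $\widehat{T}W$ whose restriction to $W^{\hat\otimes n}$ is $$e_n(j)=\prod_{0\le r\le n,\ r\ne j}\frac{s_n-2^r}{2^j-2^r}\quad(j\le n),\qquad e_n(j)=0\quad(j>n).$$ On $\widehat{T}_+W=W\hat\otimes\widehat{T}W$ let $\tilde s=1\hat\otimes s$ and $\tilde e(j)=1\hat\otimes e(j)$. The bar complex $\mathrm{CBar}(V)$ is $\Sigma(\widehat{T}_+W)$ with differential $b'=m|_{\widehat{T}_+W}$. Let $\Omega^1=\widehat{T}W\hat\otimes(\widehat{T}W/K)$ be the bimodule of noncommutative 1-forms $x\,dy$ of $\widehat{T}W$ (in the differential envelope, where $d$ is a derivation of degree $1$), let $DR^1(\widehat{T}W)$ be its quotient by the closed submodule generated by the graded commutators of elements of $\widehat{T}W$ with 1-forms, graded by $|x\,dy|=|x|+|y|$, and let $L_m$ be the Lie derivative, $L_m(x\,dy)=m(x)\,dy-(-1)^{|x|}x\,d(m(y))$. The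 Hochschild complex $C(V,V^*)$ is $\Sigma DR^1(\widehat{T}W)$ with differential $L_m$. Then: (i) For every $j\ge1$ the operator $e(j)$ on $\widehat{T}_+W$ is an idempotent whose image is the eigenspace of $s$ with eigenvalue $2^j$; it commutes with $b'$, so that $\Sigma(e(j)[\widehat{T}_+W])$ is a subcomplex of the bar complex; and $x\mapsto(e(j)x)_j$ is an isomorphism of complexes of graded topological modules $$\mathrm{CBar}(V)=\prod_{j\ge1}\bigl(\Sigma(e(j)[\widehat{T}_+W]),b'\bigr),$$ with inverse $(y_j)_j\mapsto\sum_j y_j$. (ii) The map $\Theta:\widehat{T}_+W=W\hat\otimes\widehat{T}W\to DR^1(\widehat{T}W)$, $\Theta(x\otimes y)=dx\cdot y$, is an isomorphism of graded topological modules. Let $b=\Theta^{-1}L_m\Theta$. For every $j\ge0$ the operator $\tilde e(j)$ is an idempotent whose image is the eigenspace of $\tilde s$ with eigenvalue $2^j$; it commutes with $b$, so that $\Sigma(\tilde e(j)[\widehat{T}_+W])$ is a subcomplex of $(\Sigma(\widehat{T}_+W),b)\cong C(V,V^*)$; and $x\mapsto(\tilde e(j)x)_j$ is an isomorphism of complexes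 of graded topological modules $$C(V,V^*)\cong(\Sigma(\widehat{T}_+W),b)=\prod_{j\ge0}\bigl(\Sigma(\tilde e(j)[\widehat{T}_+W]),b\bigr),$$ with inverse $(y_j)_j\mapsto\sum_j y_j$. -/

import Mathlib

namespace FormalGeometry

/-! ## Profinite modules -/

/-- The profinite (= topologically free) `K`-module with topological basis `X`: its elements are the
arbitrary, possibly infinite, linear combinations of elements of `X`. It is the inverse limit of
the free modules `F → K` over the finite subsets `F` of `X`, and it is the linear dual of the free
`K`-module on `X`. -/
def ProMod (X K : Type*) : Type _ := X → K

namespace ProMod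

variable {X K : Type*}

/-- The inverse limit topology: the product topology, every factor `K` being discrete. -/
instance : TopologicalSpace (ProMod X K) := @Pi.topologicalSpace X (fun _ => K) (fun _ => ⊥)

@[ext] theorem ext {x y : ProMod X K} (h : ∀ w, x w = y w) : x = y := funext h

theorem continuous_iff {Y : Type*} [TopologicalSpace Y] {f : Y → ProMod X K} :
    Continuous f ↔ ∀ w, @Continuous Y K _ ⊥ (fun y => f y w) := by
  let _ : TopologicalSpace K := ⊥
  exact continuous_pi_iff

theorem continuous_coord (w : X) : @Continuous (ProMod X K) K _ ⊥ (fun x => x w) := by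
  let _ : TopologicalSpace K := ⊥
  exact continuous_apply w

variable [CommRing K]

instance : AddCommGroup (ProMod X K) := inferInstanceAs (AddCommGroup (X → K))

instance : Module K (ProMod X K) := inferInstanceAs (Module K (X → K))

@[simp] theorem add_apply (x y : ProMod X K) (w : X) : (x + y) w = x w + y w := rfl
@[simp] theorem sub_apply (x y : ProMod X K) (w : X) : (x - y) w = x w - y w := rfl
@[simp] theorem neg_apply (x : ProMod X K) (w : X) : (-x) w = -x w := rfl
@[simp] theorem smul_apply (c : K) (x : ProMod X K) (w : X) : (c • x) w = c * x w := rfl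
@[simp] theorem zero_apply (w : X) : (0 : ProMod X K) w = 0 := rfl
instance : IsTopologicalAddGroup (ProMod X K) := by
  let _ : TopologicalSpace K := ⊥
  have : DiscreteTopology K := ⟨rfl⟩
  exact inferInstanceAs (IsTopologicalAddGroup (X → K))

instance : ContinuousConstSMul K (ProMod X K) := by
  let _ : TopologicalSpace K := ⊥
  have : DiscreteTopology K := ⟨rfl⟩
  exact inferInstanceAs (ContinuousConstSMul K (X → K))

end ProMod

/-! ## Gradings -/

/-- The ground ring is evenly graded: it has no homogeneous components of odd degree. -/
class EvenlyGraded {K : Type*} [CommRing K] (𝒦 : ℤ → AddSubgroup K) : Prop where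
  eq_bot_of_odd : ∀ n : ℤ, Odd n → 𝒦 n = ⊥

/-- A basis of the `K`-module `V` consisting of homogeneous elements for the grading `𝒱`: it exhibits
`V` as a free graded module. -/
structure HomogeneousBasis (K : Type*) [CommRing K] {V : Type*} [AddCommGroup V] [Module K V]
    (𝒱 : ℤ → AddSubgroup V) (ι : Type*) where
  toBasis : Module.Basis ι K V
  degree : ι → ℤ
  mem : ∀ i, toBasis i ∈ 𝒱 (degree i)

/-- The degree of the element `t_i` of the topological basis of `ΣV*` dual to the basis `Σv_i` of
`ΣV`, where `(ΣV)^n = V^(n+1)`. -/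
def HomogeneousBasis.dualDegree {K : Type*} [CommRing K] {V : Type*} [AddCommGroup V] [Module K V]
    {𝒱 : ℤ → AddSubgroup V} {ι : Type*} (B : HomogeneousBasis K 𝒱 ι) : ι → ℤ :=
  fun i => 1 - B.degree i

/-- The sign `(-1)^n`. -/
def sgn (K : Type*) [CommRing K] (n : ℤ) : K := ((n.negOnePow : ℤ) : K)

/-- The degree of the monomial `t_{i₁} ⋯ t_{iₙ}`, where `d i` is the degree of `t_i`. -/
def wordDeg {ι : Type*} (d : ι → ℤ) (w : List ι) : ℤ := (w.map d).sum

/-! ## The completed tensor algebra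

`W` is the profinite graded module with topological basis `t_i`, `i : ι`, with `t_i` of degree
`d i`. -/

/-- The completed tensor algebra `T̂W = ∏ₙ W^{⊗̂n} = K⟨⟨t⟩⟩`: noncommutative power series, given by
their coefficients at the words in the `t_i`. -/
abbrev TSeries (ι K : Type*) : Type _ := ProMod (List ι) K

/-- The completed tensor product `T̂W ⊗̂ T̂W`. -/
abbrev TSeries₂ (ι K : Type*) : Type _ := ProMod (List ι × List ι) K

section Algebra

variable {ι K : Type*} [CommRing K]

open Classical in
/-- The generator `t_i`. -/
noncomputable def gen (i : ι) : TSeries ι K := fun w => if w = [i] then 1 else 0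

open Classical in
/-- The unit of `T̂W`. -/
noncomputable def one : TSeries ι K := fun w => if w = [] then 1 else 0

/-- The associative multiplication of `T̂W` (concatenation of words). -/
def mul (x y : TSeries ι K) : TSeries ι K :=
  fun w => ∑ k ∈ Finset.range (w.length + 1), x (w.take k) * y (w.drop k)

/-- The element `x ⊗ y` of `T̂W ⊗̂ T̂W`. -/
def tens (x y : TSeries ι K) : TSeries₂ ι K := fun p => x p.1 * y p.2

/-- The linear functional "coefficient at `v`" applied to the second factor. -/
def sliceLeft (v : List ι) : TSeries₂ ι K →ₗ[K] TSeries ι K where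
  toFun F := fun u => F (u, v)
  map_add' _ _ := rfl
  map_smul' _ _ := rfl

/-- The linear functional "coefficient at `u`" applied to the first factor. -/
def sliceRight (u : List ι) : TSeries₂ ι K →ₗ[K] TSeries ι K where
  toFun F := fun v => F (u, v)
  map_add' _ _ := rfl
  map_smul' _ _ := rfl

/-- `x = x(∅) + ∑ₐ tₐ (leftPart a x)`. -/
def leftPart (a : ι) : TSeries ι K →ₗ[K] TSeries ι K where
  toFun x := fun w => x (a :: w)
  map_add' _ _ := rfl
  map_smul' _ _ := rfl

theorem leftPart_apply (a : ι) (x : TSeries ι K) (w : List ι) : leftPart a x w = x (a :: w) := rfl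

/-- The parity involution `x ↦ (-1)^{|x|} x` of `T̂W`. -/
def parity (d : ι → ℤ) (x : TSeries ι K) : TSeries ι K := fun w => sgn K (wordDeg d w) * x w

/-- The graded commutator `[x, y]` on `T̂W`, equal to `xy - (-1)^{|x||y|} yx` for homogeneous
`x` and `y`. -/
def gcomm (d : ι → ℤ) (x y : TSeries ι K) : TSeries ι K :=
  fun w => ∑ k ∈ Finset.range (w.length + 1),
    (x (w.take k) * y (w.drop k) -
      sgn K (wordDeg d (w.take k) * wordDeg d (w.drop k)) * (y (w.take k) * x (w.drop k)))

/-- The submodule of `T̂W` of the homogeneous elements of degree `n`. -/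
def homogeneous (𝒦 : ℤ → AddSubgroup K) (d : ι → ℤ) (n : ℤ) : AddSubgroup (TSeries ι K) where
  carrier := {x | ∀ w, x w ∈ 𝒦 (n - wordDeg d w)}
  add_mem' hx hy w := add_mem (hx w) (hy w)
  zero_mem' _ := zero_mem _
  neg_mem' hx w := neg_mem (hx w)

/-- The submodule of `T̂W ⊗̂ T̂W` of the homogeneous elements of degree `n`. -/
def homogeneous₂ (𝒦 : ℤ → AddSubgroup K) (d : ι → ℤ) (n : ℤ) : AddSubgroup (TSeries₂ ι K) where
  carrier := {F | ∀ u v, F (u, v) ∈ 𝒦 (n - wordDeg d u - wordDeg d v)}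
  add_mem' hx hy u v := add_mem (hx u v) (hy u v)
  zero_mem' _ _ := zero_mem _
  neg_mem' hx u v := neg_mem (hx u v)

/-- The submodule `∏_{i ≥ 1} W^{⊗̂i} = W ⊗̂ T̂W` of `T̂W`. -/
def pos (ι K : Type*) [CommRing K] : Submodule K (TSeries ι K) where
  carrier := {x | x [] = 0}
  add_mem' {x y} hx hy := by
    have h1 : x [] = 0 := hx
    have h2 : y [] = 0 := hy
    change x [] + y [] = 0
    rw [h1, h2, add_zero]
  zero_mem' := rfl
  smul_mem' c x hx := by
    have h1 : x [] = 0 := hx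
    change c * x [] = 0
    rw [h1, mul_zero]

/-! ## The pro-free Lie algebra -/

/-- Lie monomials in the generators. -/
inductive IsLieMonomial (d : ι → ℤ) : TSeries ι K → Prop
  | gen (i : ι) : IsLieMonomial d (gen i)
  | bracket {x y : TSeries ι K} (hx : IsLieMonomial d x) (hy : IsLieMonomial d y) :
      IsLieMonomial d (gcomm d x y)

/-- The pro-free Lie algebra `L̂W ⊆ T̂W`: the convergent infinite linear combinations of Lie
monomials. -/
def lieSeries (K : Type*) [CommRing K] (d : ι → ℤ) : Submodule K (TSeries ι K) :=
  (Submodule.span K {x | IsLieMonomial d x}).topologicalClosure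

/-- The generator `t_i` as an element of `L̂W`. -/
noncomputable def lieGen (d : ι → ℤ) (i : ι) : lieSeries K d :=
  ⟨gen i, subset_closure (Submodule.subset_span (IsLieMonomial.gen i))⟩

/-- `[·, y]` as a linear map. -/
def gcommLeft (d : ι → ℤ) (y : TSeries ι K) : TSeries ι K →ₗ[K] TSeries ι K where
  toFun x := gcomm d x y
  map_add' x x' := by
    ext w
    simp only [gcomm, ProMod.add_apply, ← Finset.sum_add_distrib]
    exact Finset.sum_congr rfl fun k _ => by ring
  map_smul' c x := by
    ext w
    simp only [gcomm, ProMod.smul_apply, RingHom.id_apply, Finset.mul_sum]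
    exact Finset.sum_congr rfl fun k _ => by ring

/-- `[x, ·]` as a linear map. -/
def gcommRight (d : ι → ℤ) (x : TSeries ι K) : TSeries ι K →ₗ[K] TSeries ι K where
  toFun y := gcomm d x y
  map_add' y y' := by
    ext w
    simp only [gcomm, ProMod.add_apply, ← Finset.sum_add_distrib]
    exact Finset.sum_congr rfl fun k _ => by ring
  map_smul' c y := by
    ext w
    simp only [gcomm, ProMod.smul_apply, RingHom.id_apply, Finset.mul_sum]
    exact Finset.sum_congr rfl fun k _ => by ring

theorem continuous_gcommLeft (d : ι → ℤ) (y : TSeries ι K) : Continuous (gcommLeft d y) := by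
  rw [ProMod.continuous_iff]
  intro w
  let _ : TopologicalSpace K := ⊥
  have : DiscreteTopology K := ⟨rfl⟩
  change Continuous fun x : TSeries ι K => gcomm d x y w
  unfold gcomm
  refine continuous_finsetSum _ fun k _ => ?_
  exact ((ProMod.continuous_coord _).mul continuous_const).sub
    (continuous_const.mul (continuous_const.mul (ProMod.continuous_coord _)))

theorem continuous_gcommRight (d : ι → ℤ) (x : TSeries ι K) : Continuous (gcommRight d x) := by
  rw [ProMod.continuous_iff]
  intro w
  let _ : TopologicalSpace K := ⊥
  have : DiscreteTopology K := ⟨rfl⟩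
  change Continuous fun y : TSeries ι K => gcomm d x y w
  unfold gcomm
  refine continuous_finsetSum _ fun k _ => ?_
  exact (continuous_const.mul (ProMod.continuous_coord _)).sub
    (continuous_const.mul ((ProMod.continuous_coord _).mul continuous_const))

theorem topologicalClosure_le_comap {A B : Type*} [AddCommGroup A] [Module K A] [TopologicalSpace A]
    [AddCommGroup B] [Module K B] [TopologicalSpace B] [IsTopologicalAddGroup A]
    [ContinuousConstSMul K A] [IsTopologicalAddGroup B] [ContinuousConstSMul K B]
    {f : A →ₗ[K] B} (hf : Continuous f) {s : Set A} {N : Submodule K B}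
    (hN : IsClosed (N : Set B)) (h : ∀ x ∈ s, f x ∈ N) :
    (Submodule.span K s).topologicalClosure ≤ N.comap f := by
  refine Submodule.topologicalClosure_minimal _ (Submodule.span_le.2 h) ?_
  exact hN.preimage hf

theorem isClosed_lieSeries (d : ι → ℤ) : IsClosed (lieSeries K d : Set (TSeries ι K)) :=
  Submodule.isClosed_topologicalClosure _

/-- `L̂W` is closed under the bracket. -/
theorem gcomm_mem (d : ι → ℤ) {x y : TSeries ι K} (hx : x ∈ lieSeries K d)
    (hy : y ∈ lieSeries K d) : gcomm d x y ∈ lieSeries K d := by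
  have key : ∀ x, IsLieMonomial d x → ∀ y ∈ lieSeries K d, gcomm d x y ∈ lieSeries K d := by
    intro x hx y hy
    refine topologicalClosure_le_comap (continuous_gcommRight d x) (isClosed_lieSeries d) ?_ hy
    intro y hy
    exact subset_closure (Submodule.subset_span (IsLieMonomial.bracket hx hy))
  refine topologicalClosure_le_comap (continuous_gcommLeft d y) (isClosed_lieSeries d) ?_ hx
  intro x hx
  exact key x hx y hy

theorem lieSeries_le_pos (d : ι → ℤ) : lieSeries K d ≤ pos ι K := by
  refine Submodule.topologicalClosure_minimal _ (Submodule.span_le.2 ?_) ?_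
  · intro x hx
    change x [] = 0
    induction hx with
    | gen i => simp [gen]
    | bracket _ _ h1 h2 => simp [gcomm, h1, h2]
  · let _ : TopologicalSpace K := ⊥
    have : DiscreteTopology K := ⟨rfl⟩
    exact (isClosed_discrete ({0} : Set K)).preimage (ProMod.continuous_coord [])

/-! ## `C_∞`-structures -/

/-- A `C_∞`-structure: a continuous derivation `m` of degree one of the pro-free graded Lie algebra
`L̂W`, `W = ΣV*`, with `m² = 0`. -/
structure CInfinityStructure (𝒦 : ℤ → AddSubgroup K) (d : ι → ℤ) where
  m : lieSeries K d →L[K] lieSeries K d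
  degree_one : ∀ (n : ℤ) (x : lieSeries K d), (x : TSeries ι K) ∈ homogeneous 𝒦 d n →
    (m x : TSeries ι K) ∈ homogeneous 𝒦 d (n + 1)
  leibniz : ∀ x y : lieSeries K d,
    (m ⟨gcomm d x y, gcomm_mem d x.2 y.2⟩ : TSeries ι K) =
      gcomm d (m x) y + gcomm d (parity d x) (m y)
  sq_zero : ∀ x, m (m x) = 0

/-! ## Odd vector fields on `T̂W` given by their values on the generators -/

/-- `∑ₐ φₐ · leftPart a x`. -/
noncomputable def subst (φ : ι → TSeries ι K) (x : TSeries ι K) : TSeries ι K :=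
  fun w => ∑ k ∈ Finset.range (w.length + 1), ∑ᶠ a, φ a (w.take k) * x (a :: w.drop k)

/-- The coefficient at `w` of `ξ(x)`, where `ξ` is the odd continuous derivation with `ξ(tₐ) = φₐ`,
so that `ξ(x) = ∑ₐ (φₐ · leftPart a x + (-1)^{|tₐ|} tₐ · ξ(leftPart a x))`. -/
noncomputable def derCoeff (d : ι → ℤ) (φ : ι → TSeries ι K) : List ι → TSeries ι K → K
  | [], x => subst φ x []
  | b :: w, x => subst φ x (b :: w) + sgn K (d b) * derCoeff d φ w (leftPart b x)

/-- The family `φ` is the restriction to the generators of a continuous linear map on `W`. -/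
def RowFinite (φ : ι → TSeries ι K) : Prop := ∀ w, {a | φ a w ≠ 0}.Finite

theorem finsum_row {φ : ι → TSeries ι K} (h : RowFinite φ) (p : List ι) (g : ι → K) :
    ∑ᶠ a, φ a p * g a = ∑ a ∈ (h p).toFinset, φ a p * g a := by
  refine finsum_eq_sum_of_support_subset _ fun a ha => ?_
  rw [Set.Finite.coe_toFinset]
  intro h0
  exact ha (by simp [h0])

theorem subst_add {φ : ι → TSeries ι K} (h : RowFinite φ) (x y : TSeries ι K) :
    subst φ (x + y) = subst φ x + subst φ y := by
  ext w
  simp only [subst, ProMod.add_apply, finsum_row h]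
  simp only [mul_add, Finset.sum_add_distrib]

theorem subst_smul {φ : ι → TSeries ι K} (h : RowFinite φ) (c : K) (x : TSeries ι K) :
    subst φ (c • x) = c • subst φ x := by
  ext w
  simp only [subst, finsum_row h]
  simp only [subst, finsum_row h, ProMod.smul_apply, Finset.mul_sum]
  exact Finset.sum_congr rfl fun _ _ => Finset.sum_congr rfl fun _ _ => by ring

theorem derCoeff_add (d : ι → ℤ) {φ : ι → TSeries ι K} (h : RowFinite φ) (w : List ι)
    (x y : TSeries ι K) : derCoeff d φ w (x + y) = derCoeff d φ w x + derCoeff d φ w y := by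
  induction w generalizing x y with
  | nil => simp [derCoeff, subst_add h]
  | cons b w ih => simp only [derCoeff, subst_add h, map_add, ih, ProMod.add_apply]; ring

theorem derCoeff_smul (d : ι → ℤ) {φ : ι → TSeries ι K} (h : RowFinite φ) (w : List ι)
    (c : K) (x : TSeries ι K) : derCoeff d φ w (c • x) = c * derCoeff d φ w x := by
  induction w generalizing x with
  | nil => simp [derCoeff, subst_smul h]
  | cons b w ih => simp only [derCoeff, subst_smul h, map_smul, ih, ProMod.smul_apply]; ring

theorem continuous_leftPart (a : ι) : Continuous (leftPart (K := K) a) :=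
  ProMod.continuous_iff.2 fun _ => ProMod.continuous_coord _

theorem continuous_subst {φ : ι → TSeries ι K} (h : RowFinite φ) : Continuous (subst φ) := by
  rw [ProMod.continuous_iff]
  intro w
  let _ : TopologicalSpace K := ⊥
  have : DiscreteTopology K := ⟨rfl⟩
  simp only [subst, finsum_row h]
  exact continuous_finsetSum _ fun k _ => continuous_finsetSum _ fun a _ =>
    continuous_const.mul (ProMod.continuous_coord _)

theorem continuous_derCoeff (d : ι → ℤ) {φ : ι → TSeries ι K} (h : RowFinite φ) (w : List ι) :
    @Continuous _ K _ ⊥ (derCoeff d φ w) := by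
  let _ : TopologicalSpace K := ⊥
  have : DiscreteTopology K := ⟨rfl⟩
  induction w with
  | nil => exact (ProMod.continuous_coord []).comp (continuous_subst h)
  | cons b w ih =>
    exact ((ProMod.continuous_coord (b :: w)).comp (continuous_subst h)).add
      (continuous_const.mul (ih.comp (continuous_leftPart b)))

/-- The odd vector field `ξ` on `T̂W` with `ξ(tₐ) = φₐ`. -/
noncomputable def derivation (d : ι → ℤ) (φ : ι → TSeries ι K) (h : RowFinite φ) :
    TSeries ι K →L[K] TSeries ι K where
  toFun x := fun w => derCoeff d φ w x
  map_add' x y := ProMod.ext fun w => derCoeff_add d h w x y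
  map_smul' c x := ProMod.ext fun w => derCoeff_smul d h w c x
  cont := ProMod.continuous_iff.2 fun w => continuous_derCoeff d h w

theorem mul_nil (x y : TSeries ι K) : mul x y [] = x [] * y [] := by simp [mul]

theorem mul_cons (x y : TSeries ι K) (b : ι) (w : List ι) :
    mul x y (b :: w) = x [] * y (b :: w) + mul (leftPart b x) y w := by
  simp only [mul, List.length_cons]
  rw [Finset.sum_range_succ', add_comm]
  simp [leftPart_apply]

theorem leftPart_mul (x y : TSeries ι K) (b : ι) :
    leftPart b (mul x y) = x [] • leftPart b y + mul (leftPart b x) y := by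
  ext w
  exact mul_cons x y b w

theorem mul_add_left (x x' y : TSeries ι K) : mul (x + x') y = mul x y + mul x' y := by
  ext w
  simp only [mul, ProMod.add_apply, add_mul, Finset.sum_add_distrib]

theorem mul_smul_left (c : K) (x y : TSeries ι K) : mul (c • x) y = c • mul x y := by
  ext w
  simp only [mul, ProMod.smul_apply, Finset.mul_sum, mul_assoc]

theorem mul_smul_right (c : K) (x y : TSeries ι K) : mul x (c • y) = c • mul x y := by
  ext w
  simp only [mul, ProMod.smul_apply, Finset.mul_sum]
  exact Finset.sum_congr rfl fun _ _ => by ring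

theorem mul_assoc' (x y z : TSeries ι K) : mul (mul x y) z = mul x (mul y z) := by
  ext w
  induction w generalizing x with
  | nil => simp only [mul_nil]; ring
  | cons b w ih =>
    simp only [mul_cons, leftPart_mul, mul_add_left, mul_smul_left, mul_nil,
      ProMod.add_apply, ProMod.smul_apply, ih]
    ring

theorem subst_apply {φ : ι → TSeries ι K} (h : RowFinite φ) (x : TSeries ι K) (w : List ι) :
    ∃ S : Finset ι, ∀ S', S ⊆ S' → subst φ x w = ∑ a ∈ S', mul (φ a) (leftPart a x) w := by
  classical
  refine ⟨(Finset.range (w.length + 1)).biUnion fun k => (h (w.take k)).toFinset,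
    fun S' hS => ?_⟩
  simp only [subst, mul]
  rw [Finset.sum_comm]
  refine Finset.sum_congr rfl fun k hk => ?_
  refine finsum_eq_sum_of_support_subset _ fun a ha => ?_
  refine hS (Finset.mem_biUnion.2 ⟨k, hk, ?_⟩)
  rw [Set.Finite.mem_toFinset]
  intro h0
  exact ha (by simp [h0])

theorem mul_sum_left {α : Type*} (S : Finset α) (f : α → TSeries ι K) (y : TSeries ι K)
    (w : List ι) : mul (fun v => ∑ a ∈ S, f a v) y w = ∑ a ∈ S, mul (f a) y w := by
  simp only [mul, Finset.sum_mul]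
  exact Finset.sum_comm

theorem subst_mul {φ : ι → TSeries ι K} (h : RowFinite φ) (x y : TSeries ι K) :
    subst φ (mul x y) = x [] • subst φ y + mul (subst φ x) y := by
  classical
  ext w
  obtain ⟨S₁, h₁⟩ := subst_apply h (mul x y) w
  obtain ⟨S₂, h₂⟩ := subst_apply h y w
  choose S₃ h₃ using fun k => subst_apply h x (w.take k)
  set S := S₁ ∪ S₂ ∪ (Finset.range (w.length + 1)).biUnion S₃ with hS
  have e1 : S₁ ⊆ S := fun a ha => by simp [hS, ha]
  have e2 : S₂ ⊆ S := fun a ha => by simp [hS, ha]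
  have e3 : ∀ k ∈ Finset.range (w.length + 1), S₃ k ⊆ S := fun k hk a ha => by
    refine Finset.mem_union_right _ (Finset.mem_biUnion.2 ⟨k, hk, ha⟩)
  have e4 : mul (subst φ x) y w = mul (fun v => ∑ a ∈ S, mul (φ a) (leftPart a x) v) y w := by
    refine Finset.sum_congr rfl fun k hk => ?_
    rw [h₃ k S (e3 k hk)]
  rw [ProMod.add_apply, ProMod.smul_apply, e4, mul_sum_left, h₁ S e1, h₂ S e2, Finset.mul_sum,
    ← Finset.sum_add_distrib]
  refine Finset.sum_congr rfl fun a _ => ?_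
  rw [leftPart_mul, mul_assoc']
  have : ∀ u v z : TSeries ι K, mul u (v + z) = mul u v + mul u z := by
    intro u v z
    ext w
    simp only [mul, ProMod.add_apply, mul_add, Finset.sum_add_distrib]
  rw [this, mul_smul_right]
  rfl

theorem sgn_add (a b : ℤ) : sgn K (a + b) = sgn K a * sgn K b := by
  simp [sgn, Int.negOnePow_add]

theorem sgn_zero : sgn K 0 = 1 := by simp [sgn]

theorem leftPart_parity (d : ι → ℤ) (b : ι) (x : TSeries ι K) :
    leftPart b (parity d x) = sgn K (d b) • parity d (leftPart b x) := by
  ext w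
  simp only [leftPart_apply, parity, wordDeg, List.map_cons, List.sum_cons, sgn_add,
    ProMod.smul_apply]
  ring

theorem derivation_apply_cons (d : ι → ℤ) {φ : ι → TSeries ι K} (h : RowFinite φ)
    (x : TSeries ι K) (b : ι) (w : List ι) : derivation d φ h x (b :: w) =
      subst φ x (b :: w) + sgn K (d b) * derivation d φ h (leftPart b x) w := rfl

theorem derivation_apply_nil (d : ι → ℤ) {φ : ι → TSeries ι K} (h : RowFinite φ)
    (x : TSeries ι K) : derivation d φ h x [] = subst φ x [] := rfl

/-- The graded Leibniz rule. -/
theorem derivation_mul (d : ι → ℤ) {φ : ι → TSeries ι K} (h : RowFinite φ) (x y : TSeries ι K) :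
    derivation d φ h (mul x y) =
      mul (derivation d φ h x) y + mul (parity d x) (derivation d φ h y) := by
  ext w
  induction w generalizing x with
  | nil =>
    simp only [derivation_apply_nil, subst_mul h, ProMod.add_apply, ProMod.smul_apply, mul_nil]
    simp [parity, wordDeg, sgn_zero]
    ring
  | cons b w ih =>
    have e : leftPart b (derivation d φ h x) =
        leftPart b (subst φ x) + sgn K (d b) • derivation d φ h (leftPart b x) := rfl
    have e' : parity d x [] = x [] := by simp [parity, wordDeg, sgn_zero]
    simp only [derivation_apply_cons, leftPart_mul, map_add, map_smul, subst_mul h,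
      ProMod.add_apply, ProMod.smul_apply, ih, mul_cons, e, leftPart_parity, mul_add_left,
      mul_smul_left, e', derivation_apply_nil]
    ring

theorem derivation_one (d : ι → ℤ) {φ : ι → TSeries ι K} (h : RowFinite φ) :
    derivation d φ h one = 0 := by
  have h1 : ∀ a, leftPart a (one : TSeries ι K) = 0 := fun a => by
    ext w; simp [leftPart_apply, one]
  have h2 : subst φ (one : TSeries ι K) = 0 := by
    ext w; simp [subst, one]
  ext w
  cases w with
  | nil => rw [derivation_apply_nil, h2]
  | cons b w => rw [derivation_apply_cons, h1, h2]; simp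

theorem derivation_homogeneous (𝒦 : ℤ → AddSubgroup K) [GradedRing 𝒦] (d : ι → ℤ)
    {φ : ι → TSeries ι K} (h : RowFinite φ) (hφ : ∀ a, φ a ∈ homogeneous 𝒦 d (d a + 1)) (n : ℤ)
    {x : TSeries ι K} (hx : x ∈ homogeneous 𝒦 d n) :
    derivation d φ h x ∈ homogeneous 𝒦 d (n + 1) := by
  have hsub : ∀ (n : ℤ) (x : TSeries ι K), x ∈ homogeneous 𝒦 d n →
      subst φ x ∈ homogeneous 𝒦 d (n + 1) := by
    intro n x hx w
    refine sum_mem fun k _ => ?_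
    rw [finsum_row h]
    refine sum_mem fun a _ => ?_
    have := SetLike.mul_mem_graded (hφ a (w.take k)) (hx (a :: w.drop k))
    convert this using 2
    have hw : wordDeg d w = wordDeg d (w.take k) + wordDeg d (w.drop k) := by
      conv_lhs => rw [← List.take_append_drop k w]
      simp [wordDeg]
    rw [hw]
    simp only [wordDeg, List.map_cons, List.sum_cons]
    ring
  intro w
  induction w generalizing x n with
  | nil => exact hsub n x hx []
  | cons b w ih =>
    rw [derivation_apply_cons]
    refine add_mem (hsub n x hx _) ?_
    have hb : leftPart b x ∈ homogeneous 𝒦 d (n - d b) := by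
      intro v
      have := hx (b :: v)
      rw [leftPart_apply]
      convert this using 2
      simp only [wordDeg, List.map_cons, List.sum_cons]
      ring
    have := ih (n - d b) hb
    have e : n - d b + 1 - wordDeg d w = n + 1 - wordDeg d (b :: w) := by
      simp only [wordDeg, List.map_cons, List.sum_cons]
      ring
    rw [e] at this
    rcases Int.even_or_odd (d b) with hd | hd
    · simpa [sgn, Int.negOnePow_even _ hd] using this
    · simpa [sgn, Int.negOnePow_odd _ hd] using this

end Algebra

/-! ## The vector field on `T̂W` of a `C_∞`-structure -/

namespace CInfinityStructure

variable {ι K : Type*} [CommRing K] {𝒦 : ℤ → AddSubgroup K} {d : ι → ℤ}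

/-- The values of `m` on the generators. -/
noncomputable def onGen (C : CInfinityStructure 𝒦 d) (a : ι) : TSeries ι K := C.m (lieGen d a)

theorem rowFinite (C : CInfinityStructure 𝒦 d) : RowFinite C.onGen := by
  intro w
  let _ : TopologicalSpace K := ⊥
  have : DiscreteTopology K := ⟨rfl⟩
  have hc : Continuous fun x : lieSeries K d => (C.m x : TSeries ι K) w :=
    (ProMod.continuous_coord w).comp (continuous_subtype_val.comp C.m.continuous)
  have ho : IsOpen {x : lieSeries K d | (C.m x : TSeries ι K) w = 0} :=
    (isOpen_discrete ({0} : Set K)).preimage hc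
  obtain ⟨U, hU, hUe⟩ := isOpen_induced_iff.1 ho
  have h0 : (0 : TSeries ι K) ∈ U := by
    have : (0 : lieSeries K d) ∈ Subtype.val ⁻¹' U := by rw [hUe]; simp
    simpa using this
  obtain ⟨I, u, hu, hI⟩ := (isOpen_pi_iff (A := fun _ : List ι => K)).1 hU 0 h0
  refine ((I.finite_toSet).preimage (f := fun a : ι => [a])
    (fun a _ b _ hab => by simpa using hab)).subset ?_
  intro a ha
  by_contra hn
  refine ha ?_
  have hm : lieGen d a ∈ Subtype.val ⁻¹' U := by
    refine hI fun v hv => ?_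
    have : gen (K := K) a v = 0 := by
      have hne : v ≠ [a] := by
        rintro rfl
        exact hn hv
      simp [gen, hne]
    change gen (K := K) a v ∈ u v
    rw [this]
    exact (hu v hv).2
  rw [hUe] at hm
  exact hm

/-- The `A_∞`-structure of a `C_∞`-structure: the unique extension of `m` to a continuous derivation
of `T̂W`. -/
noncomputable def vectorField (C : CInfinityStructure 𝒦 d) : TSeries ι K →L[K] TSeries ι K :=
  derivation d C.onGen C.rowFinite

theorem onGen_homogeneous [GradedRing 𝒦] (C : CInfinityStructure 𝒦 d) (a : ι) :
    C.onGen a ∈ homogeneous 𝒦 d (d a + 1) := by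
  refine C.degree_one (d a) (lieGen d a) fun w => ?_
  by_cases hw : w = [a]
  · subst hw
    have : (lieGen (K := K) d a : TSeries ι K) [a] = 1 := by simp [lieGen, gen]
    rw [this]
    simpa [wordDeg] using SetLike.GradedOne.one_mem (A := 𝒦)
  · have : (lieGen (K := K) d a : TSeries ι K) w = 0 := by simp [lieGen, gen, hw]
    rw [this]
    exact zero_mem _

theorem vectorField_mem_pos (C : CInfinityStructure 𝒦 d) (x : TSeries ι K) :
    C.vectorField x ∈ pos ι K := by
  change subst C.onGen x [] = 0
  have : ∀ a, C.onGen a [] = 0 := fun a => lieSeries_le_pos d (C.m (lieGen d a)).2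
  simp [subst, this]

/-- On homogeneous elements the bracket is the graded commutator. -/
theorem gcomm_eq [EvenlyGraded 𝒦] {p q : ℤ} {x y : TSeries ι K} (hx : x ∈ homogeneous 𝒦 d p)
    (hy : y ∈ homogeneous 𝒦 d q) : gcomm d x y = mul x y - sgn K (p * q) • mul y x := by
  have key : ∀ u v : List ι, sgn K (wordDeg d u * wordDeg d v) * (y u * x v) =
      sgn K (p * q) * (y u * x v) := by
    intro u v
    rcases Int.even_or_odd (p - wordDeg d v) with h1 | h1
    · rcases Int.even_or_odd (q - wordDeg d u) with h2 | h2
      · have hs : (wordDeg d u * wordDeg d v).negOnePow = (p * q).negOnePow := by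
          rw [Int.negOnePow_eq_iff]
          have e : wordDeg d u * wordDeg d v - p * q =
              -((q - wordDeg d u) * wordDeg d v + q * (p - wordDeg d v)) := by ring
          rw [e]
          exact ((h2.mul_right _).add (h1.mul_left _)).neg
        rw [sgn, hs, sgn]
      · have h0 := hy u
        rw [EvenlyGraded.eq_bot_of_odd (𝒦 := 𝒦) _ h2, AddSubgroup.mem_bot] at h0
        simp [h0]
    · have h0 := hx v
      rw [EvenlyGraded.eq_bot_of_odd (𝒦 := 𝒦) _ h1, AddSubgroup.mem_bot] at h0
      simp [h0]
  ext w
  simp only [gcomm, key, mul, ProMod.sub_apply, ProMod.smul_apply, Finset.mul_sum,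
    Finset.sum_sub_distrib]

theorem mul_homogeneous [GradedRing 𝒦] {p q : ℤ} {x y : TSeries ι K}
    (hx : x ∈ homogeneous 𝒦 d p) (hy : y ∈ homogeneous 𝒦 d q) :
    mul x y ∈ homogeneous 𝒦 d (p + q) := by
  refine fun w => sum_mem fun k _ => ?_
  have := SetLike.mul_mem_graded (hx (w.take k)) (hy (w.drop k))
  convert this using 2
  have hw : wordDeg d w = wordDeg d (w.take k) + wordDeg d (w.drop k) := by
    conv_lhs => rw [← List.take_append_drop k w]
    simp [wordDeg]
  rw [hw]
  ring

theorem sgn_smul_mem {A : Type*} [AddCommGroup A] [Module K A] (S : AddSubgroup A) (n : ℤ) {x : A}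
    (hx : x ∈ S) : sgn K n • x ∈ S := by
  rcases Int.even_or_odd n with h | h
  · simpa [sgn, Int.negOnePow_even _ h] using hx
  · simpa [sgn, Int.negOnePow_odd _ h] using hx

theorem gen_homogeneous [GradedRing 𝒦] (a : ι) : gen (K := K) a ∈ homogeneous 𝒦 d (d a) := by
  intro w
  by_cases hw : w = [a]
  · subst hw
    simpa [wordDeg, gen] using SetLike.GradedOne.one_mem (A := 𝒦)
  · simp [gen, hw]

theorem vectorField_gen (C : CInfinityStructure 𝒦 d) (a : ι) :
    C.vectorField (gen a) = C.onGen a := by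
  classical
  have h1 : leftPart a (gen (K := K) a) = one := by
    ext w
    simp [leftPart_apply, gen, one]
  have h2 : ∀ b, b ≠ a → leftPart b (gen (K := K) a) = 0 := by
    intro b hb
    ext w
    simp [leftPart_apply, gen, hb]
  have h3 : subst C.onGen (gen a) = C.onGen a := by
    ext w
    simp only [subst]
    rw [Finset.sum_eq_single w.length]
    · rw [finsum_eq_single _ a fun b hb => by simp [gen, hb]]
      simp [gen]
    · intro k hk hne
      have hlt : k < w.length := by
        have := Finset.mem_range.1 hk
        omega
      refine finsum_eq_zero_of_forall_eq_zero fun b => ?_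
      have : w.drop k ≠ [] := by simpa [List.drop_eq_nil_iff] using hlt
      simp [gen, this]
    · intro h
      exact absurd (Finset.mem_range.2 (Nat.lt_succ_self _)) h
  ext w
  change derivation d C.onGen C.rowFinite (gen a) w = _
  cases w with
  | nil => rw [derivation_apply_nil, h3]
  | cons b w =>
    rw [derivation_apply_cons, h3]
    by_cases hb : b = a
    · subst hb
      rw [h1, derivation_one]
      simp
    · rw [h2 b hb, map_zero]
      simp

/-- The vector field on `T̂W` extends the `C_∞`-structure. -/
theorem vectorField_eq [GradedRing 𝒦] [EvenlyGraded 𝒦] (C : CInfinityStructure 𝒦 d)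
    (x : lieSeries K d) : C.vectorField x = C.m x := by
  have key : ∀ y : TSeries ι K, IsLieMonomial d y → (∃ p, y ∈ homogeneous 𝒦 d p) ∧
      ∃ hy : y ∈ lieSeries K d, C.vectorField y = C.m ⟨y, hy⟩ := by
    intro y hy
    induction hy with
    | gen a => exact ⟨⟨d a, gen_homogeneous a⟩, (lieGen d a).2, C.vectorField_gen a⟩
    | @bracket u v _ _ hu hv =>
      obtain ⟨⟨p, hp⟩, hu, eu⟩ := hu
      obtain ⟨⟨q, hq⟩, hv, ev⟩ := hv
      have hpu : C.vectorField u ∈ homogeneous 𝒦 d (p + 1) :=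
        derivation_homogeneous 𝒦 d C.rowFinite C.onGen_homogeneous p hp
      have hqv : C.vectorField v ∈ homogeneous 𝒦 d (q + 1) :=
        derivation_homogeneous 𝒦 d C.rowFinite C.onGen_homogeneous q hq
      have hpar : ∀ {n : ℤ} {z : TSeries ι K}, z ∈ homogeneous 𝒦 d n →
          parity d z = sgn K n • z := by
        intro n z hz
        ext w
        simp only [parity, ProMod.smul_apply]
        rcases Int.even_or_odd (n - wordDeg d w) with h | h
        · have : n = (n - wordDeg d w) + wordDeg d w := by ring
          rw [this, sgn_add]
          simp [sgn, Int.negOnePow_even _ h]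
        · have h0 := hz w
          rw [EvenlyGraded.eq_bot_of_odd (𝒦 := 𝒦) _ h, AddSubgroup.mem_bot] at h0
          simp [h0]
      refine ⟨⟨p + q, ?_⟩, gcomm_mem d hu hv, ?_⟩
      · rw [gcomm_eq hp hq]
        refine sub_mem (mul_homogeneous hp hq) (sgn_smul_mem _ _ ?_)
        rw [add_comm]
        exact mul_homogeneous hq hp
      · have hm := C.leibniz ⟨u, hu⟩ ⟨v, hv⟩
        rw [hm, ← eu, ← ev]
        have hl : ∀ u v : TSeries ι K, C.vectorField (mul u v) =
            mul (C.vectorField u) v + mul (parity d u) (C.vectorField v) :=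
          derivation_mul d C.rowFinite
        change C.vectorField (gcomm d u v) =
          gcomm d (C.vectorField u) v + gcomm d (parity d u) (C.vectorField v)
        rw [hpar hp, gcomm_eq hp hq, gcomm_eq hpu hq, gcomm_eq (sgn_smul_mem _ p hp) hqv,
          map_sub, map_smul, hl, hl, hpar hp, hpar hq]
        have e1 : sgn K ((p + 1) * q) = sgn K (p * q) * sgn K q := by
          rw [← sgn_add]; congr 1; ring
        have e2 : sgn K (p * (q + 1)) = sgn K (p * q) * sgn K p := by
          rw [← sgn_add]; congr 1; ring
        have hP : sgn K p * sgn K p = 1 := by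
          rw [← sgn_add, sgn, Int.negOnePow_even _ ⟨p, rfl⟩]
          simp
        ext w
        simp only [e1, e2, mul_smul_left, mul_smul_right, ProMod.add_apply, ProMod.sub_apply,
          ProMod.smul_apply]
        linear_combination (sgn K (p * q) * mul (C.vectorField v) u w) * hP
  have hcl : IsClosed {z : lieSeries K d | C.vectorField z = C.m z} := by
    have hT2 : T2Space (TSeries ι K) := by
      let _ : TopologicalSpace K := ⊥
      have : DiscreteTopology K := ⟨rfl⟩
      exact inferInstanceAs (T2Space (List ι → K))
    exact isClosed_eq (C.vectorField.continuous.comp continuous_subtype_val)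
      (continuous_subtype_val.comp C.m.continuous)
  obtain ⟨x, hx⟩ := x
  have hsp : ∀ y ∈ Submodule.span K {y | IsLieMonomial d y}, ∃ hy : y ∈ lieSeries K d,
      C.vectorField y = C.m ⟨y, hy⟩ := by
    intro y hy
    induction hy using Submodule.span_induction with
    | mem y hy => exact (key y hy).2
    | zero => exact ⟨zero_mem _, by rw [map_zero]; exact (congrArg Subtype.val (map_zero C.m)).symm⟩
    | add u v _ _ hu hv =>
      obtain ⟨hu, eu⟩ := hu
      obtain ⟨hv, ev⟩ := hv
      refine ⟨add_mem hu hv, ?_⟩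
      rw [map_add, eu, ev]
      exact (congrArg Subtype.val (map_add C.m ⟨u, hu⟩ ⟨v, hv⟩)).symm
    | smul c u _ hu =>
      obtain ⟨hu, eu⟩ := hu
      refine ⟨Submodule.smul_mem _ c hu, ?_⟩
      rw [map_smul, eu]
      exact (congrArg Subtype.val (map_smul C.m c ⟨u, hu⟩)).symm
  have hd : (⟨x, hx⟩ : lieSeries K d) ∈
      closure {z : lieSeries K d | C.vectorField z = C.m z} := by
    rw [closure_subtype]
    refine closure_mono ?_ hx
    intro y hy
    obtain ⟨h1, h2⟩ := hsp y hy
    exact ⟨⟨y, h1⟩, h2, rfl⟩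
  rw [hcl.closure_eq] at hd
  exact hd

/-- The differential `b'` of the bar complex: the restriction of the vector field to
`∏_{i ≥ 1} (ΣV*)^{⊗̂i}`. -/
noncomputable def barDiff (C : CInfinityStructure 𝒦 d) : pos ι K →ₗ[K] pos ι K :=
  (C.vectorField : TSeries ι K →ₗ[K] TSeries ι K).restrict fun x _ => C.vectorField_mem_pos x

end CInfinityStructure

/-! ## Noncommutative one-forms

The module of one-forms `Ω¹ = T̂W ⊗̂ (T̂W/K)` is a quotient of `T̂W ⊗̂ T̂W`, the class of `x ⊗ y` being
`x·dy`. One-forms are multiplied as elements of the differential envelope, where `d` is a derivation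
of degree one: `a·(x dy) = ax dy` and `(x dy)·a = x d(ya) - (-1)^{|y|} xy da`. -/

section OneForms

variable {ι K : Type*} [CommRing K]

/-- A representative in `T̂W ⊗̂ T̂W` of the graded commutator
`[a, x dy] = a·(x dy) - (-1)^{|a|(|x|+|y|+1)} (x dy)·a`
of homogeneous elements `a`, `x`, `y` of degrees `p`, `q`, `r`. -/
def oneFormComm (p q r : ℤ) (a x y : TSeries ι K) : TSeries₂ ι K :=
  tens (mul a x) y - sgn K (p * (q + r + 1)) • (tens x (mul y a) - sgn K r • tens (mul x y) a)

/-- The submodule of `T̂W ⊗̂ T̂W` by which one has to divide to obtain `DR¹(T̂W)`: the closed submodule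
generated by the elements `x ⊗ 1` (that is, `x·d1 = 0`) and by all commutators of homogeneous
elements of `T̂W` with one-forms. -/
def oneFormRel (𝒦 : ℤ → AddSubgroup K) (d : ι → ℤ) : Submodule K (TSeries₂ ι K) :=
  (Submodule.span K ({F | ∃ x : TSeries ι K, F = tens x one} ∪
    {F | ∃ (p q r : ℤ) (a x y : TSeries ι K), a ∈ homogeneous 𝒦 d p ∧ x ∈ homogeneous 𝒦 d q ∧
      y ∈ homogeneous 𝒦 d r ∧ F = oneFormComm p q r a x y})).topologicalClosure

/-- The noncommutative one-forms `DR¹(T̂W)`, that is, `Ω¹` modulo commutators. -/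
abbrev DR1 (𝒦 : ℤ → AddSubgroup K) (d : ι → ℤ) : Type _ := TSeries₂ ι K ⧸ oneFormRel 𝒦 d

/-- The one-forms in `DR¹(T̂W)` of degree `n`, where `x·dy` has degree `|x| + |y|`. -/
def DR1.homogeneous (𝒦 : ℤ → AddSubgroup K) (d : ι → ℤ) (n : ℤ) : AddSubgroup (DR1 𝒦 d) :=
  (homogeneous₂ 𝒦 d n).map (oneFormRel 𝒦 d).mkQ.toAddMonoidHom

/-- A representative of `Θ(x)`: on monomials, `Θ(tₐ ⊗ y) = dtₐ·y = d(tₐy) - (-1)^{|tₐ|} tₐ·dy`. -/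
def thetaRep (d : ι → ℤ) : TSeries ι K →ₗ[K] TSeries₂ ι K where
  toFun x
    | ([], v) => x v
    | ([a], v) => -(sgn K (d a) * x (a :: v))
    | (_ :: _ :: _, _) => 0
  map_add' x y := by
    ext ⟨u, v⟩
    match u with
    | [] => rfl
    | [a] =>
      change -(sgn K (d a) * (x (a :: v) + y (a :: v))) =
        -(sgn K (d a) * x (a :: v)) + -(sgn K (d a) * y (a :: v))
      ring
    | _ :: _ :: _ => exact (add_zero (0 : K)).symm
  map_smul' c x := by
    ext ⟨u, v⟩
    match u with
    | [] => rfl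
    | [a] =>
      change -(sgn K (d a) * (c * x (a :: v))) = c * -(sgn K (d a) * x (a :: v))
      ring
    | _ :: _ :: _ => exact (mul_zero c).symm

/-- The map `Θ : W ⊗̂ T̂W = ∏_{i ≥ 1} W^{⊗̂i} → DR¹(T̂W)`, `x ⊗ y ↦ dx·y`. -/
def theta (𝒦 : ℤ → AddSubgroup K) (d : ι → ℤ) : pos ι K →ₗ[K] DR1 𝒦 d :=
  (oneFormRel 𝒦 d).mkQ ∘ₗ thetaRep d ∘ₗ (pos ι K).subtype

namespace CInfinityStructure

variable {𝒦 : ℤ → AddSubgroup K} {d : ι → ℤ}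

/-- The Lie derivative of `m` before dividing by the relations:
`x·dy ↦ m(x)·dy - (-1)^{|x|} x·d(m(y))`. -/
noncomputable def lieDerivRep (C : CInfinityStructure 𝒦 d) : TSeries₂ ι K →ₗ[K] TSeries₂ ι K where
  toFun F := fun p => C.vectorField (sliceLeft p.2 F) p.1 -
    sgn K (wordDeg d p.1) * C.vectorField (sliceRight p.1 F) p.2
  map_add' F G := by
    ext p
    change C.vectorField (sliceLeft p.2 (F + G)) p.1 -
      sgn K (wordDeg d p.1) * C.vectorField (sliceRight p.1 (F + G)) p.2 =
      (C.vectorField (sliceLeft p.2 F) p.1 -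
        sgn K (wordDeg d p.1) * C.vectorField (sliceRight p.1 F) p.2) +
      (C.vectorField (sliceLeft p.2 G) p.1 -
        sgn K (wordDeg d p.1) * C.vectorField (sliceRight p.1 G) p.2)
    simp only [map_add, ProMod.add_apply]
    ring
  map_smul' c F := by
    ext p
    change C.vectorField (sliceLeft p.2 (c • F)) p.1 -
      sgn K (wordDeg d p.1) * C.vectorField (sliceRight p.1 (c • F)) p.2 =
      c * (C.vectorField (sliceLeft p.2 F) p.1 -
        sgn K (wordDeg d p.1) * C.vectorField (sliceRight p.1 F) p.2)
    simp only [map_smul, ProMod.smul_apply]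
    ring

theorem continuous_lieDerivRep (C : CInfinityStructure 𝒦 d) : Continuous C.lieDerivRep := by
  rw [ProMod.continuous_iff]
  intro p
  let _ : TopologicalSpace K := ⊥
  have : DiscreteTopology K := ⟨rfl⟩
  have h1 : Continuous (sliceLeft (K := K) p.2) :=
    ProMod.continuous_iff.2 fun _ => ProMod.continuous_coord _
  have h2 : Continuous (sliceRight (K := K) p.1) :=
    ProMod.continuous_iff.2 fun _ => ProMod.continuous_coord _
  exact ((ProMod.continuous_coord p.1).comp (C.vectorField.continuous.comp h1)).sub
    (continuous_const.mul ((ProMod.continuous_coord p.2).comp (C.vectorField.continuous.comp h2)))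

theorem lieDerivRep_tens (C : CInfinityStructure 𝒦 d) (x y : TSeries ι K) :
    C.lieDerivRep (tens x y) = tens (C.vectorField x) y - tens (parity d x) (C.vectorField y) := by
  ext ⟨u, v⟩
  have h1 : sliceLeft v (tens x y) = y v • x := by
    ext w
    exact mul_comm _ _
  have h2 : sliceRight u (tens x y) = x u • y := rfl
  change C.vectorField (sliceLeft v (tens x y)) u -
    sgn K (wordDeg d u) * C.vectorField (sliceRight u (tens x y)) v =
    C.vectorField x u * y v - sgn K (wordDeg d u) * x u * C.vectorField y v
  rw [h1, h2, map_smul, map_smul, ProMod.smul_apply, ProMod.smul_apply]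
  ring

theorem parity_eq [EvenlyGraded 𝒦] {p : ℤ} {x : TSeries ι K} (hx : x ∈ homogeneous 𝒦 d p) :
    parity d x = sgn K p • x := by
  ext w
  simp only [parity, ProMod.smul_apply]
  rcases Int.even_or_odd (p - wordDeg d w) with h | h
  · have : p = (p - wordDeg d w) + wordDeg d w := by ring
    rw [this, sgn_add]
    simp [sgn, Int.negOnePow_even _ h]
  · have h0 := hx w
    rw [EvenlyGraded.eq_bot_of_odd (𝒦 := 𝒦) _ h, AddSubgroup.mem_bot] at h0
    simp [h0]

theorem sgn_mul_self (a : ℤ) : sgn K a * sgn K a = 1 := by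
  rw [← sgn_add, sgn, Int.negOnePow_even _ ⟨a, rfl⟩]
  simp

theorem sgn_one : sgn K 1 = -1 := by simp [sgn]

theorem lieDerivRep_mem [GradedRing 𝒦] [EvenlyGraded 𝒦] (C : CInfinityStructure 𝒦 d) :
    oneFormRel 𝒦 d ≤ (oneFormRel 𝒦 d).comap C.lieDerivRep := by
  refine topologicalClosure_le_comap C.continuous_lieDerivRep
    (Submodule.isClosed_topologicalClosure _) ?_
  have hcomm : ∀ (p q r : ℤ) (a x y : TSeries ι K), a ∈ homogeneous 𝒦 d p →
      x ∈ homogeneous 𝒦 d q → y ∈ homogeneous 𝒦 d r →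
      oneFormComm p q r a x y ∈ oneFormRel 𝒦 d := fun p q r a x y ha hx hy =>
    subset_closure (Submodule.subset_span (Or.inr ⟨p, q, r, a, x, y, ha, hx, hy, rfl⟩))
  rintro F (⟨x, rfl⟩ | ⟨p, q, r, a, x, y, ha, hx, hy, rfl⟩)
  · have h1 : C.vectorField one = 0 := derivation_one d C.rowFinite
    have h0 : tens (parity d x) (0 : TSeries ι K) = 0 := by
      ext p
      simp [tens]
    rw [lieDerivRep_tens, h1, h0, sub_zero]
    exact subset_closure (Submodule.subset_span (Or.inl ⟨_, rfl⟩))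
  · have hm : ∀ (n : ℤ) (x : TSeries ι K), x ∈ homogeneous 𝒦 d n →
        C.vectorField x ∈ homogeneous 𝒦 d (n + 1) := fun n x hx =>
      derivation_homogeneous 𝒦 d C.rowFinite C.onGen_homogeneous n hx
    have hl : ∀ u v : TSeries ι K, C.vectorField (mul u v) =
        mul (C.vectorField u) v + mul (parity d u) (C.vectorField v) :=
      derivation_mul d C.rowFinite
    have hp : ∀ u v : TSeries ι K, ∀ i j : ℤ, u ∈ homogeneous 𝒦 d i → v ∈ homogeneous 𝒦 d j →
        parity d (mul u v) = sgn K (i + j) • mul u v := by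
      intro u v i j hu hv
      refine parity_eq (𝒦 := 𝒦) fun w => sum_mem fun k _ => ?_
      have := SetLike.mul_mem_graded (hu (w.take k)) (hv (w.drop k))
      convert this using 2
      have hw : wordDeg d w = wordDeg d (w.take k) + wordDeg d (w.drop k) := by
        conv_lhs => rw [← List.take_append_drop k w]
        simp [wordDeg]
      rw [hw]
      ring
    have key : C.lieDerivRep (oneFormComm p q r a x y) =
        oneFormComm (p + 1) q r (C.vectorField a) x y +
        sgn K p • oneFormComm p (q + 1) r a (C.vectorField x) y -
        sgn K (p + q) • oneFormComm p q (r + 1) a x (C.vectorField y) := by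
      simp only [oneFormComm, map_sub, map_smul, lieDerivRep_tens, hl, hp a x p q ha hx,
        hp x y q r hx hy, parity_eq ha, parity_eq hx, parity_eq hy]
      have e1 : sgn K ((p + 1) * (q + r + 1)) = sgn K (p * (q + r + 1)) * sgn K (q + r + 1) := by
        rw [← sgn_add]; congr 1; ring
      have e2 : sgn K (p * (q + 1 + r + 1)) = sgn K (p * (q + r + 1)) * sgn K p := by
        rw [← sgn_add]; congr 1; ring
      have e3 : sgn K (p * (q + (r + 1) + 1)) = sgn K (p * (q + r + 1)) * sgn K p := by
        rw [← sgn_add]; congr 1; ring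
      rw [e1, e2, e3]
      simp only [sgn_add, sgn_one]
      have hP := sgn_mul_self (K := K) p
      ext ⟨u, v⟩
      simp only [tens, ProMod.sub_apply, ProMod.add_apply, ProMod.smul_apply, mul_smul_left]
      generalize sgn K (p * (q + r + 1)) = E
      generalize sgn K p = P at *
      generalize sgn K q = Q at *
      generalize sgn K r = R at *
      linear_combination (-(Q * E * x u * mul (C.vectorField y) a v) -
        Q * E * R * mul x (C.vectorField y) u * a v + E * C.vectorField x u * mul y a v -
        E * R * mul (C.vectorField x) y u * a v) * hP
    change C.lieDerivRep _ ∈ oneFormRel 𝒦 d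
    rw [key]
    exact sub_mem (add_mem (hcomm _ _ _ _ _ _ (hm _ _ ha) hx hy)
      (Submodule.smul_mem _ _ (hcomm _ _ _ _ _ _ ha (hm _ _ hx) hy)))
      (Submodule.smul_mem _ _ (hcomm _ _ _ _ _ _ ha hx (hm _ _ hy)))

/-- The Lie derivative `L_m : DR¹(T̂W) → DR¹(T̂W)`: the differential of the Hochschild complex with
coefficients in `V*`. -/
noncomputable def lieDeriv [GradedRing 𝒦] [EvenlyGraded 𝒦] (C : CInfinityStructure 𝒦 d) :
    DR1 𝒦 d →ₗ[K] DR1 𝒦 d :=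
  (oneFormRel 𝒦 d).mapQ (oneFormRel 𝒦 d) C.lieDerivRep C.lieDerivRep_mem

end CInfinityStructure

end OneForms

/-! ## The modified shuffle operator and its eigenprojections -/

section Hodge

variable {ι K : Type*} [CommRing K]

/-- The coefficient of the shuffle coproduct `Δ(x)` at `u ⊗ v`. As `Δ` is the continuous algebra
homomorphism with `Δ(tₐ) = tₐ ⊗ 1 + 1 ⊗ tₐ`, and `x = x(∅) + ∑ₐ tₐ·(leftPart a x)`, we have
`Δ(x) = x(∅) + ∑ₐ (tₐ ⊗ 1 + 1 ⊗ tₐ)·Δ(leftPart a x)`, where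
`(tₐ ⊗ 1)·(u ⊗ v) = tₐu ⊗ v` and `(1 ⊗ t_b)·(u ⊗ v) = (-1)^{|t_b||u|} u ⊗ t_b v`. -/
def shuffleCoeff (d : ι → ℤ) : List ι → List ι → TSeries ι K → K
  | [], v, x => x v
  | a :: u, [], x => x (a :: u)
  | a :: u, b :: v, x => shuffleCoeff d u (b :: v) (leftPart a x) +
      sgn K (d b * wordDeg d (a :: u)) * shuffleCoeff d (a :: u) v (leftPart b x)
termination_by u v => u.length + v.length

theorem shuffleCoeff_add (d : ι → ℤ) (u v : List ι) (x y : TSeries ι K) :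
    shuffleCoeff d u v (x + y) = shuffleCoeff d u v x + shuffleCoeff d u v y := by
  fun_induction shuffleCoeff d u v x generalizing y with
  | case1 => simp [shuffleCoeff]
  | case2 => simp [shuffleCoeff]
  | case3 a u b v x ih1 ih2 =>
    simp only [shuffleCoeff, map_add, ih1, ih2]
    ring

theorem shuffleCoeff_smul (d : ι → ℤ) (u v : List ι) (c : K) (x : TSeries ι K) :
    shuffleCoeff d u v (c • x) = c * shuffleCoeff d u v x := by
  fun_induction shuffleCoeff d u v x with
  | case1 => simp [shuffleCoeff]
  | case2 => simp [shuffleCoeff]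
  | case3 a u b v x ih1 ih2 =>
    simp only [shuffleCoeff, map_smul, ih1, ih2]
    ring

/-- The shuffle coproduct `Δ : T̂W → T̂W ⊗̂ T̂W`. -/
def comul (d : ι → ℤ) : TSeries ι K →ₗ[K] TSeries₂ ι K where
  toFun x := fun p => shuffleCoeff d p.1 p.2 x
  map_add' x y := ProMod.ext fun p => shuffleCoeff_add d p.1 p.2 x y
  map_smul' c x := ProMod.ext fun p => shuffleCoeff_smul d p.1 p.2 c x

/-- The multiplication `μ : T̂W ⊗̂ T̂W → T̂W`. -/
def mulMap (ι K : Type*) [CommRing K] : TSeries₂ ι K →ₗ[K] TSeries ι K where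
  toFun F := fun w => ∑ k ∈ Finset.range (w.length + 1), F (w.take k, w.drop k)
  map_add' F G := by
    ext w
    simp only [ProMod.add_apply]
    exact Finset.sum_add_distrib
  map_smul' c F := by
    ext w
    exact (Finset.mul_sum _ _ _).symm

/-- The modified shuffle operator `s = μΔ`. -/
def shuffleOp (d : ι → ℤ) : TSeries ι K →ₗ[K] TSeries ι K := mulMap ι K ∘ₗ comul d

theorem shuffleOp_mem_pos (d : ι → ℤ) {x : TSeries ι K} (hx : x ∈ pos ι K) :
    shuffleOp d x ∈ pos ι K := by
  have h : x [] = 0 := hx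
  change ∑ k ∈ Finset.range 1, shuffleCoeff d (List.take k []) (List.drop k []) x = 0
  simp [shuffleCoeff, h]

theorem aeval_mem_pos (d : ι → ℤ) (p : Polynomial K) {x : TSeries ι K} (hx : x ∈ pos ι K) :
    Polynomial.aeval (shuffleOp d) p x ∈ pos ι K := by
  induction p using Polynomial.induction_on' with
  | add p q hp hq =>
    rw [map_add]
    exact add_mem hp hq
  | monomial n c =>
    rw [Polynomial.aeval_monomial]
    refine Submodule.smul_mem _ c ?_
    induction n with
    | zero => simpa using hx
    | succ n ih =>
      rw [pow_succ']
      exact shuffleOp_mem_pos d ih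

open Polynomial in
/-- The Lagrange polynomial `∏_{r ≤ n, r ≠ j} (2^j - 2^r)⁻¹ (X - 2^r)` for `j ≤ n`, and `0` for
`j > n`. -/
noncomputable def hodgePoly (n j : ℕ) : ℚ[X] :=
  if j ≤ n then
    C (∏ r ∈ (Finset.range (n + 1)).erase j, ((2 : ℚ) ^ j - 2 ^ r))⁻¹ *
      ∏ r ∈ (Finset.range (n + 1)).erase j, (X - C ((2 : ℚ) ^ r))
  else 0

variable [Algebra ℚ K]

/-- The operator `e(j)` on `T̂W`. The operator `s` preserves the order of series, and on the component
`W^{⊗̂n}` of order `n` the operator `e(j)` is `e_n(j)`, the `j`-th Lagrange polynomial of `s_n`. -/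
noncomputable def hodgeProj (d : ι → ℤ) (j : ℕ) : TSeries ι K →ₗ[K] TSeries ι K where
  toFun x := fun w =>
    Polynomial.aeval (shuffleOp d) ((hodgePoly w.length j).map (algebraMap ℚ K)) x w
  map_add' x y := by
    ext w
    simp only [map_add, ProMod.add_apply]
    rfl
  map_smul' c x := by
    ext w
    simp only [map_smul, ProMod.smul_apply]
    rfl

theorem hodgeProj_mem_pos (d : ι → ℤ) (j : ℕ) {x : TSeries ι K} (hx : x ∈ pos ι K) :
    hodgeProj d j x ∈ pos ι K :=
  aeval_mem_pos d _ hx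

/-- `s` on `∏_{i ≥ 1} W^{⊗̂i}`. -/
def shuffleOpPos (d : ι → ℤ) : pos ι K →ₗ[K] pos ι K :=
  (shuffleOp d).restrict fun _ hx => shuffleOp_mem_pos d hx

/-- `e(j)` on `∏_{i ≥ 1} W^{⊗̂i}`. -/
noncomputable def hodgeProjPos (d : ι → ℤ) (j : ℕ) : pos ι K →ₗ[K] pos ι K :=
  (hodgeProj d j).restrict fun _ hx => hodgeProj_mem_pos d j hx

/-- The operator `1 ⊗̂ f` on `W ⊗̂ T̂W = ∏_{i ≥ 1} W^{⊗̂i}`. -/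
def oneTensor (f : TSeries ι K →ₗ[K] TSeries ι K) : pos ι K →ₗ[K] pos ι K where
  toFun x := ⟨fun w => match w with
    | [] => 0
    | a :: w => f (leftPart a x) w, rfl⟩
  map_add' x y := by
    ext w
    match w with
    | [] => exact (add_zero (0 : K)).symm
    | a :: w =>
      change f (leftPart a ((x : TSeries ι K) + y)) w = f (leftPart a x) w + f (leftPart a y) w
      simp only [map_add, ProMod.add_apply]
  map_smul' c x := by
    ext w
    match w with
    | [] => exact (mul_zero c).symm
    | a :: w =>
      change f (leftPart a (c • (x : TSeries ι K))) w = c * f (leftPart a x) w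
      simp only [map_smul, ProMod.smul_apply]

/-- The operator `s̃ = 1 ⊗̂ s`. -/
def shuffleOpTilde (d : ι → ℤ) : pos ι K →ₗ[K] pos ι K := oneTensor (shuffleOp d)

/-- The operator `ẽ(j) = 1 ⊗̂ e(j)`. -/
noncomputable def hodgeProjTilde (d : ι → ℤ) (j : ℕ) : pos ι K →ₗ[K] pos ι K :=
  oneTensor (hodgeProj d j)

/-- The component of degree `n` of the suspension `Σ(∏_{i ≥ 1} W^{⊗̂i})`, that is, the component of
degree `n + 1` of `∏_{i ≥ 1} W^{⊗̂i}`. -/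
def suspHomogeneous (𝒦 : ℤ → AddSubgroup K) (d : ι → ℤ) (n : ℤ) : AddSubgroup (pos ι K) :=
  (homogeneous 𝒦 d (n + 1)).comap (pos ι K).subtype.toAddMonoidHom

/-- `e` is the projection onto the eigenspace of `s` with eigenvalue `c`. -/
structure IsEigenprojection {M : Type*} [AddCommGroup M] [Module K M] (s e : M →ₗ[K] M) (c : K) :
    Prop where
  idempotent : e ∘ₗ e = e
  range_eq : LinearMap.range e = Module.End.eigenspace s c

/-- The graded topological module `M`, with homogeneous components `gr n` and with the operator `δ`,
is a cochain complex; the images `e(j)[M]` are subcomplexes; the maps `e(j)` are cochain maps; and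
`x ↦ (e(j) x)_j` is an isomorphism from `M` to the direct product of the complexes `e(j)[M]`: it is
an isomorphism of topological modules respecting gradings and differentials, and its inverse is
`(y_j)_j ↦ ∑_j y_j`. -/
structure SplitsAsProduct {M J : Type*} [AddCommGroup M] [Module K M] [TopologicalSpace M]
    (gr : ℤ → AddSubgroup M) (δ : M →ₗ[K] M) (e : J → M →ₗ[K] M) : Prop where
  degree_one : ∀ n, ∀ x ∈ gr n, δ x ∈ gr (n + 1)
  sq_zero : δ ∘ₗ δ = 0
  subcomplex : ∀ j, ∀ x ∈ LinearMap.range (e j), δ x ∈ LinearMap.range (e j)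
  comm : ∀ j, e j ∘ₗ δ = δ ∘ₗ e j
  product : ∃ Φ : M ≃L[K] ((j : J) → LinearMap.range (e j)),
    (∀ x j, (Φ x j : M) = e j x) ∧
    (∀ x j, (Φ (δ x) j : M) = δ (Φ x j)) ∧
    (∀ y, HasSum (fun j => (y j : M)) (Φ.symm y)) ∧
    ∀ n x, x ∈ gr n ↔ ∀ j, (Φ x j : M) ∈ gr n

end Hodge

end FormalGeometry

/-!
The operators of the theorem are all built from the shuffle operator `s = μΔ`, and both Hodge
decompositions follow from two facts about it.

*Spectrum.* Lie series are primitive for `Δ`. Hence on a product of `r` Lie monomials `s` is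
multiplication by `2^r` up to products of fewer Lie monomials: `Δ` distributes the factors over the
two tensor factors in `2^r` ways, and reordering them costs only brackets
(`IsLieProd.shuffleL_sub_mem`). A word of length `n` is a product of `n` generators, so
`(s - 2)(s - 4) ⋯ (s - 2^n)` vanishes on words of length `n ≥ 1` (`aeval_prod_apply`); no
Poincaré–Birkhoff–Witt theorem is needed. The Lagrange polynomials of `s` are therefore orthogonal
projections onto its eigenspaces, their sum is the identity, and the one for the eigenvalue `2^0`
vanishes on words of positive length.

*Commutation.* A continuous derivation of the tensor algebra that maps the generators to Lie series
is also a coderivation of `Δ`, so it commutes with `s` (`IsLieDerivation.shuffleL_comm`). This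
applies to `m`, which settles the bar complex, and to the bracket with a Lie series.

For the Hochschild complex, the inverse of `Θ` rotates the monomials of a one-form cyclically until
the differential comes first; it is well defined because it kills commutators
(`thetaInvL_tens_mul`), and every one-form is congruent to one in the image of `Θ`
(`tens_single_mem`). Under `Θ` the Lie derivative of `dtₐ·y` is
`-d(m(tₐ))·y - (-1)^{|tₐ|} dtₐ·m(y)`. The second term commutes with `1 ⊗ s` as `m` commutes with
`s`. For the first, `m(tₐ)` is a Lie series, and `d[p,q]·y` equals `dp·[q,y]` minus a signed `dq·[p,y]`
modulo commutators. By induction, `Θ⁻¹(dp·-)` is for every Lie series `p` a combination of operators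
built from brackets with Lie series, which commute with `s` (`oneTensorL_formCoeff`).

As differentials commuting with `s` preserve its eigenspaces, both complexes split
(`IsProjectionFamily.splitsAsProduct`).

Since the ground ring is evenly graded, all signs depend only on the parity of the degrees of words;
`HasParity` and `twist` express them. Identities between continuous linear maps are checked on
words, which span a dense submodule (`ProMod.map_congr`).
-/

namespace FormalGeometry

/-! ### Continuous linear maps between profinite modules -/

namespace ProMod

variable {X Y K : Type*}

instance : T2Space (ProMod X K) := by
  let _ : TopologicalSpace K := ⊥
  have : DiscreteTopology K := ⟨rfl⟩
  exact inferInstanceAs (T2Space (X → K))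

variable [CommRing K]

@[simp] theorem sum_apply {α : Type*} (S : Finset α) (f : α → ProMod X K) (w : X) :
    (∑ a ∈ S, f a) w = ∑ a ∈ S, f a w := by
  classical
  induction S using Finset.induction_on with
  | empty => simp
  | insert a S ha ih => simp [Finset.sum_insert ha, ih]

open Classical in
/-- The element `x` of the topological basis `X`. -/
noncomputable def single (x : X) : ProMod X K := fun y => if y = x then 1 else 0

@[simp] theorem single_self (x : X) : single (K := K) x x = 1 := by simp [single]

theorem single_of_ne {x y : X} (h : y ≠ x) : single (K := K) x y = 0 := by simp [single, h]

theorem eq_of_single_ne_zero {x y : X} (h : single (K := K) x y ≠ 0) : y = x := by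
  by_contra hne
  exact h (single_of_ne hne)

/-- A linear map with continuous coordinates is continuous. -/
def mkCLM (f : ProMod X K →ₗ[K] ProMod Y K)
    (hf : ∀ y, @Continuous _ K _ ⊥ fun x => f x y) : ProMod X K →L[K] ProMod Y K :=
  ⟨f, continuous_iff.2 hf⟩

/-- As the coefficients are discrete, every coordinate of a continuous linear map depends only on
finitely many coordinates of its argument. -/
theorem exists_finset (f : ProMod X K →L[K] ProMod Y K) (y : Y) :
    ∃ S : Finset X, ∀ x, (∀ i ∈ S, x i = 0) → f x y = 0 := by
  let _ : TopologicalSpace K := ⊥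
  have : DiscreteTopology K := ⟨rfl⟩
  have hc : Continuous fun x : ProMod X K => f x y := (continuous_coord y).comp f.continuous
  have ho : IsOpen {x : ProMod X K | f x y = 0} := (isOpen_discrete ({0} : Set K)).preimage hc
  obtain ⟨I, u, hu, hI⟩ := (isOpen_pi_iff (A := fun _ : X => K)).1 ho (0 : ProMod X K)
    (congrFun (map_zero f) y)
  refine ⟨I, fun x hx => hI fun i hi => ?_⟩
  rw [hx i hi]
  exact (hu i hi).2

theorem map_eq_zero {f : ProMod X K →L[K] ProMod Y K} {x : ProMod X K}
    (h : ∀ i, x i ≠ 0 → f (single i) = 0) : f x = 0 := by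
  classical
  ext y
  obtain ⟨S, hS⟩ := exists_finset f y
  have hx : x = (x - ∑ i ∈ S, x i • single i) + ∑ i ∈ S, x i • single i := by abel
  rw [hx, map_add, add_apply, hS, zero_add, map_sum, sum_apply]
  · refine Finset.sum_eq_zero fun i _ => ?_
    by_cases hi : x i = 0
    · simp [hi]
    · simp [h i hi]
  · intro i hi
    rw [sub_apply, sum_apply, Finset.sum_eq_single i]
    · simp
    · intro j _ hj
      simp [single_of_ne hj.symm]
    · exact fun hn => absurd hi hn

/-- The finite linear combinations of the topological basis are dense. -/
theorem map_congr {f g : ProMod X K →L[K] ProMod Y K} {x : ProMod X K}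
    (h : ∀ i, x i ≠ 0 → f (single i) = g (single i)) : f x = g x := by
  have : (f - g) x = 0 := map_eq_zero fun i hi => by simp [h i hi]
  simpa [sub_eq_zero] using this

theorem clm_ext {f g : ProMod X K →L[K] ProMod Y K}
    (h : ∀ i, f (single i) = g (single i)) : f = g :=
  ContinuousLinearMap.ext fun _ => map_congr fun i _ => h i

/-- A closed submodule containing the topological basis is everything. -/
theorem mem_of_single_mem (N : Submodule K (ProMod X K)) (hN : IsClosed (N : Set (ProMod X K)))
    (h : ∀ i, single i ∈ N) (x : ProMod X K) : x ∈ N := by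
  classical
  have hx : HasSum (fun i => x i • single (K := K) i) x := by
    let _ : TopologicalSpace K := ⊥
    refine Pi.hasSum.2 fun j => ?_
    have := hasSum_single (f := fun i => (x i • single (K := K) i) j) j fun i hi => by
      rw [ProMod.smul_apply, single_of_ne hi.symm, mul_zero]
    rwa [ProMod.smul_apply, single_self, mul_one] at this
  exact hN.mem_of_tendsto hx (Filter.Eventually.of_forall fun S =>
    sum_mem fun i _ => N.smul_mem _ (h i))

theorem ofMatrix_aux {c : X → ProMod Y K} (hc : ∀ y, {x | c x y ≠ 0}.Finite) (F : ProMod X K)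
    (y : Y) : ∑ᶠ x, c x y * F x = ∑ x ∈ (hc y).toFinset, c x y * F x := by
  refine finsum_eq_sum_of_support_subset _ fun x hx => ?_
  rw [Set.Finite.coe_toFinset]
  intro h0
  exact hx (by simp [h0])

/-- The continuous linear map with a given row-finite matrix. -/
noncomputable def ofMatrix (c : X → ProMod Y K) (hc : ∀ y, {x | c x y ≠ 0}.Finite) :
    ProMod X K →L[K] ProMod Y K :=
  mkCLM
    { toFun := fun F y => ∑ᶠ x, c x y * F x
      map_add' := fun F G => ProMod.ext fun y => by
        change ∑ᶠ x, c x y * (F + G) x = ∑ᶠ x, c x y * F x + ∑ᶠ x, c x y * G x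
        rw [ofMatrix_aux hc, ofMatrix_aux hc, ofMatrix_aux hc, ← Finset.sum_add_distrib]
        exact Finset.sum_congr rfl fun _ _ => mul_add _ _ _
      map_smul' := fun a F => ProMod.ext fun y => by
        change ∑ᶠ x, c x y * (a • F) x = a * ∑ᶠ x, c x y * F x
        rw [ofMatrix_aux hc, ofMatrix_aux hc, Finset.mul_sum]
        exact Finset.sum_congr rfl fun _ _ => mul_left_comm _ _ _ }
    (fun y => by
      let _ : TopologicalSpace K := ⊥
      have : DiscreteTopology K := ⟨rfl⟩
      change Continuous fun F : ProMod X K => ∑ᶠ x, c x y * F x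
      simp only [ofMatrix_aux hc]
      exact continuous_finsetSum _ fun x _ => continuous_const.mul (continuous_coord _))

theorem ofMatrix_apply (c : X → ProMod Y K) (hc : ∀ y, {x | c x y ≠ 0}.Finite) (F : ProMod X K)
    (y : Y) : ofMatrix c hc F y = ∑ x ∈ (hc y).toFinset, c x y * F x :=
  ofMatrix_aux hc F y

@[simp] theorem ofMatrix_single (c : X → ProMod Y K) (hc : ∀ y, {x | c x y ≠ 0}.Finite) (x : X) :
    ofMatrix c hc (single x) = c x := by
  ext y
  change ∑ᶠ x', c x' y * single x x' = c x y
  rw [finsum_eq_single _ x fun x' hx' => by simp [single_of_ne hx']]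
  simp

end ProMod

open ProMod

/-! ### Parity -/

section Parity

variable {ι K : Type*} [CommRing K]

theorem sgn_of_even {n : ℤ} (h : Even n) : sgn K n = 1 := by simp [sgn, Int.negOnePow_even _ h]

theorem sgn_congr {a b : ℤ} (h : Even (a - b)) : sgn K a = sgn K b := by
  have : a = (a - b) + b := by ring
  rw [this, sgn_add, sgn_of_even h, one_mul]

theorem sgn_mul_sgn (a : ℤ) : sgn K a * sgn K a = 1 := CInfinityStructure.sgn_mul_self a

theorem wordDeg_nil (d : ι → ℤ) : wordDeg d [] = 0 := rfl

theorem wordDeg_cons (d : ι → ℤ) (a : ι) (w : List ι) :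
    wordDeg d (a :: w) = d a + wordDeg d w := rfl

theorem wordDeg_append (d : ι → ℤ) (u v : List ι) :
    wordDeg d (u ++ v) = wordDeg d u + wordDeg d v := by simp [wordDeg]

theorem wordDeg_take_add_drop (d : ι → ℤ) (w : List ι) (k : ℕ) :
    wordDeg d (w.take k) + wordDeg d (w.drop k) = wordDeg d w := by
  rw [← wordDeg_append, List.take_append_drop]

/-- All words occurring in `x` have degree congruent to `n` modulo two. -/
def HasParity (d : ι → ℤ) (n : ℤ) (x : TSeries ι K) : Prop :=
  ∀ w, x w ≠ 0 → Even (wordDeg d w - n)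

/-- The operator `x ↦ (-1)^{n|x|} x`. -/
def twist (d : ι → ℤ) (n : ℤ) : TSeries ι K →L[K] TSeries ι K :=
  mkCLM
    { toFun := fun x w => sgn K (n * wordDeg d w) * x w
      map_add' := fun _ _ => ProMod.ext fun _ => mul_add _ _ _
      map_smul' := fun _ _ => ProMod.ext fun _ => mul_left_comm _ _ _ }
    (fun w => by
      let _ : TopologicalSpace K := ⊥
      have : DiscreteTopology K := ⟨rfl⟩
      exact continuous_const.mul (continuous_coord w))

variable {d : ι → ℤ}

theorem twist_apply (n : ℤ) (x : TSeries ι K) (w : List ι) :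
    twist d n x w = sgn K (n * wordDeg d w) * x w := rfl

theorem twist_one_eq_parity (x : TSeries ι K) : twist d 1 x = parity d x := by
  ext w
  simp [twist_apply, parity]

theorem HasParity.twist_eq {n : ℤ} {x : TSeries ι K} (h : HasParity d n x) (k : ℤ) :
    twist d k x = sgn K (k * n) • x := by
  ext w
  rw [twist_apply, ProMod.smul_apply]
  by_cases hw : x w = 0
  · simp [hw]
  · congr 1
    refine sgn_congr ?_
    rw [← mul_sub]
    exact (h w hw).mul_left k

theorem twist_twist (k l : ℤ) (x : TSeries ι K) : twist d k (twist d l x) = twist d (k + l) x := by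
  ext w
  simp only [twist_apply, add_mul, sgn_add]
  ring

theorem twist_mul (n : ℤ) (x y : TSeries ι K) :
    twist d n (mul x y) = mul (twist d n x) (twist d n y) := by
  ext w
  simp only [twist_apply, mul, Finset.mul_sum]
  refine Finset.sum_congr rfl fun k _ => ?_
  rw [← wordDeg_take_add_drop d w k, mul_add, sgn_add]
  ring

theorem HasParity.congr {n : ℤ} {x : TSeries ι K} (h : HasParity d n x) {m : ℤ}
    (hm : Even (n - m)) : HasParity d m x := fun w hw => by
  have := (h w hw).add hm
  rwa [sub_add_sub_cancel] at this

theorem hasParity_single (w : List ι) : HasParity (K := K) d (wordDeg d w) (single w) :=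
  fun v hv => by rw [eq_of_single_ne_zero hv]; simp

theorem single_nil : single ([] : List ι) = (one : TSeries ι K) := by
  ext w
  simp [single, one]

theorem single_singleton (a : ι) : single [a] = (gen a : TSeries ι K) := by
  ext w
  simp [single, gen]

theorem hasParity_gen (a : ι) : HasParity (K := K) d (d a) (gen a) := by
  have := hasParity_single (K := K) (d := d) [a]
  rwa [wordDeg_cons, wordDeg_nil, add_zero, single_singleton] at this

theorem hasParity_one : HasParity (K := K) d 0 (one : TSeries ι K) := by
  rw [← single_nil]
  exact hasParity_single []

theorem hasParity_mul {n m : ℤ} {x y : TSeries ι K} (hx : HasParity d n x) (hy : HasParity d m y) :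
    HasParity d (n + m) (mul x y) := by
  intro w hw
  obtain ⟨k, _, hk⟩ := Finset.exists_ne_zero_of_sum_ne_zero hw
  have h1 := hx _ (left_ne_zero_of_mul hk)
  have h2 := hy _ (right_ne_zero_of_mul hk)
  rw [← wordDeg_take_add_drop d w k, add_sub_add_comm]
  exact h1.add h2

theorem hasParity_smul {n : ℤ} {x : TSeries ι K} (hx : HasParity d n x) (c : K) :
    HasParity d n (c • x) := fun w hw => hx w (right_ne_zero_of_mul hw)

theorem hasParity_sub {n : ℤ} {x y : TSeries ι K} (hx : HasParity d n x) (hy : HasParity d n y) :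
    HasParity d n (x - y) := fun w hw => by
  by_cases h : x w = 0
  · refine hy w fun h' => hw ?_
    simp [h, h']
  · exact hx w h

/-- Homogeneous series have a parity, the ground ring being evenly graded. -/
theorem hasParity_of_homogeneous {𝒦 : ℤ → AddSubgroup K} [EvenlyGraded 𝒦] {n : ℤ}
    {x : TSeries ι K} (hx : x ∈ homogeneous 𝒦 d n) : HasParity d n x := by
  intro w hw
  by_contra h
  rw [Int.not_even_iff_odd] at h
  have h0 := hx w
  have h' : Odd (n - wordDeg d w) := by
    rw [← neg_sub]; exact h.neg
  rw [EvenlyGraded.eq_bot_of_odd (𝒦 := 𝒦) _ h', AddSubgroup.mem_bot] at h0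
  exact hw h0

open Classical in
/-- The projection onto the part of parity `n`. -/
noncomputable def parityProj (d : ι → ℤ) (n : ℤ) : TSeries ι K →L[K] TSeries ι K :=
  mkCLM
    { toFun := fun x w => if Even (wordDeg d w - n) then x w else 0
      map_add' := fun x y => ProMod.ext fun w => by
        change (if _ then x w + y w else 0) = (if _ then x w else 0) + (if _ then y w else 0)
        split_ifs <;> simp
      map_smul' := fun c x => ProMod.ext fun w => by
        change (if _ then c * x w else 0) = c * (if _ then x w else 0)
        split_ifs <;> simp }
    (fun w => by
      change @Continuous _ K _ ⊥ fun x : TSeries ι K => if Even (wordDeg d w - n) then x w else 0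
      split_ifs
      · exact continuous_coord w
      · exact @continuous_const _ _ _ ⊥ _)

open Classical in
theorem parityProj_apply (n : ℤ) (x : TSeries ι K) (w : List ι) :
    parityProj d n x w = if Even (wordDeg d w - n) then x w else 0 := rfl

theorem HasParity.parityProj_eq {n : ℤ} {x : TSeries ι K} (h : HasParity d n x) :
    parityProj d n x = x := by
  ext w
  rw [parityProj_apply]
  by_cases hw : x w = 0
  · simp [hw]
  · exact if_pos (h w hw)

theorem HasParity.parityProj_eq_zero {n m : ℤ} {x : TSeries ι K} (h : HasParity d m x)
    (hne : ¬ Even (m - n)) : parityProj d n x = 0 := by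
  ext w
  rw [parityProj_apply]
  by_cases hw : x w = 0
  · simp [hw]
  · refine if_neg fun he => hne ?_
    have := he.sub (h w hw)
    rwa [sub_sub_sub_cancel_left] at this

end Parity

/-! ### Multiplication operators and the graded commutator -/

section Operators

variable {ι K : Type*} [CommRing K] {d : ι → ℤ}

theorem mul_add_right (x y y' : TSeries ι K) : mul x (y + y') = mul x y + mul x y' := by
  ext w
  simp only [mul, ProMod.add_apply, mul_add, Finset.sum_add_distrib]

theorem mul_sub_left (x x' y : TSeries ι K) : mul (x - x') y = mul x y - mul x' y := by
  ext w
  simp only [mul, ProMod.sub_apply, sub_mul, Finset.sum_sub_distrib]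

theorem mul_sub_right (x y y' : TSeries ι K) : mul x (y - y') = mul x y - mul x y' := by
  ext w
  simp only [mul, ProMod.sub_apply, mul_sub, Finset.sum_sub_distrib]

/-- Left multiplication by `p`. -/
def mulLeft (p : TSeries ι K) : TSeries ι K →L[K] TSeries ι K :=
  mkCLM
    { toFun := mul p
      map_add' := mul_add_right p
      map_smul' := fun c x => mul_smul_right c p x }
    (fun w => by
      let _ : TopologicalSpace K := ⊥
      have : DiscreteTopology K := ⟨rfl⟩
      change Continuous fun x : TSeries ι K => mul p x w
      exact continuous_finsetSum _ fun k _ => continuous_const.mul (continuous_coord _))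

/-- Right multiplication by `p`. -/
def mulRight (p : TSeries ι K) : TSeries ι K →L[K] TSeries ι K :=
  mkCLM
    { toFun := fun x => mul x p
      map_add' := fun x y => mul_add_left x y p
      map_smul' := fun c x => mul_smul_left c x p }
    (fun w => by
      let _ : TopologicalSpace K := ⊥
      have : DiscreteTopology K := ⟨rfl⟩
      change Continuous fun x : TSeries ι K => mul x p w
      exact continuous_finsetSum _ fun k _ => (continuous_coord _).mul continuous_const)

@[simp] theorem mulLeft_apply (p x : TSeries ι K) : mulLeft p x = mul p x := rfl

@[simp] theorem mulRight_apply (p x : TSeries ι K) : mulRight p x = mul x p := rfl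

theorem mul_zero_right (p : TSeries ι K) : mul p 0 = 0 := (mulLeft p).map_zero

theorem mul_zero_left (p : TSeries ι K) : mul 0 p = 0 := (mulRight p).map_zero

theorem leftPart_one (b : ι) : leftPart b (one : TSeries ι K) = 0 := by
  ext w
  simp [leftPart_apply, one]

theorem one_mul' (x : TSeries ι K) : mul one x = x := by
  ext w
  cases w with
  | nil => simp [mul_nil, one]
  | cons b w => rw [mul_cons, leftPart_one, mul_zero_left]; simp [one]

theorem leftPart_gen_self (a : ι) : leftPart a (gen (K := K) a) = one := by
  ext w
  simp [leftPart_apply, gen, one]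

theorem leftPart_gen_of_ne {a b : ι} (h : b ≠ a) : leftPart b (gen (K := K) a) = 0 := by
  ext w
  simp [leftPart_apply, gen, h]

theorem gen_mul_nil (a : ι) (x : TSeries ι K) : mul (gen a) x [] = 0 := by
  simp [mul_nil, gen]

theorem leftPart_gen_mul_self (a : ι) (x : TSeries ι K) : leftPart a (mul (gen a) x) = x := by
  rw [leftPart_mul, leftPart_gen_self, one_mul']
  simp [gen]

theorem leftPart_gen_mul_of_ne {a b : ι} (h : b ≠ a) (x : TSeries ι K) :
    leftPart b (mul (gen a) x) = 0 := by
  rw [leftPart_mul, leftPart_gen_of_ne h, mul_zero_left]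
  simp [gen]

theorem single_cons (a : ι) (w : List ι) :
    single (a :: w) = mul (gen (K := K) a) (single w) := by
  classical
  ext v
  cases v with
  | nil => rw [gen_mul_nil]; exact single_of_ne (by simp)
  | cons b v =>
    rw [← leftPart_apply b (mul _ _)]
    by_cases h : b = a
    · subst h
      rw [leftPart_gen_mul_self]
      simp [single]
    · rw [leftPart_gen_mul_of_ne h]
      exact single_of_ne (by simp [h])

theorem single_append (u v : List ι) :
    single (u ++ v) = mul (single (K := K) u) (single v) := by
  induction u with
  | nil => rw [single_nil, one_mul']; rfl
  | cons a u ih => rw [List.cons_append, single_cons, ih, single_cons, mul_assoc']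

theorem mul_one' (x : TSeries ι K) : mul x one = x := by
  have : mulRight (K := K) (ι := ι) one = ContinuousLinearMap.id K _ := clm_ext fun w => by
    rw [mulRight_apply, ← single_nil, ← single_append, List.append_nil]
    rfl
  exact DFunLike.congr_fun this x

/-- For `p` of parity `n` the bracket with `p` is `y ↦ py - (-1)^{n|y|} yp`. -/
theorem gcomm_eq_of_hasParity {n : ℤ} {p : TSeries ι K} (hp : HasParity d n p) (y : TSeries ι K) :
    gcomm d p y = mul p y - mul (twist d n y) p := by
  ext w
  simp only [gcomm, mul, ProMod.sub_apply, ← Finset.sum_sub_distrib, twist_apply]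
  refine Finset.sum_congr rfl fun k _ => ?_
  by_cases h : p (w.drop k) = 0
  · simp [h]
  · congr 1
    rw [← mul_assoc]
    congr 2
    refine sgn_congr ?_
    rw [mul_comm, ← sub_mul]
    exact (hp _ h).mul_right _

theorem hasParity_gcomm {n m : ℤ} {x y : TSeries ι K} (hx : HasParity d n x)
    (hy : HasParity d m y) : HasParity d (n + m) (gcomm d x y) := by
  rw [gcomm_eq_of_hasParity hx, hy.twist_eq, mul_smul_left]
  refine hasParity_sub (hasParity_mul hx hy) (hasParity_smul ?_ _)
  rw [add_comm]
  exact hasParity_mul hy hx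

theorem IsLieMonomial.exists_hasParity {p : TSeries ι K} (hp : IsLieMonomial d p) :
    ∃ n, HasParity d n p := by
  induction hp with
  | gen i => exact ⟨_, hasParity_gen i⟩
  | bracket _ _ h1 h2 =>
    obtain ⟨n, hn⟩ := h1
    obtain ⟨m, hm⟩ := h2
    exact ⟨_, hasParity_gcomm hn hm⟩

/-- Continuous linear maps which agree on the Lie monomials of parity `n` agree on the Lie series of
parity `n`. -/
theorem map_congr_of_mem_lieSeries {Y : Type*} {f g : TSeries ι K →L[K] ProMod Y K} {n : ℤ}
    (h : ∀ q, IsLieMonomial d q → HasParity d n q → f q = g q) {p : TSeries ι K}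
    (hp : p ∈ lieSeries K d) (hn : HasParity d n p) : f p = g p := by
  have hle : lieSeries K d ≤ (⊥ : Submodule K (ProMod Y K)).comap
      ((f - g) ∘L parityProj d n : TSeries ι K →L[K] ProMod Y K).toLinearMap := by
    refine topologicalClosure_le_comap ((f - g) ∘L parityProj d n).continuous ?_ ?_
    · exact isClosed_singleton
    · intro q hq
      obtain ⟨m, hm⟩ := IsLieMonomial.exists_hasParity hq
      change (f - g) (parityProj d n q) = 0
      by_cases he : Even (m - n)
      · have hqn := hm.congr he
        rw [hqn.parityProj_eq]
        simp [h q hq hqn]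
      · rw [hm.parityProj_eq_zero he, map_zero]
  have : (f - g) (parityProj d n p) = 0 := hle hp
  rw [hn.parityProj_eq] at this
  simpa [sub_eq_zero] using this

end Operators

/-! ### Operators on the completed tensor square -/

section TensorSquare

variable {ι K : Type*} [CommRing K] {d : ι → ℤ}

theorem tens_single (u v : List ι) :
    tens (single (K := K) u) (single v) = single (u, v) := by
  classical
  ext ⟨u', v'⟩
  by_cases h1 : u' = u <;> by_cases h2 : v' = v <;> simp [tens, single, h1, h2]

theorem sliceLeft_tens (v : List ι) (x y : TSeries ι K) : sliceLeft v (tens x y) = y v • x := by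
  ext w
  exact mul_comm _ _

theorem sliceRight_tens (u : List ι) (x y : TSeries ι K) : sliceRight u (tens x y) = x u • y := rfl

/-- `x ↦ x ⊗ y`. -/
def tensLeft (y : TSeries ι K) : TSeries ι K →L[K] TSeries₂ ι K :=
  mkCLM
    { toFun := fun x => tens x y
      map_add' := fun _ _ => ProMod.ext fun _ => add_mul _ _ _
      map_smul' := fun _ _ => ProMod.ext fun _ => mul_assoc _ _ _ }
    (fun p => by
      let _ : TopologicalSpace K := ⊥
      have : DiscreteTopology K := ⟨rfl⟩
      change Continuous fun x : TSeries ι K => x p.1 * y p.2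
      exact (continuous_coord _).mul continuous_const)

/-- `y ↦ x ⊗ y`. -/
def tensRight (x : TSeries ι K) : TSeries ι K →L[K] TSeries₂ ι K :=
  mkCLM
    { toFun := fun y => tens x y
      map_add' := fun _ _ => ProMod.ext fun _ => mul_add _ _ _
      map_smul' := fun _ _ => ProMod.ext fun _ => mul_left_comm _ _ _ }
    (fun p => by
      let _ : TopologicalSpace K := ⊥
      have : DiscreteTopology K := ⟨rfl⟩
      change Continuous fun y : TSeries ι K => x p.1 * y p.2
      exact continuous_const.mul (continuous_coord _))

@[simp] theorem tensLeft_apply (x y : TSeries ι K) : tensLeft y x = tens x y := rfl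

theorem tens_add_left (x x' y : TSeries ι K) : tens (x + x') y = tens x y + tens x' y :=
  (tensLeft y).map_add x x'

theorem tens_add_right (x y y' : TSeries ι K) : tens x (y + y') = tens x y + tens x y' :=
  (tensRight x).map_add y y'

theorem tens_sub_left (x x' y : TSeries ι K) : tens (x - x') y = tens x y - tens x' y :=
  (tensLeft y).map_sub x x'

theorem tens_sub_right (x y y' : TSeries ι K) : tens x (y - y') = tens x y - tens x y' :=
  (tensRight x).map_sub y y'

theorem tens_smul_left (c : K) (x y : TSeries ι K) : tens (c • x) y = c • tens x y :=
  (tensLeft y).map_smul c x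

theorem tens_smul_right (c : K) (x y : TSeries ι K) : tens x (c • y) = c • tens x y :=
  (tensRight x).map_smul c y

theorem tens_zero_left (y : TSeries ι K) : tens 0 y = 0 := (tensLeft y).map_zero

theorem tens_zero_right (x : TSeries ι K) : tens x 0 = 0 := (tensRight x).map_zero

theorem continuous_sliceLeft (v : List ι) : Continuous (sliceLeft (K := K) v) :=
  ProMod.continuous_iff.2 fun _ => ProMod.continuous_coord _

theorem continuous_sliceRight (u : List ι) : Continuous (sliceRight (K := K) u) :=
  ProMod.continuous_iff.2 fun _ => ProMod.continuous_coord _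

/-- The operator `f ⊗ 1`. -/
def fstMap (f : TSeries ι K →L[K] TSeries ι K) : TSeries₂ ι K →L[K] TSeries₂ ι K :=
  mkCLM
    { toFun := fun F p => f (sliceLeft p.2 F) p.1
      map_add' := fun F G => ProMod.ext fun p => by
        change f (sliceLeft p.2 (F + G)) p.1 = f (sliceLeft p.2 F) p.1 + f (sliceLeft p.2 G) p.1
        rw [map_add, map_add, ProMod.add_apply]
      map_smul' := fun c F => ProMod.ext fun p => by
        change f (sliceLeft p.2 (c • F)) p.1 = c * f (sliceLeft p.2 F) p.1
        rw [map_smul, map_smul, ProMod.smul_apply] }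
    (fun p => @Continuous.comp _ _ _ _ _ ⊥ _ _ (continuous_coord p.1)
      (f.continuous.comp (continuous_sliceLeft p.2)))

/-- The operator `1 ⊗ f`. -/
def sndMap (f : TSeries ι K →L[K] TSeries ι K) : TSeries₂ ι K →L[K] TSeries₂ ι K :=
  mkCLM
    { toFun := fun F p => f (sliceRight p.1 F) p.2
      map_add' := fun F G => ProMod.ext fun p => by
        change f (sliceRight p.1 (F + G)) p.2 = f (sliceRight p.1 F) p.2 + f (sliceRight p.1 G) p.2
        rw [map_add, map_add, ProMod.add_apply]
      map_smul' := fun c F => ProMod.ext fun p => by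
        change f (sliceRight p.1 (c • F)) p.2 = c * f (sliceRight p.1 F) p.2
        rw [map_smul, map_smul, ProMod.smul_apply] }
    (fun p => @Continuous.comp _ _ _ _ _ ⊥ _ _ (continuous_coord p.2)
      (f.continuous.comp (continuous_sliceRight p.1)))

theorem fstMap_apply (f : TSeries ι K →L[K] TSeries ι K) (F : TSeries₂ ι K) (u v : List ι) :
    fstMap f F (u, v) = f (sliceLeft v F) u := rfl

theorem sndMap_apply (f : TSeries ι K →L[K] TSeries ι K) (F : TSeries₂ ι K) (u v : List ι) :
    sndMap f F (u, v) = f (sliceRight u F) v := rfl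

@[simp] theorem fstMap_tens (f : TSeries ι K →L[K] TSeries ι K) (x y : TSeries ι K) :
    fstMap f (tens x y) = tens (f x) y := by
  ext ⟨u, v⟩
  rw [fstMap_apply, sliceLeft_tens, map_smul]
  exact mul_comm _ _

@[simp] theorem sndMap_tens (f : TSeries ι K →L[K] TSeries ι K) (x y : TSeries ι K) :
    sndMap f (tens x y) = tens x (f y) := by
  ext ⟨u, v⟩
  rw [sndMap_apply, sliceRight_tens, map_smul]
  rfl

/-- Continuous linear maps on the tensor square are determined by their values on tensors. -/
theorem clm_ext_tens {Y : Type*} {f g : TSeries₂ ι K →L[K] ProMod Y K}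
    (h : ∀ x y, f (tens x y) = g (tens x y)) : f = g :=
  clm_ext fun ⟨u, v⟩ => by rw [← tens_single, h]

/-- The operator `ξ ⊗ 1 + 1 ⊗ ξ` for an operator `ξ` of degree `n`, with the sign
`(1 ⊗ ξ)(x ⊗ y) = (-1)^{n|x|} x ⊗ ξ(y)`. -/
def tensDer (d : ι → ℤ) (n : ℤ) (ξ : TSeries ι K →L[K] TSeries ι K) :
    TSeries₂ ι K →L[K] TSeries₂ ι K :=
  fstMap ξ + fstMap (twist d n) ∘L sndMap ξ

/-- Left multiplication by `p ⊗ 1 + 1 ⊗ p` for `p` of degree `n`. -/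
abbrev primOp (d : ι → ℤ) (n : ℤ) (p : TSeries ι K) : TSeries₂ ι K →L[K] TSeries₂ ι K :=
  tensDer d n (mulLeft p)

theorem tensDer_tens (n : ℤ) (ξ : TSeries ι K →L[K] TSeries ι K) (x y : TSeries ι K) :
    tensDer d n ξ (tens x y) = tens (ξ x) y + tens (twist d n x) (ξ y) := by
  simp [tensDer]

theorem tensDer_apply (n : ℤ) (ξ : TSeries ι K →L[K] TSeries ι K) (F : TSeries₂ ι K)
    (u v : List ι) : tensDer d n ξ F (u, v) =
      ξ (sliceLeft v F) u + sgn K (n * wordDeg d u) * ξ (sliceRight u F) v := rfl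

/-- `p ↦ (p ⊗ 1 + 1 ⊗ p) F` for `p` of degree `n`. -/
def primOpLeft (d : ι → ℤ) (n : ℤ) (F : TSeries₂ ι K) : TSeries ι K →L[K] TSeries₂ ι K :=
  mkCLM
    { toFun := fun p => primOp d n p F
      map_add' := fun p q => ProMod.ext fun ⟨u, v⟩ => by
        simp only [tensDer_apply, ProMod.add_apply, mulLeft_apply, mul_add_left]
        ring
      map_smul' := fun c p => ProMod.ext fun ⟨u, v⟩ => by
        simp only [tensDer_apply, ProMod.smul_apply, mulLeft_apply, mul_smul_left,
          RingHom.id_apply]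
        ring }
    (fun ⟨u, v⟩ => by
      let _ : TopologicalSpace K := ⊥
      have : DiscreteTopology K := ⟨rfl⟩
      change Continuous fun p : TSeries ι K => mul p (sliceLeft v F) u +
        sgn K (n * wordDeg d u) * mul p (sliceRight u F) v
      exact ((continuous_coord u).comp (mulRight (sliceLeft v F)).continuous).add
        (continuous_const.mul ((continuous_coord v).comp (mulRight (sliceRight u F)).continuous)))

@[simp] theorem primOpLeft_apply (n : ℤ) (F : TSeries₂ ι K) (p : TSeries ι K) :
    primOpLeft d n F p = primOp d n p F := rfl

/-- The multiplication `μ` as a continuous linear map. -/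
def mulMapL : TSeries₂ ι K →L[K] TSeries ι K :=
  mkCLM (mulMap ι K) (fun w => by
    let _ : TopologicalSpace K := ⊥
    have : DiscreteTopology K := ⟨rfl⟩
    change Continuous fun F : TSeries₂ ι K =>
      ∑ k ∈ Finset.range (w.length + 1), F (w.take k, w.drop k)
    exact continuous_finsetSum _ fun k _ => continuous_coord _)

theorem mulMapL_tens (x y : TSeries ι K) : mulMapL (tens x y) = mul x y := rfl

/-! ### The shuffle coproduct -/

theorem continuous_shuffleCoeff (d : ι → ℤ) (u v : List ι) :
    @Continuous (TSeries ι K) K _ ⊥ (shuffleCoeff d u v) := by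
  let _ : TopologicalSpace K := ⊥
  have : DiscreteTopology K := ⟨rfl⟩
  match u, v with
  | [], v =>
    have : shuffleCoeff (K := K) d [] v = fun x => x v := by ext x; simp [shuffleCoeff]
    rw [this]
    exact continuous_coord v
  | a :: u, [] =>
    have : shuffleCoeff (K := K) d (a :: u) [] = fun x => x (a :: u) := by
      ext x; simp [shuffleCoeff]
    rw [this]
    exact continuous_coord _
  | a :: u, b :: v =>
    have : shuffleCoeff (K := K) d (a :: u) (b :: v) = fun x =>
        shuffleCoeff d u (b :: v) (leftPart a x) +
          sgn K (d b * wordDeg d (a :: u)) * shuffleCoeff d (a :: u) v (leftPart b x) := by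
      ext x
      rw [shuffleCoeff]
    rw [this]
    exact ((continuous_shuffleCoeff d u (b :: v)).comp (continuous_leftPart a)).add
      (continuous_const.mul ((continuous_shuffleCoeff d (a :: u) v).comp (continuous_leftPart b)))
termination_by u.length + v.length

/-- The shuffle coproduct as a continuous linear map. -/
def comulL (d : ι → ℤ) : TSeries ι K →L[K] TSeries₂ ι K :=
  mkCLM (comul d) fun p => continuous_shuffleCoeff d p.1 p.2

theorem comulL_apply (x : TSeries ι K) (u v : List ι) :
    comulL d x (u, v) = shuffleCoeff d u v x := rfl

theorem shuffleCoeff_zero (u v : List ι) : shuffleCoeff d u v (0 : TSeries ι K) = 0 :=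
  congrFun (comulL d).map_zero (u, v)

theorem shuffleCoeff_nil_right (u : List ι) (x : TSeries ι K) : shuffleCoeff d u [] x = x u := by
  cases u <;> simp [shuffleCoeff]

theorem shuffleCoeff_nil_left (v : List ι) (x : TSeries ι K) : shuffleCoeff d [] v x = x v := by
  simp [shuffleCoeff]

theorem comulL_one : comulL d (one : TSeries ι K) = tens one one := by
  ext ⟨u, v⟩
  rw [comulL_apply]
  match u, v with
  | [], v => simp [shuffleCoeff, tens, one]
  | a :: u, [] => simp [shuffleCoeff, tens, one]
  | a :: u, b :: v =>
    rw [shuffleCoeff, leftPart_one, leftPart_one, shuffleCoeff_zero, shuffleCoeff_zero]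
    simp [tens, one]

theorem gen_mul_cons_self (a : ι) (x : TSeries ι K) (w : List ι) :
    mul (gen a) x (a :: w) = x w := by
  rw [← leftPart_apply a (mul _ _), leftPart_gen_mul_self]

theorem gen_mul_cons_of_ne {a b : ι} (h : b ≠ a) (x : TSeries ι K) (w : List ι) :
    mul (gen a) x (b :: w) = 0 := by
  rw [← leftPart_apply b (mul _ _), leftPart_gen_mul_of_ne h, ProMod.zero_apply]

theorem shuffleCoeff_leftPart_gen_mul (a b : ι) (x : TSeries ι K) (u v w : List ι)
    (G : TSeries ι K) (hG : shuffleCoeff d u v x = G w) :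
    shuffleCoeff d u v (leftPart b (mul (gen a) x)) = mul (gen a) G (b :: w) := by
  by_cases h : b = a
  · subst h
    rw [leftPart_gen_mul_self, gen_mul_cons_self, hG]
  · rw [leftPart_gen_mul_of_ne h, gen_mul_cons_of_ne h, shuffleCoeff_zero]

/-- The generators are primitive. -/
theorem comulL_gen_mul (a : ι) (x : TSeries ι K) :
    comulL d (mul (gen a) x) = primOp d (d a) (gen a) (comulL d x) := by
  ext ⟨u, v⟩
  rw [comulL_apply, tensDer_apply, mulLeft_apply, mulLeft_apply]
  match u, v with
  | [], v =>
    have : sliceRight [] (comulL d x) = x := ProMod.ext fun w => shuffleCoeff_nil_left w x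
    rw [gen_mul_nil, shuffleCoeff_nil_left, wordDeg_nil, mul_zero, sgn_zero, one_mul, zero_add,
      this]
  | b :: u, [] =>
    have : sliceLeft [] (comulL d x) = x := ProMod.ext fun w => shuffleCoeff_nil_right w x
    rw [gen_mul_nil, shuffleCoeff_nil_right, mul_zero, add_zero, this]
  | b :: u, c :: v =>
    rw [shuffleCoeff,
      shuffleCoeff_leftPart_gen_mul a b x u (c :: v) u (sliceLeft (c :: v) (comulL d x)) rfl,
      shuffleCoeff_leftPart_gen_mul a c x (b :: u) v v (sliceRight (b :: u) (comulL d x)) rfl]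
    congr 1
    by_cases h : c = a
    · rw [h]
    · rw [gen_mul_cons_of_ne h, mul_zero, mul_zero]

/-- Lie monomials are primitive: the operators `primOp` represent the graded commutator. -/
theorem comulL_mul_of_isLieMonomial {p : TSeries ι K} (hp : IsLieMonomial d p) :
    ∃ n, HasParity d n p ∧ ∀ x, comulL d (mul p x) = primOp d n p (comulL d x) := by
  induction hp with
  | gen i => exact ⟨_, hasParity_gen i, comulL_gen_mul i⟩
  | @bracket p q _ _ h1 h2 =>
    obtain ⟨n, hn, hp⟩ := h1
    obtain ⟨m, hm, hq⟩ := h2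
    refine ⟨_, hasParity_gcomm hn hm, fun x => ?_⟩
    have key : primOp d (n + m) (gcomm d p q) =
        primOp d n p ∘L primOp d m q - sgn K (n * m) • (primOp d m q ∘L primOp d n p) := by
      refine clm_ext_tens fun x y => ?_
      simp only [_root_.sub_apply, _root_.smul_apply,
        ContinuousLinearMap.comp_apply, tensDer_tens, map_add, mulLeft_apply, twist_mul,
        hn.twist_eq, hm.twist_eq, twist_twist, gcomm_eq_of_hasParity hn, mul_smul_left,
        mul_sub_left, mul_assoc', tens_sub_left, tens_sub_right, tens_smul_left,
        tens_smul_right, smul_add, smul_smul, add_comm m n, mul_comm m n, sgn_mul_sgn, one_smul]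
      abel
    rw [key, gcomm_eq_of_hasParity hn, hm.twist_eq, mul_smul_left, mul_sub_left, mul_smul_left,
      mul_assoc', mul_assoc', map_sub, map_smul, hp, hq, hq, hp]
    rfl

theorem primOp_eq_of_hasParity {n m : ℤ} {p : TSeries ι K} (hn : HasParity d n p)
    (hm : HasParity d m p) : primOp d n p = primOp d m p := by
  by_cases hp : p = 0
  · subst hp
    refine clm_ext_tens fun x y => ?_
    simp only [tensDer_tens, mulLeft_apply, mul_zero_left, tens_zero_right]
  · obtain ⟨w, hw⟩ : ∃ w, p w ≠ 0 := by
      by_contra h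
      push Not at h
      exact hp (ProMod.ext h)
    have he : Even (n - m) := by
      have := (hm w hw).sub (hn w hw)
      rwa [sub_sub_sub_cancel_left] at this
    ext F ⟨u, v⟩
    rw [tensDer_apply, tensDer_apply, sgn_congr (a := n * wordDeg d u) (b := m * wordDeg d u)]
    rw [← sub_mul]
    exact he.mul_right _

/-- Lie series are primitive. -/
theorem comulL_mul_of_mem_lieSeries {p : TSeries ι K} {n : ℤ} (hp : p ∈ lieSeries K d)
    (hn : HasParity d n p) (x : TSeries ι K) :
    comulL d (mul p x) = primOp d n p (comulL d x) := by
  refine map_congr_of_mem_lieSeries (f := comulL d ∘L mulRight x)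
    (g := primOpLeft d n (comulL d x)) (fun q hq hqn => ?_) hp hn
  obtain ⟨m, hm, h⟩ := comulL_mul_of_isLieMonomial hq
  rw [ContinuousLinearMap.comp_apply, mulRight_apply, h, primOpLeft_apply,
    primOp_eq_of_hasParity hqn hm]

/-- The operator `s = μΔ` as a continuous linear map. -/
def shuffleL (d : ι → ℤ) : TSeries ι K →L[K] TSeries ι K := mulMapL ∘L comulL d

theorem shuffleL_apply (x : TSeries ι K) : shuffleL d x = shuffleOp d x := rfl

/-! ### Derivations which preserve the Lie series commute with the shuffle operator -/

/-- A continuous derivation of degree `n` of the tensor algebra which maps the generators to Lie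
series. -/
structure IsLieDerivation (d : ι → ℤ) (n : ℤ) (ξ : TSeries ι K →L[K] TSeries ι K) : Prop where
  leibniz : ∀ x y, ξ (mul x y) = mul (ξ x) y + mul (twist d n x) (ξ y)
  mem : ∀ a, ξ (gen a) ∈ lieSeries K d
  parity : ∀ a, HasParity d (n + d a) (ξ (gen a))

namespace IsLieDerivation

variable {n : ℤ} {ξ : TSeries ι K →L[K] TSeries ι K}

theorem map_one (h : IsLieDerivation d n ξ) : ξ one = 0 := by
  have := h.leibniz one one
  rw [hasParity_one.twist_eq, mul_zero, sgn_zero, one_smul, one_mul', one_mul', mul_one'] at this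
  simpa using this

theorem map_twist (h : IsLieDerivation d n ξ) (k : ℤ) (x : TSeries ι K) :
    ξ (twist d k x) = sgn K (k * n) • twist d k (ξ x) := by
  have : ξ ∘L twist d k = sgn K (k * n) • (twist d k ∘L ξ) := by
    refine clm_ext fun w => ?_
    induction w with
    | nil =>
      simp only [_root_.smul_apply, ContinuousLinearMap.comp_apply, single_nil,
        hasParity_one.twist_eq, map_smul, h.map_one, map_zero, smul_zero]
    | cons a w ih =>
      simp only [_root_.smul_apply, ContinuousLinearMap.comp_apply] at ih
      simp only [_root_.smul_apply, ContinuousLinearMap.comp_apply, single_cons,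
        twist_mul, h.leibniz, map_add, (hasParity_gen a).twist_eq, map_smul, mul_smul_left, ih,
        (h.parity a).twist_eq, mul_smul_right, smul_add, smul_smul]
      congr 2
      · rw [← sgn_add]
        refine sgn_congr ?_
        ring_nf
        exact (even_two.mul_left _).neg
      · ring
  exact DFunLike.congr_fun this x

theorem tensDer_primOp (h : IsLieDerivation d n ξ) (a : ι) (F : TSeries₂ ι K) :
    tensDer d n ξ (primOp d (d a) (gen a) F) = primOp d (n + d a) (ξ (gen a)) F +
      sgn K (n * d a) • primOp d (d a) (gen a) (tensDer d n ξ F) := by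
  have : tensDer d n ξ ∘L primOp d (d a) (gen a) = primOp d (n + d a) (ξ (gen a)) +
      sgn K (n * d a) • (primOp d (d a) (gen a) ∘L tensDer d n ξ) := by
    refine clm_ext_tens fun x y => ?_
    simp only [_root_.add_apply, _root_.smul_apply,
      ContinuousLinearMap.comp_apply, tensDer_tens, map_add, mulLeft_apply, twist_mul, h.leibniz,
      (hasParity_gen a).twist_eq, h.map_twist, mul_smul_left, tens_add_left, tens_add_right,
      tens_smul_left, tens_smul_right, smul_add, twist_twist, mul_comm (d a) n, add_comm (d a) n]
    abel
  exact DFunLike.congr_fun this F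

/-- A derivation which preserves the Lie series is a coderivation of the shuffle coproduct. -/
theorem comulL_apply (h : IsLieDerivation d n ξ) (x : TSeries ι K) :
    comulL d (ξ x) = tensDer d n ξ (comulL d x) := by
  have : comulL d ∘L ξ = tensDer d n ξ ∘L comulL d := by
    refine clm_ext fun w => ?_
    simp only [ContinuousLinearMap.comp_apply]
    induction w with
    | nil =>
      rw [single_nil, h.map_one, map_zero, comulL_one, tensDer_tens, h.map_one, tens_zero_left,
        tens_zero_right, add_zero]
    | cons a w ih =>
      rw [single_cons, h.leibniz, map_add, comulL_gen_mul, h.tensDer_primOp,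
        comulL_mul_of_mem_lieSeries (h.mem a) (h.parity a), (hasParity_gen a).twist_eq,
        mul_smul_left, map_smul, comulL_gen_mul, ih]
  exact DFunLike.congr_fun this x

theorem shuffleL_comm (h : IsLieDerivation d n ξ) (x : TSeries ι K) :
    shuffleL d (ξ x) = ξ (shuffleL d x) := by
  have : mulMapL ∘L tensDer d n ξ = ξ ∘L mulMapL := by
    refine clm_ext_tens fun x y => ?_
    simp only [ContinuousLinearMap.comp_apply, tensDer_tens, map_add, mulMapL_tens, h.leibniz]
  change mulMapL (comulL d (ξ x)) = _
  rw [h.comulL_apply]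
  exact DFunLike.congr_fun this _

end IsLieDerivation

/-- The bracket with `p`, for `p` of parity `n`. -/
def adL (d : ι → ℤ) (n : ℤ) (p : TSeries ι K) : TSeries ι K →L[K] TSeries ι K :=
  mulLeft p - mulRight p ∘L twist d n

theorem adL_apply (n : ℤ) (p x : TSeries ι K) :
    adL d n p x = mul p x - mul (twist d n x) p := rfl

theorem isLieDerivation_adL {n : ℤ} {p : TSeries ι K} (hp : p ∈ lieSeries K d)
    (hn : HasParity d n p) : IsLieDerivation d n (adL d n p) where
  leibniz x y := by
    simp only [adL_apply, twist_mul, mul_sub_left, mul_sub_right, mul_assoc']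
    abel
  mem a := by
    rw [adL_apply, ← gcomm_eq_of_hasParity hn]
    exact gcomm_mem d hp (lieGen d a).2
  parity a := by
    rw [adL_apply, ← gcomm_eq_of_hasParity hn]
    exact hasParity_gcomm hn (hasParity_gen a)

end TensorSquare

/-! ### The filtration by the number of Lie factors -/

section Filtration

variable {ι K : Type*} [CommRing K] {d : ι → ℤ}

/-- Products of `r` Lie monomials. -/
inductive IsLieProd (d : ι → ℤ) : ℕ → TSeries ι K → Prop
  | base : IsLieProd d 0 one
  | cons {r : ℕ} {p x : TSeries ι K} (hp : IsLieMonomial d p) (hx : IsLieProd d r x) :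
      IsLieProd d (r + 1) (mul p x)

/-- The span of the products of fewer than `r` Lie monomials. -/
def lieFiltration (K : Type*) [CommRing K] (d : ι → ℤ) (r : ℕ) : Submodule K (TSeries ι K) :=
  Submodule.span K {x | ∃ k < r, IsLieProd d k x}

theorem IsLieProd.mem {r k : ℕ} {x : TSeries ι K} (hx : IsLieProd d k x) (h : k < r) :
    x ∈ lieFiltration K d r := Submodule.subset_span ⟨k, h, hx⟩

theorem lieFiltration_mono {r r' : ℕ} (h : r ≤ r') : lieFiltration K d r ≤ lieFiltration K d r' :=
  Submodule.span_mono fun _ ⟨k, hk, hx⟩ => ⟨k, hk.trans_le h, hx⟩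

theorem isLieProd_single (w : List ι) : IsLieProd (K := K) d w.length (single w) := by
  induction w with
  | nil => exact single_nil (ι := ι) (K := K) ▸ IsLieProd.base
  | cons a w ih => exact single_cons (K := K) a w ▸ IsLieProd.cons (IsLieMonomial.gen a) ih

theorem IsLieProd.exists_hasParity {r : ℕ} {x : TSeries ι K} (hx : IsLieProd d r x) :
    ∃ n, HasParity d n x := by
  induction hx with
  | base => exact ⟨0, hasParity_one⟩
  | cons hp _ ih =>
    obtain ⟨n, hn⟩ := hp.exists_hasParity
    obtain ⟨m, hm⟩ := ih
    exact ⟨_, hasParity_mul hn hm⟩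

theorem IsLieProd.mul_isLieProd {r k : ℕ} {x y : TSeries ι K} (hx : IsLieProd d r x)
    (hy : IsLieProd d k y) : IsLieProd d (r + k) (mul x y) := by
  induction hx with
  | base => rwa [one_mul', zero_add]
  | cons hp _ ih =>
    rw [mul_assoc', add_right_comm]
    exact IsLieProd.cons hp ih

theorem map_mem_of_span {A B : Type*} [AddCommGroup A] [Module K A] [AddCommGroup B] [Module K B]
    (f : A →ₗ[K] B) {s : Set A} {N : Submodule K B} (h : ∀ x ∈ s, f x ∈ N) {x : A}
    (hx : x ∈ Submodule.span K s) : f x ∈ N :=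
  (Submodule.span_le (p := N.comap f)).2 h hx

theorem mul_mem_lieFiltration_left {r k : ℕ} {x y : TSeries ι K} (hx : IsLieProd d k x)
    (hy : y ∈ lieFiltration K d r) : mul x y ∈ lieFiltration K d (k + r) :=
  map_mem_of_span (mulLeft x).toLinearMap
    (by rintro _ ⟨_, hj, hz⟩; exact (hx.mul_isLieProd hz).mem (Nat.add_lt_add_left hj k)) hy

theorem mul_mem_lieFiltration_right {r k : ℕ} {x y : TSeries ι K} (hx : IsLieProd d k x)
    (hy : y ∈ lieFiltration K d r) : mul y x ∈ lieFiltration K d (r + k) :=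
  map_mem_of_span (mulRight x).toLinearMap
    (by rintro _ ⟨_, hj, hz⟩; exact (hz.mul_isLieProd hx).mem (Nat.add_lt_add_right hj k)) hy

/-- A Lie monomial commutes with a product of `r` Lie monomials up to products of at most `r` Lie
monomials: the difference is a sum of products in which one factor is replaced by a bracket. -/
theorem IsLieProd.twist_mul_sub_mem {r : ℕ} {m : ℤ} {p y : TSeries ι K} (hp : IsLieMonomial d p)
    (hm : HasParity d m p) (hy : IsLieProd d r y) :
    mul (twist d m y) p - mul p y ∈ lieFiltration K d (r + 1) := by
  induction hy with
  | base =>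
    rw [hasParity_one.twist_eq, mul_zero, sgn_zero, one_smul, one_mul', mul_one', sub_self]
    exact zero_mem _
  | @cons r q y hq hy ih =>
    obtain ⟨k, hk⟩ := hq.exists_hasParity
    have e : mul (twist d m (mul q y)) p -
        mul p (mul q y) =
        sgn K (m * k) • mul q
          (mul (twist d m y) p - mul p y) -
        mul (gcomm d p q) y := by
      rw [gcomm_eq_of_hasParity hm, twist_mul, hk.twist_eq]
      simp only [mul_sub_right, mul_sub_left, mul_smul_left, mul_assoc', smul_sub]
      abel
    rw [e]
    refine sub_mem (Submodule.smul_mem _ _ ?_) ?_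
    · have hq1 : IsLieProd d 1 q := by
        simpa [mul_one'] using IsLieProd.cons hq (IsLieProd.base (K := K) (d := d))
      have := mul_mem_lieFiltration_left hq1 ih
      rwa [add_comm] at this
    · exact (IsLieProd.cons (IsLieMonomial.bracket hp hq) hy).mem (Nat.lt_succ_self _)

/-- The coproduct of a product of `r` Lie monomials distributes the factors over the two sides. -/
theorem IsLieProd.comulL_mem {r : ℕ} {x : TSeries ι K} (hx : IsLieProd d r x) :
    comulL d x ∈ Submodule.span K {F : TSeries₂ ι K | ∃ a b y z, IsLieProd d a y ∧
      IsLieProd d b z ∧ a + b = r ∧ F = tens y z} := by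
  induction hx with
  | base =>
    rw [comulL_one]
    exact Submodule.subset_span ⟨0, 0, _, _, .base, .base, rfl, rfl⟩
  | @cons r p x hp hx ih =>
    obtain ⟨n, hn, h⟩ := comulL_mul_of_isLieMonomial hp
    rw [h]
    refine map_mem_of_span (primOp d n p).toLinearMap ?_ ih
    rintro _ ⟨a, b, y, z, hy, hz, hab, rfl⟩
    change primOp d n p (tens y z) ∈ _
    obtain ⟨k, hk⟩ := hy.exists_hasParity
    rw [tensDer_tens, hk.twist_eq, tens_smul_left]
    refine add_mem (Submodule.subset_span ⟨a + 1, b, _, _, .cons hp hy, hz, by omega, rfl⟩)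
      (Submodule.smul_mem _ _
        (Submodule.subset_span ⟨a, b + 1, _, _, hy, .cons hp hz, by omega, rfl⟩))

/-- On products of `r` Lie monomials the shuffle operator is multiplication by `2^r`, up to products
of fewer Lie monomials. -/
theorem IsLieProd.shuffleL_sub_mem {r : ℕ} {x : TSeries ι K} (hx : IsLieProd d r x) :
    shuffleL d x - (2 : K) ^ r • x ∈ lieFiltration K d r := by
  induction hx with
  | base =>
    have : shuffleL d (one : TSeries ι K) = one := by
      change mulMapL (comulL d one) = _
      rw [comulL_one, mulMapL_tens, one_mul']
    rw [this, pow_zero, one_smul, sub_self]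
    exact zero_mem _
  | @cons r p x hp hx ih =>
    obtain ⟨n, hn, h⟩ := comulL_mul_of_isLieMonomial hp
    have key : ∀ F ∈ Submodule.span K {F : TSeries₂ ι K | ∃ a b y z, IsLieProd d a y ∧
        IsLieProd d b z ∧ a + b = r ∧ F = tens y z},
        mulMapL (primOp d n p F) - (2 : K) • mul p (mulMapL F) ∈
          lieFiltration K d (r + 1) := by
      refine fun F => map_mem_of_span
        (mulMapL ∘L primOp d n p - (2 : K) • (mulLeft p ∘L mulMapL)).toLinearMap ?_
      rintro _ ⟨a, b, y, z, hy, hz, rfl, rfl⟩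
      change mulMapL (primOp d n p (tens y z)) -
        (2 : K) • mul p (mulMapL (tens y z)) ∈ _
      have e : mulMapL (primOp d n p (tens y z)) -
          (2 : K) • mul p (mulMapL (tens y z)) =
          FormalGeometry.mul
            (mul (twist d n y) p - mul p y) z := by
        rw [tensDer_tens, map_add, mulMapL_tens, mulMapL_tens, mulMapL_tens, two_smul,
          mulLeft_apply, mulLeft_apply, mul_sub_left, mul_assoc', mul_assoc']
        abel
      rw [e]
      have := mul_mem_lieFiltration_right hz (IsLieProd.twist_mul_sub_mem hp hn hy)
      rwa [add_right_comm] at this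
    have hp1 : IsLieProd d 1 p := by
      simpa [mul_one'] using IsLieProd.cons hp (IsLieProd.base (K := K) (d := d))
    have h1 := key _ hx.comulL_mem
    have h2 := mul_mem_lieFiltration_left hp1 ih
    rw [add_comm] at h2
    have e : shuffleL d (mul p x) - (2 : K) ^ (r + 1) • mul p x =
        (mulMapL (primOp d n p (comulL d x)) -
          (2 : K) • mul p (mulMapL (comulL d x))) +
        (2 : K) • mul p (shuffleL d x - (2 : K) ^ r • x) := by
      change mulMapL (comulL d (mul p x)) - _ = _ + (2 : K) •
        mul p (mulMapL (comulL d x) - _)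
      rw [h, mul_sub_right, mul_smul_right, pow_succ']
      module
    rw [e]
    exact add_mem h1 (Submodule.smul_mem _ _ h2)

theorem shuffleL_sub_mem_lieFiltration {r : ℕ} {x : TSeries ι K}
    (hx : x ∈ lieFiltration K d (r + 1)) :
    shuffleL d x - (2 : K) ^ r • x ∈ lieFiltration K d r := by
  refine map_mem_of_span (shuffleL d - (2 : K) ^ r • ContinuousLinearMap.id K _).toLinearMap ?_ hx
  rintro y ⟨k, hk, hy⟩
  change shuffleL d y - (2 : K) ^ r • y ∈ _
  have h := hy.shuffleL_sub_mem
  rcases Nat.lt_succ_iff_lt_or_eq.1 hk with hk | rfl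
  · have e : shuffleL d y - (2 : K) ^ r • y =
        (shuffleL d y - (2 : K) ^ k • y) + ((2 : K) ^ k - 2 ^ r) • y := by module
    rw [e]
    exact add_mem (lieFiltration_mono hk.le h) (Submodule.smul_mem _ _ (hy.mem hk))
  · exact h

open Polynomial in
/-- The operator `(s - 2)(s - 4) ⋯ (s - 2^n)` maps the span of products of at most `n` Lie monomials
into the constants. -/
theorem aeval_prod_mem_lieFiltration (n : ℕ) {x : TSeries ι K}
    (hx : x ∈ lieFiltration K d (n + 1)) :
    aeval (shuffleOp d) (∏ r ∈ Finset.range n, (X - C ((2 : K) ^ (r + 1)))) x ∈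
      lieFiltration K d 1 := by
  induction n generalizing x with
  | zero => simpa using hx
  | succ n ih =>
    rw [Finset.prod_range_succ, map_mul, Module.End.mul_apply]
    refine ih ?_
    rw [map_sub, aeval_X, aeval_C, LinearMap.sub_apply, Module.algebraMap_end_apply]
    exact shuffleL_sub_mem_lieFiltration hx

theorem apply_eq_zero_of_mem_lieFiltration_one {x : TSeries ι K} (hx : x ∈ lieFiltration K d 1)
    {w : List ι} (hw : w ≠ []) : x w = 0 := by
  refine Submodule.span_induction ?_ rfl (fun y z _ _ hy hz => ?_) (fun c y _ hy => ?_) hx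
  · rintro y ⟨k, hk, hy⟩
    obtain rfl : k = 0 := by omega
    cases hy
    simp [one, hw]
  · rw [ProMod.add_apply, hy, hz, add_zero]
  · rw [ProMod.smul_apply, hy, mul_zero]

end Filtration

/-! ### The spectrum of the shuffle operator -/

section Spectrum

variable {ι K : Type*} [CommRing K] {d : ι → ℤ}

open Polynomial

theorem shuffleCoeff_congr (u v : List ι) {x y : TSeries ι K}
    (h : ∀ w, w.length = u.length + v.length → x w = y w) :
    shuffleCoeff d u v x = shuffleCoeff d u v y := by
  fun_induction shuffleCoeff d u v x generalizing y with
  | case1 => simp [shuffleCoeff, h]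
  | case2 => simp [shuffleCoeff, h]
  | case3 a u b v x ih1 ih2 =>
    rw [shuffleCoeff, ih1 (y := leftPart a y), ih2 (y := leftPart b y)]
    · intro w hw
      exact h _ (by simp [hw]; omega)
    · intro w hw
      exact h _ (by simp [hw]; omega)

/-- The shuffle operator preserves the length of words. -/
theorem shuffleOp_congr {x y : TSeries ι K} {n : ℕ} (h : ∀ w, w.length = n → x w = y w)
    {w : List ι} (hw : w.length = n) : shuffleOp d x w = shuffleOp d y w := by
  change ∑ k ∈ Finset.range (w.length + 1), shuffleCoeff d (w.take k) (w.drop k) x =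
    ∑ k ∈ Finset.range (w.length + 1), shuffleCoeff d (w.take k) (w.drop k) y
  refine Finset.sum_congr rfl fun k _ => shuffleCoeff_congr _ _ fun v hv => h v ?_
  rw [hv, ← List.length_append, List.take_append_drop, hw]

theorem aeval_shuffleOp_congr (P : K[X]) {x y : TSeries ι K} {n : ℕ}
    (h : ∀ w, w.length = n → x w = y w) {w : List ι} (hw : w.length = n) :
    aeval (shuffleOp d) P x w = aeval (shuffleOp d) P y w := by
  induction P using Polynomial.induction_on' with
  | add P Q hP hQ =>
    simp only [map_add, LinearMap.add_apply, ProMod.add_apply, hP, hQ]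
  | monomial m c =>
    have : ∀ w, w.length = n → (shuffleOp d ^ m) x w = (shuffleOp d ^ m) y w := by
      induction m with
      | zero => exact h
      | succ m ih =>
        intro w hw
        rw [pow_succ', Module.End.mul_apply, Module.End.mul_apply]
        exact shuffleOp_congr ih hw
    simp only [aeval_monomial, Module.End.mul_apply, Module.algebraMap_end_apply,
      ProMod.smul_apply, this w hw]

/-- The operator `P(s)` as a continuous linear map. -/
noncomputable def aevalL (d : ι → ℤ) (P : K[X]) : TSeries ι K →L[K] TSeries ι K :=
  ⟨aeval (shuffleOp d) P, by
    change Continuous fun x => aeval (shuffleOp d) P x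
    induction P using Polynomial.induction_on' with
    | add P Q hP hQ =>
      simp only [map_add, LinearMap.add_apply]
      exact hP.add hQ
    | monomial m c =>
      simp only [aeval_monomial, Module.End.mul_apply, Module.algebraMap_end_apply]
      refine Continuous.const_smul ?_ c
      induction m with
      | zero => exact continuous_id
      | succ m ih =>
        simp only [pow_succ']
        exact (shuffleL d).continuous.comp ih⟩

theorem aevalL_apply (P : K[X]) (x : TSeries ι K) :
    aevalL d P x = aeval (shuffleOp d) P x := rfl

theorem aeval_apply_of_eq_smul {M : Type*} [AddCommGroup M] [Module K M] {f : M →ₗ[K] M} {c : K}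
    {x : M} (h : f x = c • x) (P : K[X]) : aeval f P x = P.eval c • x := by
  induction P using Polynomial.induction_on' with
  | add P Q hP hQ => rw [map_add, LinearMap.add_apply, hP, hQ, eval_add, add_smul]
  | monomial m a =>
    have : (f ^ m) x = c ^ m • x := by
      induction m with
      | zero => simp
      | succ m ih => rw [pow_succ', Module.End.mul_apply, ih, map_smul, h, smul_smul, pow_succ]
    rw [aeval_monomial, Module.End.mul_apply, this, Module.algebraMap_end_apply, eval_monomial,
      smul_smul]

theorem shuffleOp_nil (x : TSeries ι K) : shuffleOp d x [] = x [] := by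
  change ∑ k ∈ Finset.range 1, shuffleCoeff d (List.take k []) (List.drop k []) x = x []
  simp [shuffleCoeff]

/-- On the words of length `n ≥ 1` the shuffle operator is annihilated by
`(X - 2)(X - 4) ⋯ (X - 2^n)`. -/
theorem aeval_prod_apply (x : TSeries ι K) {w : List ι} (hw : w ≠ []) :
    aeval (shuffleOp d) (∏ r ∈ Finset.range w.length, (X - C ((2 : K) ^ (r + 1)))) x w = 0 := by
  classical
  set P := ∏ r ∈ Finset.range w.length, (X - C ((2 : K) ^ (r + 1))) with hP
  have hsingle : ∀ v, aevalL d P (single v) w = 0 := by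
    intro v
    rw [aevalL_apply]
    by_cases hv : v.length = w.length
    · refine apply_eq_zero_of_mem_lieFiltration_one (d := d) ?_ hw
      refine aeval_prod_mem_lieFiltration _ ((isLieProd_single v).mem ?_)
      omega
    · rw [aeval_shuffleOp_congr P (y := 0) (n := w.length) _ rfl, map_zero, ProMod.zero_apply]
      intro u hu
      refine single_of_ne ?_
      rintro rfl
      exact hv hu
  let ev : TSeries ι K →L[K] ProMod Unit K := mkCLM
    { toFun := fun x _ => x w
      map_add' := fun _ _ => rfl
      map_smul' := fun _ _ => rfl } (fun _ => continuous_coord w)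
  have h0 : ev ∘L aevalL d P = 0 := clm_ext fun v => ProMod.ext fun _ => hsingle v
  exact congrFun (DFunLike.congr_fun h0 x) ()

variable [Algebra ℚ K]

theorem algebraMap_two_pow (j : ℕ) : algebraMap ℚ K (2 ^ j) = 2 ^ j := by
  rw [map_pow, map_ofNat]

/-- On the words of length at most `n` the operator `P(s)` depends only on the values of `P` at the
numbers `2^r`, `r ≤ n`, where `r = 0` is not needed for nonempty words. -/
theorem aeval_map_eq_zero {P : ℚ[X]} {w : List ι}
    (h : ∀ r ≤ w.length, (r = 0 → w = []) → P.eval (2 ^ r) = 0) (x : TSeries ι K) :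
    aeval (shuffleOp d) (P.map (algebraMap ℚ K)) x w = 0 := by
  by_cases hw : w = []
  · subst hw
    have h1 : X - C (1 : ℚ) ∣ P := dvd_iff_isRoot.2 (by simpa using h 0 le_rfl fun _ => rfl)
    obtain ⟨R, rfl⟩ := h1
    rw [Polynomial.map_mul, map_mul, Module.End.mul_apply]
    simp [shuffleOp_nil]
  · have h1 : ∏ r ∈ Finset.range w.length, (X - C ((2 : ℚ) ^ (r + 1))) ∣ P := by
      refine Finset.prod_dvd_of_coprime ?_ fun r hr => dvd_iff_isRoot.2 ?_
      · intro r _ r' _ hne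
        refine isCoprime_X_sub_C_of_isUnit_sub (IsUnit.mk0 _ (sub_ne_zero.2 ?_))
        exact fun he => hne (Nat.succ_injective (pow_right_injective₀ two_pos (by norm_num) he))
      · exact h (r + 1) (Finset.mem_range.1 hr) fun h0 => absurd h0 (Nat.succ_ne_zero r)
    obtain ⟨R, rfl⟩ := h1
    rw [Polynomial.map_mul, map_mul, Module.End.mul_apply, Polynomial.map_prod]
    simp only [Polynomial.map_sub, Polynomial.map_X, Polynomial.map_C, algebraMap_two_pow]
    exact aeval_prod_apply _ hw

theorem aeval_map_congr {P Q : ℚ[X]} {w : List ι}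
    (h : ∀ r ≤ w.length, (r = 0 → w = []) → P.eval (2 ^ r) = Q.eval (2 ^ r)) (x : TSeries ι K) :
    aeval (shuffleOp d) (P.map (algebraMap ℚ K)) x w =
      aeval (shuffleOp d) (Q.map (algebraMap ℚ K)) x w := by
  have := aeval_map_eq_zero (K := K) (d := d) (P := P - Q) (w := w)
    (fun r hr hr0 => by rw [eval_sub, h r hr hr0, sub_self]) x
  rwa [Polynomial.map_sub, map_sub, LinearMap.sub_apply, ProMod.sub_apply, sub_eq_zero] at this

theorem hodgePoly_eval {n j r : ℕ} (hr : r ≤ n) :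
    (hodgePoly n j).eval (2 ^ r) = if r = j then 1 else 0 := by
  unfold hodgePoly
  split_ifs with hj h h
  · subst h
    simp only [eval_mul, eval_C, eval_prod, eval_sub, eval_X]
    refine inv_mul_cancel₀ (Finset.prod_ne_zero_iff.2 fun k hk => sub_ne_zero.2 fun he => ?_)
    exact (Finset.mem_erase.1 hk).1 (pow_right_injective₀ two_pos (by norm_num) he).symm
  · simp only [eval_mul, eval_C, eval_prod, eval_sub, eval_X]
    rw [Finset.prod_eq_zero (f := fun x => (2 : ℚ) ^ r - 2 ^ x)
      (Finset.mem_erase.2 ⟨h, Finset.mem_range.2 (by omega)⟩) (sub_self _), mul_zero]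
  · omega
  · exact eval_zero

/-- On words of length `n` the operator `e(j)` is `P(s)` for every interpolation polynomial `P`. -/
theorem hodgeProj_apply_eq (j : ℕ) {P : ℚ[X]} {w : List ι}
    (h : ∀ r ≤ w.length, (r = 0 → w = []) → P.eval (2 ^ r) = if r = j then 1 else 0)
    (x : TSeries ι K) :
    hodgeProj d j x w = aeval (shuffleOp d) (P.map (algebraMap ℚ K)) x w :=
  aeval_map_congr (fun r hr hr0 => by rw [hodgePoly_eval hr, h r hr hr0]) x

theorem hodgeProj_apply (j : ℕ) (x : TSeries ι K) (w : List ι) : hodgeProj d j x w =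
    aeval (shuffleOp d) ((hodgePoly w.length j).map (algebraMap ℚ K)) x w := rfl

theorem continuous_hodgeProj (j : ℕ) : Continuous (hodgeProj (K := K) d j) := by
  rw [ProMod.continuous_iff]
  intro w
  let _ : TopologicalSpace K := ⊥
  change Continuous fun x : TSeries ι K =>
    aevalL d ((hodgePoly w.length j).map (algebraMap ℚ K)) x w
  exact (continuous_coord w).comp (aevalL d _).continuous

/-- The operator `e(j)` as a continuous linear map. -/
noncomputable def hodgeProjL (d : ι → ℤ) (j : ℕ) : TSeries ι K →L[K] TSeries ι K :=
  ⟨hodgeProj d j, continuous_hodgeProj j⟩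

theorem hodgeProj_eq_zero_of_lt {j : ℕ} {w : List ι} (h : w.length < j) (x : TSeries ι K) :
    hodgeProj d j x w = 0 := by
  rw [hodgeProj_apply, hodgePoly, if_neg (by omega)]
  simp

theorem hodgeProj_zero_of_ne_nil {w : List ι} (hw : w ≠ []) (x : TSeries ι K) :
    hodgeProj d 0 x w = 0 := by
  rw [hodgeProj_apply_eq 0 (P := 0) fun r _ hr => ?_]
  · simp
  · rw [if_neg fun h => hw (hr h), eval_zero]

theorem hodgeProj_hodgeProj (j k : ℕ) (x : TSeries ι K) :
    hodgeProj d j (hodgeProj d k x) = if j = k then hodgeProj d j x else 0 := by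
  ext w
  rw [hodgeProj_apply, aeval_shuffleOp_congr (n := w.length)
    (y := aeval (shuffleOp d) ((hodgePoly w.length k).map (algebraMap ℚ K)) x) _ _ rfl]
  · rw [← Module.End.mul_apply, ← map_mul, ← Polynomial.map_mul]
    split_ifs with h
    · subst h
      refine (hodgeProj_apply_eq j (fun r hr _ => ?_) x).symm
      rw [eval_mul, hodgePoly_eval hr]
      split_ifs <;> simp
    · refine aeval_map_eq_zero (fun r hr _ => ?_) x
      rw [eval_mul, hodgePoly_eval hr, hodgePoly_eval hr]
      split_ifs with h1 h2
      · exact absurd (h1.symm.trans h2) h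
      all_goals simp
  · intro v hv
    rw [hodgeProj_apply, hv]

theorem shuffleOp_hodgeProj (j : ℕ) (x : TSeries ι K) :
    shuffleOp d (hodgeProj d j x) = (2 : K) ^ j • hodgeProj d j x := by
  ext w
  rw [shuffleOp_congr (n := w.length)
    (y := aeval (shuffleOp d) ((hodgePoly w.length j).map (algebraMap ℚ K)) x) _ rfl]
  · have h := aeval_map_congr (K := K) (d := d) (w := w) (P := X * hodgePoly w.length j)
      (Q := C (2 ^ j) * hodgePoly w.length j) (fun r hr _ => by
        rw [eval_mul, eval_mul, hodgePoly_eval hr, eval_X, eval_C]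
        split_ifs with h
        · rw [h]
        · simp) x
    rw [Polynomial.map_mul, map_mul, Module.End.mul_apply, Polynomial.map_X, aeval_X,
      Polynomial.map_mul, map_mul, Module.End.mul_apply, Polynomial.map_C, aeval_C,
      Module.algebraMap_end_apply, algebraMap_two_pow, ProMod.smul_apply] at h
    exact h
  · intro v hv
    rw [hodgeProj_apply, hv]

theorem hodgeProj_of_shuffleOp_eq {j : ℕ} {x : TSeries ι K}
    (h : shuffleOp d x = (2 : K) ^ j • x) : hodgeProj d j x = x := by
  ext w
  -- If `j` exceeds the length of `w`, then `2^j` is not an eigenvalue on words of this length.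
  by_cases hj : j ≤ w.length
  · rw [hodgeProj_apply, aeval_apply_of_eq_smul h, ← algebraMap_two_pow, eval_map_algebraMap,
      aeval_algebraMap_apply, coe_aeval_eq_eval, hodgePoly_eval hj, if_pos rfl, map_one, one_smul]
  · rw [hodgeProj_eq_zero_of_lt (by omega)]
    set P : ℚ[X] := ∏ r ∈ Finset.range (w.length + 1), (X - C ((2 : ℚ) ^ r)) with hP
    have h0 : aeval (shuffleOp d) (P.map (algebraMap ℚ K)) x w = 0 := by
      refine aeval_map_eq_zero (fun r hr _ => ?_) x
      rw [hP, eval_prod]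
      refine Finset.prod_eq_zero (Finset.mem_range.2 (Nat.lt_succ_of_le hr)) ?_
      simp
    rw [aeval_apply_of_eq_smul h, ← algebraMap_two_pow, eval_map_algebraMap,
      aeval_algebraMap_apply, coe_aeval_eq_eval, ProMod.smul_apply] at h0
    have hu : P.eval (2 ^ j) ≠ 0 := by
      rw [hP, eval_prod]
      refine Finset.prod_ne_zero_iff.2 fun k hk => ?_
      rw [eval_sub, eval_X, eval_C]
      refine sub_ne_zero.2 fun he => ?_
      have := pow_right_injective₀ (two_pos (α := ℚ)) (by norm_num) he
      have := Finset.mem_range.1 hk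
      omega
    have hu' := (IsUnit.mk0 _ hu).map (algebraMap ℚ K)
    exact ((hu'.mul_right_eq_zero).1 h0).symm

theorem sum_hodgeProj (x : TSeries ι K) (w : List ι) :
    ∑ j ∈ Finset.range (w.length + 1), hodgeProj d j x w = x w := by
  have h := aeval_map_congr (K := K) (d := d) (w := w)
    (P := ∑ j ∈ Finset.range (w.length + 1), hodgePoly w.length j) (Q := 1) (fun r hr _ => by
      rw [eval_finsetSum, Finset.sum_eq_single r, hodgePoly_eval hr, if_pos rfl, eval_one]
      · intro k _ hk
        rw [hodgePoly_eval hr, if_neg hk.symm]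
      · exact fun hn => absurd (Finset.mem_range.2 (Nat.lt_succ_of_le hr)) hn) x
  rw [Polynomial.map_sum, map_sum, LinearMap.sum_apply, ProMod.sum_apply, Polynomial.map_one,
    map_one, Module.End.one_apply] at h
  exact h

end Spectrum

/-! ### Noncommutative one-forms modulo commutators -/

section OneForms

variable {ι K : Type*} [CommRing K] {d : ι → ℤ}

/-- The coefficients `Θ⁻¹(u dv)` for words `u` and `v`: by the Leibniz rule and cyclic rotation
`u d(v₁ b v₂)` contributes the word `b v₂ u v₁` for each letter `b` of `v = v₁ b v₂`, up to sign.
In the recursion the words `u` and `bv` are those of `u d(bv) = u db v + (-1)^{|b|} ub dv`. -/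
noncomputable def cyclicWord (K : Type*) [CommRing K] (d : ι → ℤ) :
    List ι → List ι → TSeries ι K
  | _, [] => 0
  | u, b :: v => sgn K (wordDeg d u * (d b + 1 + wordDeg d v)) • single (b :: v ++ u) +
      sgn K (d b) • cyclicWord K d (u ++ [b]) v

theorem cyclicWord_perm {u v w : List ι} (h : cyclicWord K d u v w ≠ 0) : (u ++ v).Perm w := by
  induction v generalizing u with
  | nil => exact absurd rfl h
  | cons b v ih =>
    by_cases h1 : cyclicWord K d (u ++ [b]) v w = 0
    · rw [cyclicWord, ProMod.add_apply, ProMod.smul_apply, ProMod.smul_apply, h1, mul_zero,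
        add_zero] at h
      rw [eq_of_single_ne_zero (right_ne_zero_of_mul h)]
      exact List.perm_append_comm
    · simpa using ih h1

theorem cyclicWord_apply_mem (𝒦 : ℤ → AddSubgroup K) [GradedRing 𝒦] (u v w : List ι) :
    cyclicWord K d u v w ∈ 𝒦 0 := by
  induction v generalizing u with
  | nil => exact zero_mem _
  | cons b v ih =>
    have hsgn : ∀ (n : ℤ) (c : K), c ∈ 𝒦 0 → sgn K n * c ∈ 𝒦 0 := fun n _ hc =>
      CInfinityStructure.sgn_smul_mem (K := K) (A := K) _ n hc
    refine add_mem (hsgn _ _ ?_) (hsgn _ _ (ih _))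
    by_cases h : w = b :: v ++ u
    · rw [h, single_self]
      exact SetLike.GradedOne.one_mem
    · rw [single_of_ne h]
      exact zero_mem _

theorem cyclicWord_apply_nil (u v : List ι) : cyclicWord K d u v [] = 0 := by
  by_contra h
  have := (cyclicWord_perm h).eq_nil
  rw [(List.append_eq_nil_iff.1 this).2] at h
  exact h rfl

theorem cyclicWord_finite (w : List ι) :
    {p : List ι × List ι | cyclicWord K d p.1 p.2 w ≠ 0}.Finite := by
  classical
  refine ((w.permutations.toFinset ×ˢ Finset.range (w.length + 1)).finite_toSet.image
    fun q => (q.1.take q.2, q.1.drop q.2)).subset ?_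
  rintro ⟨u, v⟩ h
  have hp := cyclicWord_perm h
  refine ⟨(u ++ v, u.length), ?_, by simp⟩
  have := hp.length_eq
  simp only [Finset.coe_product, Set.mem_prod, Finset.mem_coe, List.mem_toFinset,
    List.mem_permutations, Finset.mem_range]
  exact ⟨hp, by rw [← this]; simp⟩

/-- The inverse of `Θ` on representatives of one-forms. -/
noncomputable def thetaInvL (K : Type*) [CommRing K] (d : ι → ℤ) :
    TSeries₂ ι K →L[K] TSeries ι K :=
  ofMatrix (fun p => cyclicWord K d p.1 p.2) cyclicWord_finite

theorem thetaInvL_tens_single (u v : List ι) :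
    thetaInvL K d (tens (single u) (single v)) = cyclicWord K d u v := by
  rw [tens_single, thetaInvL, ofMatrix_single]

theorem thetaInvL_mem_pos (F : TSeries₂ ι K) : thetaInvL K d F ∈ pos ι K := by
  change thetaInvL K d F [] = 0
  rw [thetaInvL, ofMatrix_apply]
  exact Finset.sum_eq_zero fun p _ => by rw [cyclicWord_apply_nil, zero_mul]

theorem wordDeg_perm {u v : List ι} (h : u.Perm v) : wordDeg d u = wordDeg d v :=
  (h.map d).sum_eq

theorem thetaInvL_homogeneous (𝒦 : ℤ → AddSubgroup K) [GradedRing 𝒦] {n : ℤ} {F : TSeries₂ ι K}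
    (hF : F ∈ homogeneous₂ 𝒦 d n) : thetaInvL K d F ∈ homogeneous 𝒦 d n := by
  intro w
  rw [thetaInvL, ofMatrix_apply]
  refine sum_mem fun ⟨u, v⟩ hp => ?_
  have hperm := cyclicWord_perm ((Set.Finite.mem_toFinset _).1 hp)
  have := SetLike.mul_mem_graded (cyclicWord_apply_mem (d := d) 𝒦 u v w) (hF u v)
  rwa [zero_add, sub_sub, ← wordDeg_append, wordDeg_perm hperm] at this

theorem cyclicWord_append (x y a : List ι) : cyclicWord K d x (y ++ a) =
    sgn K (wordDeg d a * (wordDeg d x + wordDeg d y + 1)) • cyclicWord K d (a ++ x) y +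
      sgn K (wordDeg d y) • cyclicWord K d (x ++ y) a := by
  induction y generalizing x with
  | nil => simp [cyclicWord, wordDeg_nil, sgn_zero]
  | cons b y ih =>
    have e1 : sgn K (wordDeg d x * (d b + 1 + (wordDeg d y + wordDeg d a))) =
        sgn K (wordDeg d a * (wordDeg d x + (d b + wordDeg d y) + 1)) *
          sgn K ((wordDeg d a + wordDeg d x) * (d b + 1 + wordDeg d y)) := by
      rw [← sgn_add]
      refine sgn_congr ⟨-(wordDeg d a * (d b + 1 + wordDeg d y + wordDeg d x)) +
        wordDeg d x * wordDeg d a, ?_⟩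
      ring
    have e2 : wordDeg d x + d b + wordDeg d y + 1 = wordDeg d x + (d b + wordDeg d y) + 1 := by
      ring
    simp only [List.cons_append, cyclicWord, ih, wordDeg_append, wordDeg_cons, wordDeg_nil, e1, e2,
      List.append_assoc, List.nil_append, add_zero, sgn_add (d b)]
    module

theorem even_sub_mul_congr {p q r p' q' r' : ℤ} (hp : Even (p' - p)) (hq : Even (q' - q))
    (hr : Even (r' - r)) : Even (p' * (q' + r' + 1) - p * (q + r + 1)) := by
  have e : p' * (q' + r' + 1) - p * (q + r + 1) =
      (p' - p) * (q' + r' + 1) + p * ((q' - q) + (r' - r)) := by ring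
  rw [e]
  exact (hp.mul_right _).add ((hq.add hr).mul_left _)

/-- The map `Θ⁻¹` is well defined: it kills the graded commutators. -/
theorem thetaInvL_tens_mul {p q r : ℤ} {a x y : TSeries ι K} (ha : HasParity d p a)
    (hx : HasParity d q x) (hy : HasParity d r y) :
    thetaInvL K d (tens (mul a x) y) = sgn K (p * (q + r + 1)) •
      (thetaInvL K d (tens x (mul y a)) - sgn K r • thetaInvL K d (tens (mul x y) a)) := by
  have words : ∀ u v w : List ι, Even (wordDeg d u - p) → Even (wordDeg d v - q) →
      Even (wordDeg d w - r) →
      thetaInvL K d (tens (mul (single u) (single v)) (single w)) = sgn K (p * (q + r + 1)) •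
        (thetaInvL K d (tens (single v) (mul (single w) (single u))) -
          sgn K r • thetaInvL K d (tens (mul (single v) (single w)) (single u))) := by
    intro u v w hu hv hw
    simp only [← single_append, thetaInvL_tens_single]
    rw [cyclicWord_append, sgn_congr hw, sgn_congr (even_sub_mul_congr hu hv hw),
      add_sub_cancel_right, smul_smul, sgn_mul_sgn, one_smul]
  have step1 : ∀ v w : List ι, Even (wordDeg d v - q) → Even (wordDeg d w - r) →
      thetaInvL K d (tens (mul a (single v)) (single w)) = sgn K (p * (q + r + 1)) •
        (thetaInvL K d (tens (single v) (mul (single w) a)) -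
          sgn K r • thetaInvL K d (tens (mul (single v) (single w)) a)) := fun v w hv hw =>
    map_congr (f := thetaInvL K d ∘L tensLeft (single w) ∘L mulRight (single v))
      (g := sgn K (p * (q + r + 1)) • (thetaInvL K d ∘L tensRight (single v) ∘L mulLeft (single w) -
        sgn K r • (thetaInvL K d ∘L tensRight (mul (single v) (single w)))))
      fun u hu => words u v w (ha u hu) hv hw
  have step2 : ∀ w : List ι, Even (wordDeg d w - r) →
      thetaInvL K d (tens (mul a x) (single w)) = sgn K (p * (q + r + 1)) •
        (thetaInvL K d (tens x (mul (single w) a)) -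
          sgn K r • thetaInvL K d (tens (mul x (single w)) a)) := fun w hw =>
    map_congr (f := thetaInvL K d ∘L tensLeft (single w) ∘L mulLeft a)
      (g := sgn K (p * (q + r + 1)) • (thetaInvL K d ∘L tensLeft (mul (single w) a) -
        sgn K r • (thetaInvL K d ∘L tensLeft a ∘L mulRight (single w))))
      fun v hv => step1 v w (hx v hv) hw
  exact map_congr (f := thetaInvL K d ∘L tensRight (mul a x))
      (g := sgn K (p * (q + r + 1)) • (thetaInvL K d ∘L tensRight x ∘L mulRight a -
        sgn K r • (thetaInvL K d ∘L tensLeft a ∘L mulLeft x)))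
      fun w hw => step2 w (hy w hw)

theorem thetaInvL_tens_one (x : TSeries ι K) : thetaInvL K d (tens x one) = 0 :=
  map_congr (f := thetaInvL K d ∘L tensLeft one) (g := 0) fun u _ => by
    rw [ContinuousLinearMap.comp_apply, tensLeft_apply, ← single_nil, thetaInvL_tens_single]
    rfl

theorem thetaInvL_eq_zero (𝒦 : ℤ → AddSubgroup K) [EvenlyGraded 𝒦] {F : TSeries₂ ι K}
    (hF : F ∈ oneFormRel 𝒦 d) : thetaInvL K d F = 0 := by
  have hle : oneFormRel 𝒦 d ≤ (⊥ : Submodule K (TSeries ι K)).comap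
      (thetaInvL K d).toLinearMap := by
    refine topologicalClosure_le_comap (thetaInvL K d).continuous isClosed_singleton ?_
    rintro F (⟨x, rfl⟩ | ⟨p, q, r, a, x, y, ha, hx, hy, rfl⟩)
    · exact thetaInvL_tens_one x
    · change thetaInvL K d (oneFormComm p q r a x y) = 0
      rw [oneFormComm, map_sub, map_smul, map_sub, map_smul, sub_eq_zero]
      exact thetaInvL_tens_mul (hasParity_of_homogeneous ha) (hasParity_of_homogeneous hx)
        (hasParity_of_homogeneous hy)
  exact hle hF

/-- The representative of `Θ` as a continuous linear map. -/
def thetaRepL (d : ι → ℤ) : TSeries ι K →L[K] TSeries₂ ι K :=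
  mkCLM (thetaRep d) (fun ⟨u, v⟩ => by
    let _ : TopologicalSpace K := ⊥
    have : DiscreteTopology K := ⟨rfl⟩
    match u with
    | [] => exact continuous_coord v
    | [a] => exact (continuous_const.mul (continuous_coord (a :: v))).neg
    | _ :: _ :: _ => exact continuous_const)

/-- `Θ(tₐ ⊗ y) = d(tₐy) - (-1)^{|tₐ|} tₐ dy`. -/
theorem thetaRepL_gen_mul (a : ι) (y : TSeries ι K) : thetaRepL d (mul (gen a) y) =
    tens one (mul (gen a) y) - sgn K (d a) • tens (gen a) y := by
  ext ⟨u, v⟩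
  rw [ProMod.sub_apply, ProMod.smul_apply]
  match u with
  | [] =>
    change mul (gen a) y v = one [] * mul (gen a) y v - sgn K (d a) * (gen a [] * y v)
    simp [one, gen]
  | [b] =>
    change -(sgn K (d b) * mul (gen a) y (b :: v)) =
      one [b] * mul (gen a) y v - sgn K (d a) * (gen a [b] * y v)
    by_cases h : b = a
    · subst h
      rw [gen_mul_cons_self]
      simp [one, gen]
    · rw [gen_mul_cons_of_ne h]
      simp [one, gen, h]
  | b :: c :: u =>
    change 0 = one (b :: c :: u) * mul (gen a) y v - sgn K (d a) * (gen a (b :: c :: u) * y v)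
    simp [one, gen]

theorem thetaInvL_thetaRepL_single (a : ι) (w : List ι) :
    thetaInvL K d (thetaRepL d (single (a :: w))) = single (a :: w) := by
  rw [single_cons, thetaRepL_gen_mul, ← single_cons, map_sub, map_smul, ← single_nil,
    ← single_singleton, thetaInvL_tens_single, thetaInvL_tens_single, cyclicWord, wordDeg_nil,
    zero_mul, sgn_zero, one_smul, List.append_nil, List.nil_append, add_sub_cancel_right]

/-- Two continuous linear maps which agree on the elements `tₐ y` agree on series without constant
term. -/
theorem map_congr_of_mem_pos {Y : Type*} {f g : TSeries ι K →L[K] ProMod Y K}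
    (h : ∀ a y, f (mul (gen a) y) = g (mul (gen a) y)) {x : TSeries ι K} (hx : x ∈ pos ι K) :
    f x = g x := by
  refine map_congr fun w hw => ?_
  match w with
  | [] => exact absurd hx hw
  | a :: w => rw [single_cons, h]

theorem thetaInvL_thetaRepL {x : TSeries ι K} (hx : x ∈ pos ι K) :
    thetaInvL K d (thetaRepL d x) = x := by
  refine map_congr (f := thetaInvL K d ∘L thetaRepL d) (g := ContinuousLinearMap.id K _)
    fun w hw => ?_
  match w with
  | [] => exact absurd hx hw
  | a :: w => exact thetaInvL_thetaRepL_single a w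

theorem single_homogeneous (𝒦 : ℤ → AddSubgroup K) [GradedRing 𝒦] (w : List ι) :
    single (K := K) w ∈ homogeneous 𝒦 d (wordDeg d w) := by
  intro v
  by_cases h : v = w
  · rw [h, single_self, sub_self]
    exact SetLike.GradedOne.one_mem
  · rw [single_of_ne h]
    exact zero_mem _

theorem oneFormComm_single_mem (𝒦 : ℤ → AddSubgroup K) [GradedRing 𝒦] (u v w : List ι) :
    oneFormComm (wordDeg d u) (wordDeg d v) (wordDeg d w) (single u) (single v) (single w) ∈
      oneFormRel 𝒦 d :=
  subset_closure (Submodule.subset_span (Or.inr ⟨_, _, _, _, _, _, single_homogeneous 𝒦 u,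
    single_homogeneous 𝒦 v, single_homogeneous 𝒦 w, rfl⟩))

/-- Modulo commutators every one-form `u dv` of words is in the image of `Θ`. -/
theorem tens_single_mem (𝒦 : ℤ → AddSubgroup K) [GradedRing 𝒦] (u v : List ι) :
    tens (single u) (single v) ∈
      (pos ι K).map (thetaRepL d).toLinearMap ⊔ oneFormRel 𝒦 d := by
  have letter : ∀ (u : List ι) (a : ι), tens (single u) (single [a]) ∈
      (pos ι K).map (thetaRepL d).toLinearMap ⊔ oneFormRel 𝒦 d := by
    intro u a
    have h := oneFormComm_single_mem (d := d) 𝒦 u [] [a]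
    rw [oneFormComm] at h
    have h' : thetaRepL d (single (a :: u)) ∈
        (pos ι K).map (thetaRepL d).toLinearMap ⊔ oneFormRel 𝒦 d :=
      Submodule.mem_sup_left ⟨_, single_of_ne (by simp), rfl⟩
    rw [single_cons, thetaRepL_gen_mul, ← single_singleton, ← single_nil] at h'
    have := add_mem (Submodule.mem_sup_right h)
      (Submodule.smul_mem _ (sgn K (wordDeg d u * (wordDeg d [] + wordDeg d [a] + 1))) h')
    rw [← single_append, ← single_append, ← single_append, List.append_nil, List.nil_append,
      wordDeg_cons, wordDeg_nil, add_zero, sub_add_cancel] at this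
    exact this
  induction v using List.reverseRecOn generalizing u with
  | nil =>
    rw [single_nil]
    exact Submodule.mem_sup_right (subset_closure (Submodule.subset_span (Or.inl ⟨_, rfl⟩)))
  | append_singleton v a ih =>
    have h := oneFormComm_single_mem (d := d) 𝒦 [a] u v
    rw [oneFormComm, ← single_append, ← single_append, ← single_append] at h
    set c := sgn K (wordDeg d [a] * (wordDeg d u + wordDeg d v + 1)) with hc
    have hcc : c * c = 1 := sgn_mul_sgn _
    have e : tens (single (K := K) u) (single (v ++ [a])) =
        c • tens (single ([a] ++ u)) (single v) +
        sgn K (wordDeg d v) • tens (single (u ++ v)) (single [a]) -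
        c • (tens (single ([a] ++ u)) (single v) -
          c • (tens (single u) (single (v ++ [a])) -
            sgn K (wordDeg d v) • tens (single (u ++ v)) (single [a]))) := by
      rw [smul_sub, smul_smul, hcc, one_smul]
      abel
    rw [e]
    exact sub_mem (add_mem (Submodule.smul_mem _ _ (ih _)) (Submodule.smul_mem _ _ (letter _ _)))
      (Submodule.smul_mem _ _ (Submodule.mem_sup_right h))

/-- Every one-form is congruent to `Θ(Θ⁻¹(F))` modulo commutators. -/
theorem sub_thetaRepL_thetaInvL_mem (𝒦 : ℤ → AddSubgroup K) [GradedRing 𝒦] [EvenlyGraded 𝒦]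
    (F : TSeries₂ ι K) : F - thetaRepL d (thetaInvL K d F) ∈ oneFormRel 𝒦 d := by
  set f : TSeries₂ ι K →L[K] TSeries₂ ι K :=
    ContinuousLinearMap.id K _ - thetaRepL d ∘L thetaInvL K d with hf
  have hclosed : IsClosed (((oneFormRel 𝒦 d).comap f.toLinearMap : Submodule K _) :
      Set (TSeries₂ ι K)) :=
    (Submodule.isClosed_topologicalClosure _).preimage f.continuous
  have hsingle : ∀ p, f (single p) ∈ oneFormRel 𝒦 d := by
    rintro ⟨u, v⟩
    obtain ⟨_, ⟨x, hx, rfl⟩, r, hr, h⟩ := Submodule.mem_sup.1 (tens_single_mem (d := d) 𝒦 u v)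
    change thetaRepL d x + r = _ at h
    rw [← tens_single, ← h]
    change thetaRepL d x + r - thetaRepL d (thetaInvL K d (thetaRepL d x + r)) ∈ _
    rw [map_add, thetaInvL_thetaRepL hx, thetaInvL_eq_zero 𝒦 hr, add_zero, add_sub_cancel_left]
    exact hr
  exact mem_of_single_mem _ hclosed hsingle F

end OneForms

/-! ### The Lie derivative in terms of the tensor algebra -/

section LieDerivative

variable {ι K : Type*} [CommRing K] {d : ι → ℤ}

/-- The element `Θ⁻¹(dp·y)`, where `dp·y = d(py) - (-1)^{|p|} p dy`. -/
noncomputable def formCoeff (d : ι → ℤ) (p y : TSeries ι K) : TSeries ι K :=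
  thetaInvL K d (tens one (mul p y) - tens (twist d 1 p) y)

/-- `p ↦ Θ⁻¹(dp·y)`. -/
noncomputable def formCoeffLeft (d : ι → ℤ) (y : TSeries ι K) : TSeries ι K →L[K] TSeries ι K :=
  thetaInvL K d ∘L (tensRight one ∘L mulRight y - tensLeft y ∘L twist d 1)

/-- `y ↦ Θ⁻¹(dp·y)`. -/
noncomputable def formCoeffRight (d : ι → ℤ) (p : TSeries ι K) : TSeries ι K →L[K] TSeries ι K :=
  thetaInvL K d ∘L (tensRight one ∘L mulLeft p - tensRight (twist d 1 p))

theorem formCoeffLeft_apply (p y : TSeries ι K) : formCoeffLeft d y p = formCoeff d p y := rfl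

theorem formCoeffRight_apply (p y : TSeries ι K) : formCoeffRight d p y = formCoeff d p y := rfl

theorem formCoeff_gen (a : ι) (y : TSeries ι K) : formCoeff d (gen a) y = mul (gen a) y := by
  rw [formCoeff, (hasParity_gen a).twist_eq, one_mul, tens_smul_left, ← thetaRepL_gen_mul,
    thetaInvL_thetaRepL (gen_mul_nil a y)]

/-- The Leibniz rule `d(pq)·y = dp·qy + (-1)^{|p|} p dq·y`, where the last term is rotated to
`(-1)^{|p||q| + |p||y|} dq·yp`. -/
theorem formCoeff_mul {n m : ℤ} {p q : TSeries ι K} (hp : HasParity d n p) (hq : HasParity d m q)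
    (y : TSeries ι K) : formCoeff d (mul p q) y = formCoeff d p (mul q y) +
      sgn K (n * m) • formCoeff d q (mul (twist d n y) p) := by
  refine map_congr (f := formCoeffRight d (mul p q)) (g := formCoeffRight d p ∘L mulLeft q +
    sgn K (n * m) • (formCoeffRight d q ∘L mulRight p ∘L twist d n)) fun w _ => ?_
  change formCoeff d (mul p q) (single w) = formCoeff d p (mul q (single w)) +
      sgn K (n * m) • formCoeff d q (mul (twist d n (single w)) p)
  have hw := hasParity_single (K := K) (d := d) w
  set y : TSeries ι K := single w
  set r := wordDeg d w
  have h1 := thetaInvL_tens_mul hp hq hw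
  have h2 := thetaInvL_tens_mul hp hasParity_one (hasParity_mul hq hw)
  rw [mul_one', one_mul', zero_add] at h2
  simp only [formCoeff, twist_mul, hp.twist_eq, hq.twist_eq, hw.twist_eq, mul_smul_left,
    mul_smul_right, tens_smul_left, tens_smul_right, map_sub, map_smul, one_mul, h1, h2,
    mul_assoc', mul_add, sgn_add, mul_one]
  have hP := sgn_mul_sgn (K := K) n
  have hM := sgn_mul_sgn (K := K) m
  generalize sgn K (n * m) = E
  generalize sgn K (n * r) = F
  generalize sgn K n = P at *
  generalize sgn K m = Q at *
  generalize sgn K r = R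
  generalize thetaInvL K d (tens one (mul q (mul y p))) = A
  generalize thetaInvL K d (tens q (mul y p)) = B
  generalize thetaInvL K d (tens (mul q y) p) = D
  generalize thetaInvL K d (tens one (mul p (mul q y))) = G
  ext v
  simp only [ProMod.add_apply, ProMod.sub_apply, ProMod.smul_apply]
  linear_combination (E * F * A v - Q * E * F * B v) * hP

theorem formCoeff_gcomm {n m : ℤ} {p q : TSeries ι K} (hp : HasParity d n p)
    (hq : HasParity d m q) (y : TSeries ι K) : formCoeff d (gcomm d p q) y =
      formCoeff d p (adL d m q y) - sgn K (n * m) • formCoeff d q (adL d n p y) := by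
  have h1 := formCoeff_mul hp hq y
  have h2 := formCoeff_mul hq hp y
  have h3 : gcomm d p q = mul p q - sgn K (n * m) • mul q p := by
    rw [gcomm_eq_of_hasParity hp, hq.twist_eq, mul_smul_left]
  rw [← formCoeffLeft_apply (gcomm d p q), h3, map_sub, map_smul, formCoeffLeft_apply,
    formCoeffLeft_apply, h1, h2, adL_apply, adL_apply, ← formCoeffRight_apply p (_ - _),
    ← formCoeffRight_apply q (_ - _), map_sub, map_sub]
  simp only [formCoeffRight_apply, smul_add, smul_sub, smul_smul, mul_comm m n, sgn_mul_sgn,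
    one_smul]
  abel

/-- The operator `1 ⊗ f` on series without constant term, extended by zero to the constants. -/
def oneTensorL (f : TSeries ι K →L[K] TSeries ι K) : TSeries ι K →L[K] TSeries ι K :=
  mkCLM
    { toFun := fun x w => match w with
        | [] => 0
        | a :: w => f (leftPart a x) w
      map_add' := fun x y => ProMod.ext fun w => match w with
        | [] => (add_zero (0 : K)).symm
        | a :: w => by
          change f (leftPart a (x + y)) w = f (leftPart a x) w + f (leftPart a y) w
          rw [map_add, map_add, ProMod.add_apply]
      map_smul' := fun c x => ProMod.ext fun w => match w with
        | [] => (mul_zero c).symm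
        | a :: w => by
          change f (leftPart a (c • x)) w = c * f (leftPart a x) w
          rw [map_smul, map_smul, ProMod.smul_apply] }
    (fun w => by
      let _ : TopologicalSpace K := ⊥
      match w with
      | [] => exact continuous_const
      | a :: w =>
        exact (continuous_coord w).comp (f.continuous.comp (continuous_leftPart a)))

theorem oneTensorL_cons (f : TSeries ι K →L[K] TSeries ι K) (x : TSeries ι K) (a : ι)
    (w : List ι) : oneTensorL f x (a :: w) = f (leftPart a x) w := rfl

theorem oneTensorL_nil (f : TSeries ι K →L[K] TSeries ι K) (x : TSeries ι K) :
    oneTensorL f x [] = 0 := rfl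

theorem oneTensorL_gen_mul (f : TSeries ι K →L[K] TSeries ι K) (a : ι) (y : TSeries ι K) :
    oneTensorL f (mul (gen a) y) = mul (gen a) (f y) := by
  ext w
  match w with
  | [] => rw [oneTensorL_nil, gen_mul_nil]
  | b :: w =>
    rw [oneTensorL_cons]
    by_cases h : b = a
    · subst h
      rw [leftPart_gen_mul_self, gen_mul_cons_self]
    · rw [leftPart_gen_mul_of_ne h, gen_mul_cons_of_ne h, map_zero, ProMod.zero_apply]

/-- For a Lie series `p` the map `y ↦ Θ⁻¹(dp·y)` intertwines `s` and `1 ⊗ s`. For a bracket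
`[p, q]` it is a combination of `Θ⁻¹(dp·[q, y])` and `Θ⁻¹(dq·[p, y])`, and brackets with Lie series
commute with `s`. -/
theorem oneTensorL_formCoeff_of_isLieMonomial {p : TSeries ι K} (hp : IsLieMonomial d p)
    (y : TSeries ι K) :
    oneTensorL (shuffleL d) (formCoeff d p y) = formCoeff d p (shuffleL d y) := by
  induction hp generalizing y with
  | gen a => rw [formCoeff_gen, formCoeff_gen, oneTensorL_gen_mul]
  | @bracket p q hp hq ihp ihq =>
    obtain ⟨n, hn⟩ := hp.exists_hasParity
    obtain ⟨m, hm⟩ := hq.exists_hasParity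
    have hpl : p ∈ lieSeries K d := subset_closure (Submodule.subset_span hp)
    have hql : q ∈ lieSeries K d := subset_closure (Submodule.subset_span hq)
    rw [formCoeff_gcomm hn hm, formCoeff_gcomm hn hm, map_sub, map_smul, ihp, ihq,
      (isLieDerivation_adL hpl hn).shuffleL_comm, (isLieDerivation_adL hql hm).shuffleL_comm]

theorem oneTensorL_formCoeff {p : TSeries ι K} {n : ℤ} (hp : p ∈ lieSeries K d)
    (hn : HasParity d n p) (y : TSeries ι K) :
    oneTensorL (shuffleL d) (formCoeff d p y) = formCoeff d p (shuffleL d y) :=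
  map_congr_of_mem_lieSeries (f := oneTensorL (shuffleL d) ∘L formCoeffLeft d y)
    (g := formCoeffLeft d (shuffleL d y))
    (fun _ hq _ => oneTensorL_formCoeff_of_isLieMonomial hq y) hp hn

namespace CInfinityStructure

variable {𝒦 : ℤ → AddSubgroup K}

theorem onGen_mem (C : CInfinityStructure 𝒦 d) (a : ι) : C.onGen a ∈ lieSeries K d :=
  (C.m (lieGen d a)).2

theorem vectorField_mul (C : CInfinityStructure 𝒦 d) (x y : TSeries ι K) :
    C.vectorField (mul x y) = mul (C.vectorField x) y + mul (parity d x) (C.vectorField y) :=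
  derivation_mul d C.rowFinite x y

theorem vectorField_homogeneous [GradedRing 𝒦] (C : CInfinityStructure 𝒦 d) {n : ℤ}
    {x : TSeries ι K} (hx : x ∈ homogeneous 𝒦 d n) : C.vectorField x ∈ homogeneous 𝒦 d (n + 1) :=
  derivation_homogeneous 𝒦 d C.rowFinite C.onGen_homogeneous n hx

/-- The Lie derivative on representatives as a continuous linear map. -/
noncomputable def lieDerivRepL (C : CInfinityStructure 𝒦 d) : TSeries₂ ι K →L[K] TSeries₂ ι K :=
  ⟨C.lieDerivRep, C.continuous_lieDerivRep⟩

theorem lieDerivRepL_tens (C : CInfinityStructure 𝒦 d) (x y : TSeries ι K) :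
    C.lieDerivRepL (tens x y) =
      tens (C.vectorField x) y - tens (parity d x) (C.vectorField y) :=
  C.lieDerivRep_tens x y

/-- The differential `Θ⁻¹ L_m Θ`. -/
noncomputable def hochschildL (C : CInfinityStructure 𝒦 d) : TSeries ι K →L[K] TSeries ι K :=
  thetaInvL K d ∘L C.lieDerivRepL ∘L thetaRepL d

theorem hochschildL_mem_pos (C : CInfinityStructure 𝒦 d) (x : TSeries ι K) :
    C.hochschildL x ∈ pos ι K := thetaInvL_mem_pos _

theorem lieDerivRep_homogeneous [GradedRing 𝒦] (C : CInfinityStructure 𝒦 d) {n : ℤ}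
    {F : TSeries₂ ι K} (hF : F ∈ homogeneous₂ 𝒦 d n) : C.lieDerivRep F ∈ homogeneous₂ 𝒦 d (n + 1) := by
  intro u v
  have h1 : sliceLeft v F ∈ homogeneous 𝒦 d (n - wordDeg d v) := fun w => by
    rw [sub_right_comm]
    exact hF w v
  have h2 : sliceRight u F ∈ homogeneous 𝒦 d (n - wordDeg d u) := fun w => hF u w
  have h1' := C.vectorField_homogeneous h1 u
  have h2' := C.vectorField_homogeneous h2 v
  rw [sub_add_eq_add_sub, sub_right_comm] at h1'
  rw [sub_add_eq_add_sub] at h2'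
  exact sub_mem h1' (sgn_smul_mem (K := K) (A := K) _ _ h2')

variable [GradedRing 𝒦] [EvenlyGraded 𝒦]

theorem hasParity_onGen (C : CInfinityStructure 𝒦 d) (a : ι) :
    HasParity d (1 + d a) (C.onGen a) := by
  rw [add_comm]
  exact hasParity_of_homogeneous (C.onGen_homogeneous a)

theorem isLieDerivation (C : CInfinityStructure 𝒦 d) : IsLieDerivation d 1 C.vectorField where
  leibniz x y := by
    rw [twist_one_eq_parity]
    exact derivation_mul d C.rowFinite x y
  mem a := by
    rw [vectorField_gen]
    exact C.onGen_mem a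
  parity a := by
    rw [vectorField_gen]
    exact C.hasParity_onGen a

theorem vectorField_parity (C : CInfinityStructure 𝒦 d) (x : TSeries ι K) :
    C.vectorField (parity d x) = -parity d (C.vectorField x) := by
  rw [← twist_one_eq_parity, C.isLieDerivation.map_twist, mul_one, sgn_one, neg_one_smul,
    twist_one_eq_parity]

/-- The extension of `m` to the tensor algebra has square zero, as the square is a derivation which
vanishes on the generators. -/
theorem vectorField_vectorField (C : CInfinityStructure 𝒦 d) (x : TSeries ι K) :
    C.vectorField (C.vectorField x) = 0 := by
  have : C.vectorField ∘L C.vectorField = 0 := by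
    refine clm_ext fun w => ?_
    rw [ContinuousLinearMap.comp_apply, _root_.zero_apply]
    induction w with
    | nil => rw [single_nil, C.isLieDerivation.map_one, map_zero]
    | cons a w ih =>
      have h0 : C.vectorField (C.vectorField (gen a)) = 0 := by
        rw [vectorField_gen]
        have := C.vectorField_eq (C.m (lieGen d a))
        rw [C.sq_zero] at this
        exact this
      have h1 : parity d (C.vectorField (gen a)) = -C.vectorField (parity d (gen a)) := by
        rw [vectorField_parity, neg_neg]
      rw [single_cons, vectorField_mul, map_add, vectorField_mul, vectorField_mul, h0,
        mul_zero_left, ih, mul_zero_right, h1, zero_add, add_zero, ← mul_add_left,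
        neg_add_cancel, mul_zero_left]
  exact DFunLike.congr_fun this x

theorem lieDerivRep_lieDerivRep (C : CInfinityStructure 𝒦 d) (F : TSeries₂ ι K) :
    C.lieDerivRep (C.lieDerivRep F) = 0 := by
  have : C.lieDerivRepL ∘L C.lieDerivRepL = 0 := clm_ext_tens fun x y => by
    rw [ContinuousLinearMap.comp_apply, _root_.zero_apply, lieDerivRepL_tens, map_sub,
      lieDerivRepL_tens, lieDerivRepL_tens, vectorField_vectorField, vectorField_vectorField,
      vectorField_parity, ← neg_one_smul K (parity d _), tens_smul_left, tens_zero_left,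
      tens_zero_right]
    module
  exact DFunLike.congr_fun this F

/-- `L_m(dtₐ·y) = -d(m(tₐ))·y - (-1)^{|tₐ|} dtₐ·m(y)`. -/
theorem hochschildL_gen_mul (C : CInfinityStructure 𝒦 d) (a : ι) (y : TSeries ι K) :
    C.hochschildL (mul (gen a) y) =
      -formCoeff d (C.onGen a) y - sgn K (d a) • mul (gen a) (C.vectorField y) := by
  have hp : parity d (gen (K := K) a) = sgn K (d a) • gen a := by
    rw [← twist_one_eq_parity, (hasParity_gen a).twist_eq, one_mul]
  have hp' : parity d (C.onGen a) = -(sgn K (d a) • C.onGen a) := by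
    rw [← vectorField_gen, ← map_smul, ← hp, vectorField_parity, neg_neg]
  have hone : parity d (one : TSeries ι K) = one := by
    rw [← twist_one_eq_parity, hasParity_one.twist_eq, mul_zero, sgn_zero, one_smul]
  rw [← formCoeff_gen (d := d) a (C.vectorField y)]
  change thetaInvL K d (C.lieDerivRepL (thetaRepL d (mul (gen a) y))) = _
  rw [thetaRepL_gen_mul, formCoeff, formCoeff, ← map_smul, ← map_neg, ← map_sub]
  congr 1
  rw [map_sub, map_smul, lieDerivRepL_tens, lieDerivRepL_tens, C.isLieDerivation.map_one,
    vectorField_mul, twist_one_eq_parity, twist_one_eq_parity, hone, hp, hp', vectorField_gen,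
    tens_zero_left, mul_smul_left, tens_add_right, tens_smul_left, tens_smul_right,
    ← neg_one_smul K (sgn K (d a) • C.onGen a), tens_smul_left, tens_smul_left]
  module

/-- The operator `1 ⊗ s` commutes with the differential of the Hochschild complex. -/
theorem oneTensorL_hochschildL (C : CInfinityStructure 𝒦 d) {x : TSeries ι K}
    (hx : x ∈ pos ι K) : oneTensorL (shuffleL d) (C.hochschildL x) =
      C.hochschildL (oneTensorL (shuffleL d) x) := by
  refine map_congr_of_mem_pos (f := oneTensorL (shuffleL d) ∘L C.hochschildL)
    (g := C.hochschildL ∘L oneTensorL (shuffleL d)) (fun a y => ?_) hx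
  rw [ContinuousLinearMap.comp_apply, ContinuousLinearMap.comp_apply, oneTensorL_gen_mul,
    hochschildL_gen_mul, hochschildL_gen_mul, map_sub, map_neg, map_smul, oneTensorL_gen_mul,
    oneTensorL_formCoeff (C.onGen_mem a) (C.hasParity_onGen a), C.isLieDerivation.shuffleL_comm]

end CInfinityStructure

end LieDerivative

/-! ### Splitting by commuting projections -/

section Splitting

variable {ι K : Type*} [CommRing K] {d : ι → ℤ}

theorem finsum_eq_sum_of_finite {J : Type*} {y : J → K} {S : Finset J}
    (h : ∀ j, y j ≠ 0 → j ∈ S) : ∑ᶠ j, y j = ∑ j ∈ S, y j :=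
  finsum_eq_sum_of_support_subset _ fun j hj => h j hj

/-- A family of series converges to its coefficientwise sum if it is locally finite. -/
theorem hasSum_pos {J : Type*} {y : J → pos ι K} {z : pos ι K}
    (hfin : ∀ w, {j | (y j : TSeries ι K) w ≠ 0}.Finite)
    (hz : ∀ w, (z : TSeries ι K) w = ∑ᶠ j, (y j : TSeries ι K) w) : HasSum y z := by
  have hind : Topology.IsInducing (pos ι K).subtype := Topology.IsInducing.subtypeVal
  rw [← hind.hasSum_iff]
  let _ : TopologicalSpace K := ⊥
  refine Pi.hasSum.2 fun w => ?_
  change HasSum (fun j => (y j : TSeries ι K) w) ((z : TSeries ι K) w)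
  rw [hz, finsum_eq_sum_of_finite (S := (hfin w).toFinset) fun j hj => by simpa using hj]
  exact hasSum_sum_of_ne_finset_zero fun j hj => by simpa using hj

/-- A locally finite family of orthogonal projections whose sum is the identity. -/
structure IsProjectionFamily {J : Type*} (e : J → pos ι K →ₗ[K] pos ι K) : Prop where
  continuous : ∀ j, Continuous (e j)
  idem : ∀ j x, e j (e j x) = e j x
  orthogonal : ∀ j k x, j ≠ k → e j (e k x) = 0
  finite : ∀ w, {j | ∃ x, (e j x : TSeries ι K) w ≠ 0}.Finite
  sum_eq : ∀ (x : pos ι K) w, ∑ᶠ j, (e j x : TSeries ι K) w = (x : TSeries ι K) w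

namespace IsProjectionFamily

variable {J : Type*} {e : J → pos ι K →ₗ[K] pos ι K}

theorem finite_apply (h : IsProjectionFamily e) (y : (j : J) → LinearMap.range (e j))
    (w : List ι) : {j | ((y j : pos ι K) : TSeries ι K) w ≠ 0}.Finite :=
  (h.finite w).subset fun j hj => by
    obtain ⟨x, hx⟩ := (y j).2
    exact ⟨x, by rw [hx]; exact hj⟩

theorem hasSum (h : IsProjectionFamily e) (x : pos ι K) : HasSum (fun j => e j x) x :=
  hasSum_pos (fun w => (h.finite w).subset fun _ hj => ⟨x, hj⟩) fun w => (h.sum_eq x w).symm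

theorem apply_range (h : IsProjectionFamily e) {j : J} {x : pos ι K}
    (hx : x ∈ LinearMap.range (e j)) : e j x = x := by
  obtain ⟨z, rfl⟩ := hx
  exact h.idem j z

/-- The sum of a family of elements of the images. -/
noncomputable def sum (_h : IsProjectionFamily e) (y : (j : J) → LinearMap.range (e j)) :
    pos ι K :=
  ⟨fun w => ∑ᶠ j, ((y j : pos ι K) : TSeries ι K) w, by
    change ∑ᶠ j, ((y j : pos ι K) : TSeries ι K) [] = 0
    exact finsum_eq_zero_of_forall_eq_zero fun j => (y j : pos ι K).2⟩

theorem sum_apply (h : IsProjectionFamily e) (y : (j : J) → LinearMap.range (e j)) (w : List ι) :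
    (h.sum y : TSeries ι K) w = ∑ᶠ j, ((y j : pos ι K) : TSeries ι K) w := rfl

theorem hasSum_sum (h : IsProjectionFamily e) (y : (j : J) → LinearMap.range (e j)) :
    HasSum (fun j => (y j : pos ι K)) (h.sum y) :=
  hasSum_pos (h.finite_apply y) fun _ => rfl

theorem apply_sum (h : IsProjectionFamily e) (y : (j : J) → LinearMap.range (e j)) (k : J) :
    e k (h.sum y) = y k := by
  have h1 := (h.hasSum_sum y).map (e k) (h.continuous k)
  have h2 : HasSum (e k ∘ fun j => (y j : pos ι K)) (y k) := by
    convert hasSum_single k fun j hj => ?_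
    · exact (h.apply_range (y k).2).symm
    · obtain ⟨x, hx⟩ := (y j).2
      rw [Function.comp_apply, ← hx, h.orthogonal _ _ _ hj.symm]
  exact h1.unique h2

theorem sum_proj (h : IsProjectionFamily e) (x : pos ι K) :
    h.sum (fun j => ⟨e j x, x, rfl⟩) = x :=
  Subtype.ext (ProMod.ext fun w => h.sum_eq x w)

theorem continuous_sum (h : IsProjectionFamily e) : Continuous h.sum := by
  refine Continuous.subtype_mk (ProMod.continuous_iff.2 fun w => ?_) _
  let _ : TopologicalSpace K := ⊥
  have : DiscreteTopology K := ⟨rfl⟩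
  have heq : (fun y : (j : J) → LinearMap.range (e j) =>
      ∑ᶠ j, ((y j : pos ι K) : TSeries ι K) w) =
      fun y => ∑ j ∈ (h.finite w).toFinset, ((y j : pos ι K) : TSeries ι K) w := by
    funext y
    refine finsum_eq_sum_of_finite fun j hj => (Set.Finite.mem_toFinset _).2 ?_
    obtain ⟨x, hx⟩ := (y j).2
    exact ⟨x, by rw [hx]; exact hj⟩
  rw [heq]
  exact continuous_finsetSum _ fun j _ => (continuous_coord w).comp
    (continuous_subtype_val.comp (continuous_subtype_val.comp (continuous_apply j)))

/-- The decomposition of series into their projections. -/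
noncomputable def equiv (h : IsProjectionFamily e) :
    pos ι K ≃L[K] ((j : J) → LinearMap.range (e j)) where
  toFun x j := ⟨e j x, x, rfl⟩
  invFun := h.sum
  map_add' x y := funext fun j => Subtype.ext (map_add (e j) x y)
  map_smul' c x := funext fun j => Subtype.ext (map_smul (e j) c x)
  left_inv x := h.sum_proj x
  right_inv y := funext fun j => Subtype.ext (h.apply_sum y j)
  continuous_toFun := continuous_pi fun j => (h.continuous j).subtype_mk _
  continuous_invFun := h.continuous_sum

/-- A continuous linear map which preserves the images of the projections commutes with the
projections. -/
theorem comm (h : IsProjectionFamily e) {δ : pos ι K →ₗ[K] pos ι K} (hδ : Continuous δ)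
    (hr : ∀ j x, δ (e j x) ∈ LinearMap.range (e j)) (j : J) (x : pos ι K) :
    e j (δ x) = δ (e j x) := by
  have h1 := ((h.hasSum x).map δ hδ).map (e j) (h.continuous j)
  have h2 : HasSum (e j ∘ δ ∘ fun k => e k x) (δ (e j x)) := by
    convert hasSum_single j fun k hk => ?_
    · exact (h.apply_range (hr j x)).symm
    · obtain ⟨z, hz⟩ := hr k x
      rw [Function.comp_apply, Function.comp_apply, ← hz, h.orthogonal _ _ _ hk.symm]
  exact h1.unique h2

theorem splitsAsProduct (h : IsProjectionFamily e) {gr : ℤ → AddSubgroup (pos ι K)}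
    {δ : pos ι K →ₗ[K] pos ι K} (hδ : Continuous δ)
    (hr : ∀ j x, δ (e j x) ∈ LinearMap.range (e j))
    (hdeg : ∀ n, ∀ x ∈ gr n, δ x ∈ gr (n + 1)) (hsq : ∀ x, δ (δ x) = 0)
    (hgr : ∀ n x, x ∈ gr n ↔ ∀ j, e j x ∈ gr n) : SplitsAsProduct gr δ e where
  degree_one := hdeg
  sq_zero := LinearMap.ext hsq
  subcomplex j x hx := by
    rw [← h.apply_range hx]
    exact hr j x
  comm j := LinearMap.ext fun x => h.comm hδ hr j x
  product := ⟨h.equiv, fun _ _ => rfl, fun x j => h.comm hδ hr j x, h.hasSum_sum, hgr⟩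

end IsProjectionFamily

end Splitting

/-! ### The Hodge decompositions -/

section Hodge

variable {ι K : Type*} [CommRing K] {d : ι → ℤ}

theorem leftPart_homogeneous {𝒦 : ℤ → AddSubgroup K} {n : ℤ} {x : TSeries ι K}
    (hx : x ∈ homogeneous 𝒦 d n) (a : ι) : leftPart a x ∈ homogeneous 𝒦 d (n - d a) := fun w => by
  rw [sub_sub, ← wordDeg_cons]
  exact hx (a :: w)

theorem shuffleCoeff_mem (𝒦 : ℤ → AddSubgroup K) (u v : List ι) {n : ℤ} {x : TSeries ι K}
    (hx : x ∈ homogeneous 𝒦 d n) :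
    shuffleCoeff d u v x ∈ 𝒦 (n - (wordDeg d u + wordDeg d v)) := by
  fun_induction shuffleCoeff d u v x generalizing n with
  | case1 v x => rw [wordDeg_nil, zero_add]; exact hx v
  | case2 a u x => rw [wordDeg_nil, add_zero]; exact hx (a :: u)
  | case3 a u b v x ih1 ih2 =>
    have h1 := ih1 (leftPart_homogeneous hx a)
    have h2 := CInfinityStructure.sgn_smul_mem (K := K) (A := K) _ (d b * wordDeg d (a :: u))
      (ih2 (leftPart_homogeneous hx b))
    have e1 : n - d a - (wordDeg d u + wordDeg d (b :: v)) =
        n - (wordDeg d (a :: u) + wordDeg d (b :: v)) := by rw [wordDeg_cons d a]; ring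
    have e2 : n - d b - (wordDeg d (a :: u) + wordDeg d v) =
        n - (wordDeg d (a :: u) + wordDeg d (b :: v)) := by rw [wordDeg_cons d b]; ring
    rw [e1] at h1
    rw [e2] at h2
    exact add_mem h1 h2

theorem shuffleOp_homogeneous (𝒦 : ℤ → AddSubgroup K) {n : ℤ} {x : TSeries ι K}
    (hx : x ∈ homogeneous 𝒦 d n) : shuffleOp d x ∈ homogeneous 𝒦 d n := by
  intro w
  change ∑ k ∈ Finset.range (w.length + 1), shuffleCoeff d (w.take k) (w.drop k) x ∈ _
  refine sum_mem fun k _ => ?_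
  have := shuffleCoeff_mem 𝒦 (w.take k) (w.drop k) hx
  rwa [wordDeg_take_add_drop] at this

theorem leftPart_oneTensor (f : TSeries ι K →ₗ[K] TSeries ι K) (x : pos ι K) (a : ι) :
    leftPart a (oneTensor f x : TSeries ι K) = f (leftPart a x) := rfl

/-- Series without constant term are determined by their left parts. -/
theorem pos_ext {x y : pos ι K}
    (h : ∀ a, leftPart a (x : TSeries ι K) = leftPart a (y : TSeries ι K)) : x = y := by
  refine Subtype.ext (ProMod.ext fun w => ?_)
  match w with
  | [] => exact Eq.trans x.2 (Eq.symm y.2)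
  | a :: w => exact congrFun (h a) w

theorem oneTensorL_eq (x : pos ι K) :
    oneTensorL (shuffleL d) (x : TSeries ι K) = shuffleOpTilde d x := by
  ext w
  match w with
  | [] => rfl
  | a :: w => rfl

/-- Composing with `1 ⊗ f` preserves eigenprojections. -/
theorem isEigenprojection_oneTensor {s e : TSeries ι K →ₗ[K] TSeries ι K} {c : K}
    (hs : ∀ x, s (e x) = c • e x) (he : ∀ x, s x = c • x → e x = x) :
    IsEigenprojection (oneTensor s) (oneTensor e) c where
  idempotent := LinearMap.ext fun x => pos_ext fun a => by
    rw [LinearMap.comp_apply, leftPart_oneTensor, leftPart_oneTensor, he _ (hs _)]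
  range_eq := by
    ext x
    rw [Module.End.mem_eigenspace_iff]
    constructor
    · rintro ⟨y, rfl⟩
      refine pos_ext fun a => ?_
      rw [leftPart_oneTensor, leftPart_oneTensor, hs]
      rfl
    · intro hx
      refine ⟨x, pos_ext fun a => ?_⟩
      rw [leftPart_oneTensor]
      refine he _ ?_
      have := congrArg (fun y : pos ι K => leftPart a (y : TSeries ι K)) hx
      rw [leftPart_oneTensor] at this
      exact this

/-- A series is homogeneous if its projections are. -/
theorem IsProjectionFamily.mem_suspHomogeneous {J : Type*} {e : J → pos ι K →ₗ[K] pos ι K}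
    (h : IsProjectionFamily e) {𝒦 : ℤ → AddSubgroup K} {n : ℤ} {x : pos ι K}
    (hx : ∀ j, e j x ∈ suspHomogeneous 𝒦 d n) : x ∈ suspHomogeneous 𝒦 d n := fun w => by
  change (x : TSeries ι K) w ∈ _
  rw [← h.sum_eq x w]
  exact finsum_induction (· ∈ 𝒦 (n + 1 - wordDeg d w)) (zero_mem _)
    (fun _ _ => add_mem) fun j => hx j w

variable [Algebra ℚ K]

/-- Rational numbers are homogeneous of degree zero. -/
theorem algebraMap_rat_mem (𝒦 : ℤ → AddSubgroup K) [GradedRing 𝒦] (c : ℚ) :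
    algebraMap ℚ K c ∈ 𝒦 0 := by
  have h1 : GradedRing.proj 𝒦 0 (1 : K) = 1 := by
    rw [GradedRing.proj_apply, DirectSum.decompose_of_mem_same 𝒦 SetLike.GradedOne.one_mem]
  have h2 : GradedRing.proj 𝒦 0 (algebraMap ℚ K c) = algebraMap ℚ K c := by
    rw [Algebra.algebraMap_eq_smul_one, map_rat_smul, h1]
  rw [← h2, GradedRing.proj_apply]
  exact SetLike.coe_mem _

theorem algebraMap_rat_smul_mem (𝒦 : ℤ → AddSubgroup K) [GradedRing 𝒦] (c : ℚ) {n : ℤ}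
    {x : TSeries ι K} (hx : x ∈ homogeneous 𝒦 d n) :
    algebraMap ℚ K c • x ∈ homogeneous 𝒦 d n := fun w => by
  have := SetLike.mul_mem_graded (algebraMap_rat_mem 𝒦 c) (hx w)
  rwa [zero_add] at this

open Polynomial in
theorem aeval_homogeneous (𝒦 : ℤ → AddSubgroup K) [GradedRing 𝒦] (P : ℚ[X]) {n : ℤ}
    {x : TSeries ι K} (hx : x ∈ homogeneous 𝒦 d n) :
    aeval (shuffleOp d) (P.map (algebraMap ℚ K)) x ∈ homogeneous 𝒦 d n := by
  induction P using Polynomial.induction_on' with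
  | add P Q hP hQ =>
    rw [Polynomial.map_add, map_add, LinearMap.add_apply]
    exact add_mem hP hQ
  | monomial m c =>
    rw [Polynomial.map_monomial, aeval_monomial, Module.End.mul_apply,
      Module.algebraMap_end_apply]
    refine algebraMap_rat_smul_mem 𝒦 c ?_
    induction m with
    | zero => exact hx
    | succ m ih =>
      rw [pow_succ', Module.End.mul_apply]
      exact shuffleOp_homogeneous 𝒦 ih

theorem hodgeProj_homogeneous (𝒦 : ℤ → AddSubgroup K) [GradedRing 𝒦] (j : ℕ) {n : ℤ}
    {x : TSeries ι K} (hx : x ∈ homogeneous 𝒦 d n) :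
    hodgeProj d j x ∈ homogeneous 𝒦 d n := fun w => aeval_homogeneous 𝒦 _ hx w

theorem isEigenprojection_hodgeProjPos (j : ℕ) :
    IsEigenprojection (K := K) (shuffleOpPos d) (hodgeProjPos d j) (2 ^ j) where
  idempotent := LinearMap.ext fun x => Subtype.ext <| by
    change hodgeProj d j (hodgeProj d j (x : TSeries ι K)) = hodgeProj d j (x : TSeries ι K)
    rw [hodgeProj_hodgeProj, if_pos rfl]
  range_eq := by
    ext x
    rw [Module.End.mem_eigenspace_iff]
    constructor
    · rintro ⟨y, rfl⟩
      exact Subtype.ext (shuffleOp_hodgeProj j _)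
    · intro hx
      exact ⟨x, Subtype.ext (hodgeProj_of_shuffleOp_eq (congrArg Subtype.val hx))⟩

theorem isEigenprojection_hodgeProjTilde (j : ℕ) :
    IsEigenprojection (K := K) (shuffleOpTilde d) (hodgeProjTilde d j) (2 ^ j) :=
  isEigenprojection_oneTensor (shuffleOp_hodgeProj j) fun _ => hodgeProj_of_shuffleOp_eq

theorem finsum_hodgeProj (x : TSeries ι K) (w : List ι) : ∑ᶠ j, hodgeProj d j x w = x w := by
  rw [finsum_eq_sum_of_finite (S := Finset.range (w.length + 1)), sum_hodgeProj]
  intro j hj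
  rw [Finset.mem_range]
  by_contra h
  exact hj (hodgeProj_eq_zero_of_lt (by omega) x)

/-- On series without constant term the projection `e(0)` vanishes, so that the projections `e(j)`,
`j ≥ 1`, suffice. -/
theorem isProjectionFamily_hodgeProjPos :
    IsProjectionFamily (ι := ι) (K := K) fun j : ℕ+ => hodgeProjPos d j where
  continuous j := ((continuous_hodgeProj (j : ℕ)).comp continuous_subtype_val).subtype_mk _
  idem j x := DFunLike.congr_fun (isEigenprojection_hodgeProjPos (j : ℕ)).idempotent x
  orthogonal j k x hjk := Subtype.ext <| by
    change hodgeProj d j (hodgeProj d k (x : TSeries ι K)) = 0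
    rw [hodgeProj_hodgeProj, if_neg fun h => hjk (PNat.coe_injective h)]
  finite w := by
    refine ((Finset.range (w.length + 1)).finite_toSet.preimage
      (f := ((↑) : ℕ+ → ℕ)) PNat.coe_injective.injOn).subset ?_
    rintro j ⟨x, hx⟩
    rw [Set.mem_preimage, Finset.mem_coe, Finset.mem_range]
    by_contra h
    exact hx (hodgeProj_eq_zero_of_lt (by omega) _)
  sum_eq x w := by
    classical
    change ∑ᶠ j : ℕ+, hodgeProj d j (x : TSeries ι K) w = _
    have h0 : hodgeProj d 0 (x : TSeries ι K) w = 0 := by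
      match w with
      | [] => exact hodgeProj_mem_pos d 0 x.2
      | a :: w => exact hodgeProj_zero_of_ne_nil (by simp) _
    rw [← finsum_hodgeProj (d := d) (x : TSeries ι K) w]
    rw [← finsum_mem_range (f := fun j : ℕ => hodgeProj d j (x : TSeries ι K) w)
      PNat.coe_injective]
    refine finsum_congr fun j => ?_
    rcases Nat.eq_zero_or_pos j with rfl | hj
    · simp [h0]
    · rw [finsum_eq_if, if_pos ⟨⟨j, hj⟩, rfl⟩]

theorem isProjectionFamily_hodgeProjTilde :
    IsProjectionFamily (ι := ι) (K := K) fun j : ℕ => hodgeProjTilde d j where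
  continuous j := by
    have h : Continuous fun x : pos ι K => oneTensorL (hodgeProjL d j) (x : TSeries ι K) :=
      (oneTensorL (hodgeProjL d j)).continuous.comp continuous_subtype_val
    convert h.subtype_mk (p := (· ∈ pos ι K)) fun x => oneTensorL_nil _ _ using 2
    exact pos_ext fun _ => rfl
  idem j x := DFunLike.congr_fun (isEigenprojection_hodgeProjTilde j).idempotent x
  orthogonal j k x hjk := pos_ext fun a => by
    change hodgeProj d j (hodgeProj d k _) = 0
    rw [hodgeProj_hodgeProj, if_neg hjk]
  finite w := by
    refine (Finset.range (w.length + 1)).finite_toSet.subset ?_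
    rintro j ⟨x, hx⟩
    rw [Finset.mem_coe, Finset.mem_range]
    match w with
    | [] => exact absurd rfl hx
    | a :: w =>
      by_contra h
      rw [List.length_cons] at h
      exact hx (hodgeProj_eq_zero_of_lt (by omega) _)
  sum_eq x w := by
    match w with
    | [] => exact (finsum_eq_zero_of_forall_eq_zero fun _ => rfl).trans (Eq.symm x.2)
    | a :: w => exact finsum_hodgeProj (leftPart a (x : TSeries ι K)) w

theorem hodgeProjTilde_mem_suspHomogeneous (𝒦 : ℤ → AddSubgroup K) [GradedRing 𝒦] (j : ℕ) {n : ℤ}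
    {x : pos ι K} (hx : x ∈ suspHomogeneous 𝒦 d n) :
    hodgeProjTilde d j x ∈ suspHomogeneous 𝒦 d n := fun w => by
  match w with
  | [] => exact zero_mem _
  | a :: w =>
    have := hodgeProj_homogeneous 𝒦 j (leftPart_homogeneous (hx : _ ∈ homogeneous 𝒦 d (n + 1)) a) w
    rw [sub_sub, ← wordDeg_cons] at this
    exact this

namespace CInfinityStructure

variable {𝒦 : ℤ → AddSubgroup K} [GradedRing 𝒦] [EvenlyGraded 𝒦]

theorem splitsAsProduct_barDiff (C : CInfinityStructure 𝒦 d) :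
    SplitsAsProduct (K := K) (suspHomogeneous 𝒦 d) C.barDiff
      (fun j : ℕ+ => hodgeProjPos d j) := by
  have hfam := isProjectionFamily_hodgeProjPos (ι := ι) (K := K) (d := d)
  refine hfam.splitsAsProduct
    ((C.vectorField.continuous.comp continuous_subtype_val).subtype_mk _) (fun j x => ?_)
    (fun n x hx => C.vectorField_homogeneous hx)
    (fun x => Subtype.ext (C.vectorField_vectorField x))
    fun n x => ⟨fun hx j => hodgeProj_homogeneous 𝒦 j hx, hfam.mem_suspHomogeneous⟩
  -- The differential commutes with `s`, hence preserves its eigenspaces.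
  rw [(isEigenprojection_hodgeProjPos (j : ℕ)).range_eq, Module.End.mem_eigenspace_iff]
  refine Subtype.ext ?_
  change shuffleL d (C.vectorField (hodgeProj d j x)) =
    (2 : K) ^ (j : ℕ) • C.vectorField (hodgeProj d j x)
  rw [C.isLieDerivation.shuffleL_comm, shuffleL_apply, shuffleOp_hodgeProj, map_smul]

/-- The differential `Θ⁻¹ L_m Θ` on series without constant term. -/
noncomputable def hochschildDiff (C : CInfinityStructure 𝒦 d) : pos ι K →ₗ[K] pos ι K :=
  (C.hochschildL : TSeries ι K →ₗ[K] TSeries ι K).restrict fun x _ => C.hochschildL_mem_pos x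

theorem splitsAsProduct_hochschildDiff (C : CInfinityStructure 𝒦 d)
    (hsq : ∀ x, C.hochschildDiff (C.hochschildDiff x) = 0)
    (hdeg : ∀ n, ∀ x ∈ suspHomogeneous 𝒦 d n, C.hochschildDiff x ∈ suspHomogeneous 𝒦 d (n + 1)) :
    SplitsAsProduct (K := K) (suspHomogeneous 𝒦 d) C.hochschildDiff
      (fun j : ℕ => hodgeProjTilde d j) := by
  have hfam := isProjectionFamily_hodgeProjTilde (ι := ι) (K := K) (d := d)
  refine hfam.splitsAsProduct
    ((C.hochschildL.continuous.comp continuous_subtype_val).subtype_mk _) (fun j x => ?_)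
    hdeg hsq fun n x => ⟨fun hx j => hodgeProjTilde_mem_suspHomogeneous 𝒦 j hx,
      hfam.mem_suspHomogeneous⟩
  have hr := (isEigenprojection_hodgeProjTilde (K := K) (d := d) j).range_eq
  have hx : shuffleOpTilde d (hodgeProjTilde d j x) = (2 : K) ^ j • hodgeProjTilde d j x := by
    rw [← Module.End.mem_eigenspace_iff, ← hr]
    exact ⟨x, rfl⟩
  rw [hr, Module.End.mem_eigenspace_iff]
  refine Subtype.ext ?_
  rw [← oneTensorL_eq]
  change oneTensorL (shuffleL d) (C.hochschildL (hodgeProjTilde d j x : pos ι K)) = _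
  rw [C.oneTensorL_hochschildL (hodgeProjTilde d j x).2, oneTensorL_eq, hx]
  exact map_smul C.hochschildL _ _

end CInfinityStructure

end Hodge

/-! ### The isomorphism `Θ` -/

section Theta

variable {ι K : Type*} [CommRing K] {d : ι → ℤ}

theorem thetaRepL_homogeneous (𝒦 : ℤ → AddSubgroup K) {n : ℤ} {x : TSeries ι K}
    (hx : x ∈ homogeneous 𝒦 d n) : thetaRepL d x ∈ homogeneous₂ 𝒦 d n := by
  intro u v
  match u with
  | [] =>
    rw [wordDeg_nil, sub_zero]
    exact hx v
  | [a] =>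
    have := CInfinityStructure.sgn_smul_mem (K := K) (A := K) _ (d a) (hx (a :: v))
    rw [wordDeg_cons, ← sub_sub] at this
    rw [wordDeg_cons, wordDeg_nil, add_zero]
    exact neg_mem this
  | _ :: _ :: _ => exact zero_mem _

theorem CInfinityStructure.hochschildDiff_mem {𝒦 : ℤ → AddSubgroup K} [GradedRing 𝒦]
    (C : CInfinityStructure 𝒦 d) {n : ℤ} {x : pos ι K}
    (hx : x ∈ suspHomogeneous 𝒦 d n) : C.hochschildDiff x ∈ suspHomogeneous 𝒦 d (n + 1) :=
  thetaInvL_homogeneous 𝒦 (C.lieDerivRep_homogeneous (thetaRepL_homogeneous 𝒦 hx))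

variable (𝒦 : ℤ → AddSubgroup K) [GradedRing 𝒦] [EvenlyGraded 𝒦]

theorem mkQ_thetaRepL_thetaInvL (F : TSeries₂ ι K) :
    (oneFormRel 𝒦 d).mkQ (thetaRepL d (thetaInvL K d F)) = (oneFormRel 𝒦 d).mkQ F :=
  ((Submodule.Quotient.eq _).2 (sub_thetaRepL_thetaInvL_mem 𝒦 F)).symm

/-- The inverse of `Θ`. -/
noncomputable def thetaInv (d : ι → ℤ) : DR1 𝒦 d →ₗ[K] pos ι K :=
  (oneFormRel 𝒦 d).liftQ
    ((thetaInvL K d : TSeries₂ ι K →ₗ[K] TSeries ι K).codRestrict (pos ι K) thetaInvL_mem_pos)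
    fun _ hF => Subtype.ext (thetaInvL_eq_zero 𝒦 hF)

/-- The isomorphism `Θ` of topological modules. -/
noncomputable def thetaEquiv (d : ι → ℤ) : pos ι K ≃L[K] DR1 𝒦 d where
  toLinearMap := theta 𝒦 d
  invFun := thetaInv 𝒦 d
  left_inv x := Subtype.ext (thetaInvL_thetaRepL x.2)
  right_inv F := by
    obtain ⟨F, rfl⟩ := (oneFormRel 𝒦 d).mkQ_surjective F
    exact mkQ_thetaRepL_thetaInvL 𝒦 F
  continuous_toFun := continuous_quot_mk.comp
    ((thetaRepL d).continuous.comp continuous_subtype_val)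
  continuous_invFun := continuous_quot_lift _ ((thetaInvL K d).continuous.subtype_mk _)

theorem mem_suspHomogeneous_iff_theta (n : ℤ) (x : pos ι K) :
    x ∈ suspHomogeneous 𝒦 d n ↔ theta 𝒦 d x ∈ DR1.homogeneous 𝒦 d (n + 1) := by
  constructor
  · intro hx
    exact ⟨thetaRepL d x, thetaRepL_homogeneous 𝒦 hx, rfl⟩
  · rintro ⟨F, hF, h⟩
    have h' : F - thetaRepL d (x : TSeries ι K) ∈ oneFormRel 𝒦 d := (Submodule.Quotient.eq _).1 h
    have h0 := thetaInvL_eq_zero 𝒦 h'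
    rw [map_sub, thetaInvL_thetaRepL x.2, sub_eq_zero] at h0
    change (x : TSeries ι K) ∈ homogeneous 𝒦 d (n + 1)
    rw [← h0]
    exact thetaInvL_homogeneous 𝒦 hF

namespace CInfinityStructure

variable {𝒦}

theorem theta_hochschildDiff (C : CInfinityStructure 𝒦 d) (x : pos ι K) :
    theta 𝒦 d (C.hochschildDiff x) = C.lieDeriv (theta 𝒦 d x) :=
  mkQ_thetaRepL_thetaInvL 𝒦 (C.lieDerivRepL (thetaRepL d (x : TSeries ι K)))

theorem hochschildDiff_hochschildDiff (C : CInfinityStructure 𝒦 d) (x : pos ι K) :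
    C.hochschildDiff (C.hochschildDiff x) = 0 := by
  refine (thetaEquiv 𝒦 d).injective ?_
  change theta 𝒦 d _ = theta 𝒦 d 0
  rw [theta_hochschildDiff, theta_hochschildDiff, map_zero]
  change (oneFormRel 𝒦 d).mkQ (C.lieDerivRep (C.lieDerivRep (thetaRep d (x : TSeries ι K)))) = 0
  rw [lieDerivRep_lieDerivRep, map_zero]

end CInfinityStructure

end Theta

end FormalGeometry

open FormalGeometry in
theorem mainTheorem1 {K : Type*} [CommRing K] [Algebra ℚ K] (𝒦 : ℤ → AddSubgroup K) [GradedRing 𝒦]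
    [EvenlyGraded 𝒦] {V : Type*} [AddCommGroup V] [Module K V] (𝒱 : ℤ → AddSubgroup V)
    [DirectSum.Decomposition 𝒱] [SetLike.GradedSMul 𝒦 𝒱] {ι : Type*} (B : HomogeneousBasis K 𝒱 ι)
    (C : CInfinityStructure 𝒦 B.dualDegree) :
    ((∀ j : ℕ, 1 ≤ j → IsEigenprojection (K := K)
        (shuffleOpPos B.dualDegree) (hodgeProjPos B.dualDegree j) (2 ^ j)) ∧
      SplitsAsProduct (K := K) (suspHomogeneous 𝒦 B.dualDegree) C.barDiff
        (fun j : ℕ+ => hodgeProjPos B.dualDegree j)) ∧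
    ((∀ j : ℕ, IsEigenprojection (K := K)
        (shuffleOpTilde B.dualDegree) (hodgeProjTilde B.dualDegree j) (2 ^ j)) ∧
      ∃ Θ : pos ι K ≃L[K] DR1 𝒦 B.dualDegree,
        (∀ x, Θ x = theta 𝒦 B.dualDegree x) ∧
        (∀ n x, x ∈ suspHomogeneous 𝒦 B.dualDegree n ↔
          Θ x ∈ DR1.homogeneous 𝒦 B.dualDegree (n + 1)) ∧
        ∃ b : pos ι K →ₗ[K] pos ι K,
          (∀ x, Θ (b x) = C.lieDeriv (Θ x)) ∧
          SplitsAsProduct (K := K) (suspHomogeneous 𝒦 B.dualDegree) b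
            (fun j : ℕ => hodgeProjTilde B.dualDegree j)) := by
  refine ⟨⟨fun j _ => isEigenprojection_hodgeProjPos j, C.splitsAsProduct_barDiff⟩,
    isEigenprojection_hodgeProjTilde, thetaEquiv 𝒦 B.dualDegree, fun _ => rfl,
    mem_suspHomogeneous_iff_theta 𝒦, C.hochschildDiff, C.theta_hochschildDiff,
    C.splitsAsProduct_hochschildDiff C.hochschildDiff_hochschildDiff
      fun _ _ => C.hochschildDiff_mem⟩
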